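/- For a probability measure $\eta$ on $\mathbb R$ let $F_\eta(x)=\eta((-\infty,x])$ and $F_\eta^{-1}(u)=\inf\{x\in\mathbb R: F_\eta(x)\ge u\}$, $u\in(0,1)$. For $\rho\ge 1$ let $\mathcal P_\rho(\mathbb R)$ be the set of probability measures on $\mathbb R$ with finite moment of order $\rho$, let $\Pi(\mu,\nu)$ be the set of couplings of $\mu$ and $\nu$, and let $$\mathcal W_\rho(\mu,\nu)=\inf_{\pi\in\Pi(\mu,\nu)}\Big(\int |x-y|^\rho\,\pi(dx,dy)\Big)^{1/\rho}.$$ For $\pi(dx,dy)=\mu(dx)\,\pi_x(dy)$ and $\pi'(dx',dy')=\mu'(dx')\,\pi'_{x'}(dy')$ the adapted Wasserstein distance is $$\mathcal{AW}_\rho(\pi,\pi')=\inf_{\chi\in\Pi(\mu,\mu')}\Big(\int\big(|x-x'|^\rho+\mathcal W_\rho^\rho(\pi_x,\pi'_{x'})\big)\,\chi(dx,dx')\Big)^{1/\rho}.$$ Write $\mu\le_{cx}\nu$ if $\int f\,d\mu\le\int f\,d\nu$ for every convex $f:\mathbb R\to\mathbb R$ for which both integrals exist. For $\mu,\nu\in\mathcal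 P_1(\mathbb R)$ with $\mu\le_{cx}\nu$ put $\Psi_\pm(u)=\int_0^u (F_\mu^{-1}-F_\nu^{-1})^\pm(v)\,dv$, $u\in[0,1]$, with left-continuous generalised inverses $\Psi_\pm^{-1}(s)=\inf\{r\in[0,1]:\Psi_\pm(r)\ge s\}$; let $\varphi(u)$ be $\Psi_-^{-1}(\Psi_+(u))$ if $F_\mu^{-1}(u)>F_\nu^{-1}(u)$, $\Psi_+^{-1}(\Psi_-(u))$ if $F_\mu^{-1}(u)<F_\nu^{-1}(u)$, and $u$ otherwise; let $$p(u)=\mathbf 1_{\{F_\mu^{-1}(u)\ne F_\nu^{-1}(u)\}}\frac{F_\mu^{-1}(u)-F_\nu^{-1}(u)}{F_\nu^{-1}(\varphi(u))-F_\nu^{-1}(u)},\qquad \widetilde m_u=p(u)\,\delta_{F_\nu^{-1}(\varphi(u))}+(1-p(u))\,\delta_{F_\nu^{-1}(u)}.$$ The inverse transform martingale coupling between $\mu$ and $\nu$ is $M^{IT}(dx,dy)=\int_0^1\delta_{F_\mu^{-1}(u)}(dx)\,\widetilde m_u(dy)\,du$. **Proposition.** Let $\rho\ge1$, let $\mu_n,\nu_n,\mu,\nu\in\mathcal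 P_\rho(\mathbb R)$ for $n\in\mathbb N$ with $\mu_n\le_{cx}\nu_n$ for all $n$, and suppose that $\mathcal W_\rho(\mu_n,\mu)\to0$ and $\mathcal W_\rho(\nu_n,\nu)\to0$. Suppose that, asymptotically, every jump of $F_\mu$ is contained in a jump of $F_{\mu_n}$: for every $x\in\mathbb R$ with $\mu(\{x\})>0$ there is a real sequence $(x_n)$ such that $$\min\big(F_{\mu_n}(x_n),F_\mu(x)\big)-\max\big(F_{\mu_n}(x_n-),F_\mu(x-)\big)\longrightarrow\mu(\{x\}).\qquad(*)$$ Then the inverse transform martingale couplings $M^{IT}_n$ between $\mu_n$ and $\nu_n$ and $M^{IT}$ between $\mu$ and $\nu$ satisfy $\mathcal{AW}_\rho(M^{IT}_n,M^{IT})\to0$. Condition $(*)$ holds in particular if $\mu$ has no atoms. Condition $(*)$ cannot be dropped: for every $\rho\ge1$, the uniform distributions $\mu_n=\mathcal U((-\frac1{n+1},\frac1{n+1}))$, $\mu=\delta_0$ and $\nu_n=\nu=\mathcal U((-1,1))$ satisfy all the other assumptions, do not satisfy $(*)$, and $\mathcal{AW}_\rho(M^{IT}_n,M^{IT})\ge\frac14$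 for all $n\in\mathbb N$. -/

import Mathlib

open MeasureTheory ProbabilityTheory Filter Topology

noncomputable section

namespace ITMC

/-- `η ∈ 𝒫_ρ(ℝ)`: `η` is a probability measure on the real line with finite moment of order `ρ`. -/
structure MemP (ρ : ℝ) (η : Measure ℝ) : Prop where
  isProbabilityMeasure : IsProbabilityMeasure η
  integrable_abs_rpow : Integrable (fun x : ℝ => |x| ^ ρ) η

/-- The convex order `μ ≤_cx ν` (used for measures with finite first moment):
`∫ f dμ ≤ ∫ f dν` for every convex `f : ℝ → ℝ` whose two integrals exist. -/
def ConvexOrder (μ ν : Measure ℝ) : Prop :=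
  ∀ f : ℝ → ℝ, ConvexOn ℝ Set.univ f → Integrable f μ → Integrable f ν →
    ∫ x, f x ∂μ ≤ ∫ y, f y ∂ν

/-- `π ∈ Π(μ, ν)`. -/
def IsCoupling (π : Measure (ℝ × ℝ)) (μ ν : Measure ℝ) : Prop :=
  π.fst = μ ∧ π.snd = ν

/-- The Wasserstein distance with index `ρ` on the real line, with values in `[0, ∞]`. -/
def wasserstein (ρ : ℝ) (μ ν : Measure ℝ) : ENNReal :=
  ⨅ (π : Measure (ℝ × ℝ)) (_ : IsCoupling π μ ν),
    (∫⁻ z, ‖z.1 - z.2‖ₑ ^ ρ ∂π) ^ (1 / ρ)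

/-- The adapted Wasserstein distance with index `ρ`, with values in `[0, ∞]`: the infimum over the
couplings `χ` of the first marginals of
`(∫ (|x - x'| ^ ρ + W_ρ(π_x, π'_x') ^ ρ) χ(dx, dx')) ^ (1 / ρ)`, where `κ = (π_x)` and
`κ' = (π'_x')` are disintegrations of `π` and `π'` with respect to their first marginals.
Disintegrations are unique up to null sets of the first marginals and so the integral does not
depend on the choice of `κ` and `κ'`. -/
def adaptedWasserstein (ρ : ℝ) (π π' : Measure (ℝ × ℝ)) : ENNReal :=
  ⨅ (κ : Kernel ℝ ℝ) (_ : IsMarkovKernel κ) (_ : π.IsCondKernel κ)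
    (κ' : Kernel ℝ ℝ) (_ : IsMarkovKernel κ') (_ : π'.IsCondKernel κ')
    (χ : Measure (ℝ × ℝ)) (_ : IsCoupling χ π.fst π'.fst),
    (∫⁻ z, (‖z.1 - z.2‖ₑ ^ ρ + wasserstein ρ (κ z.1) (κ' z.2) ^ ρ) ∂χ) ^ (1 / ρ)

/-- The quantile function `F_η⁻¹(u) = inf {x | F_η(x) ≥ u}`; only its values at `u ∈ (0, 1)`
are meaningful. -/
def quantile (η : Measure ℝ) (u : ℝ) : ℝ :=
  sInf {x : ℝ | u ≤ cdf η x}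

/-- `Ψ₊(u) = ∫₀ᵘ (F_μ⁻¹ - F_ν⁻¹)⁺(v) dv`. -/
def psiPlus (μ ν : Measure ℝ) (u : ℝ) : ℝ :=
  ∫ v in (0 : ℝ)..u, max (quantile μ v - quantile ν v) 0

/-- `Ψ₋(u) = ∫₀ᵘ (F_μ⁻¹ - F_ν⁻¹)⁻(v) dv`. -/
def psiMinus (μ ν : Measure ℝ) (u : ℝ) : ℝ :=
  ∫ v in (0 : ℝ)..u, max (-(quantile μ v - quantile ν v)) 0

/-- The left-continuous generalised inverse of a nondecreasing function `Ψ` on `[0, 1]`. -/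
def genInv (Ψ : ℝ → ℝ) (s : ℝ) : ℝ :=
  sInf {r : ℝ | r ∈ Set.Icc (0 : ℝ) 1 ∧ s ≤ Ψ r}

open scoped Classical in
/-- The map `φ`: `Ψ₋⁻¹ ∘ Ψ₊` where `F_μ⁻¹ > F_ν⁻¹`, `Ψ₊⁻¹ ∘ Ψ₋` where `F_μ⁻¹ < F_ν⁻¹`, and the
identity where `F_μ⁻¹ = F_ν⁻¹`. -/
def phi (μ ν : Measure ℝ) (u : ℝ) : ℝ :=
  if quantile ν u < quantile μ u then genInv (psiMinus μ ν) (psiPlus μ ν u)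
  else if quantile μ u < quantile ν u then genInv (psiPlus μ ν) (psiMinus μ ν u)
  else u

open scoped Classical in
/-- The weight `p(u) = 1_{F_μ⁻¹(u) ≠ F_ν⁻¹(u)} (F_μ⁻¹(u) - F_ν⁻¹(u)) / (F_ν⁻¹(φ(u)) - F_ν⁻¹(u))`. -/
def weight (μ ν : Measure ℝ) (u : ℝ) : ℝ :=
  if quantile μ u ≠ quantile ν u then
    (quantile μ u - quantile ν u) / (quantile ν (phi μ ν u) - quantile ν u)
  else 0

/-- `m̃_u = p(u) δ_{F_ν⁻¹(φ(u))} + (1 - p(u)) δ_{F_ν⁻¹(u)}`. When `μ ≤_cx ν`, one has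
`p(u) ∈ [0, 1]` and `φ(u) ∈ (0, 1)` for almost every `u ∈ (0, 1)`. -/
def kernelIT (μ ν : Measure ℝ) (u : ℝ) : Measure ℝ :=
  ENNReal.ofReal (weight μ ν u) • Measure.dirac (quantile ν (phi μ ν u)) +
    ENNReal.ofReal (1 - weight μ ν u) • Measure.dirac (quantile ν u)

/-- The inverse transform martingale coupling
`M(dx, dy) = ∫₀¹ δ_{F_μ⁻¹(u)}(dx) m̃_u(dy) du` between `μ` and `ν` with `μ ≤_cx ν`. -/
def couplingIT (μ ν : Measure ℝ) : Measure (ℝ × ℝ) :=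
  (volume.restrict (Set.Ioo (0 : ℝ) 1)).bind
    (fun u => (Measure.dirac (quantile μ u)).prod (kernelIT μ ν u))

/-- Asymptotically, every jump of `F_μ` is contained in a jump of `F_{μ_n}`. -/
def JumpsAsymptoticallyContained (μs : ℕ → Measure ℝ) (μ : Measure ℝ) : Prop :=
  ∀ x : ℝ, 0 < μ {x} → ∃ xs : ℕ → ℝ,
    Tendsto (fun n => min (cdf (μs n) (xs n)) (cdf μ x) -
      max (Function.leftLim (cdf (μs n)) (xs n)) (Function.leftLim (cdf μ) x))
      atTop (𝓝 (μ.real {x}))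

/-- The uniform distribution on the interval `(a, b)`. -/
def uniformIoo (a b : ℝ) : Measure ℝ :=
  ProbabilityTheory.cond volume (Set.Ioo a b)

end ITMC

end

namespace ITMC

/-! Everything is parametrised by the quantile level `u`, uniform on (0,1). The lifted kernels m̃_u
are stable. The integrals Ψ₊ and Ψ₋ converge because the quantile functions converge in L¹, their
generalised inverses converge at almost every level, and so φ_n and p_n converge for almost every
`u` with F_μ⁻¹(u) ≠ F_ν⁻¹(u). Where the two quantiles agree, φ_n may be erratic, but weight times
displacement is |F_{μ_n}⁻¹ - F_{ν_n}⁻¹|(u) → 0, so no mass is moved a positive distance in the limit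
(`ae_tendsto_liftCdf`).

The disintegration of M^IT averages m̃_u over all levels with the same value F_μ⁻¹(u): its
distribution function at y is the conditional expectation of that of m̃_u given F_μ⁻¹
(`PsiOrdered.kernel_ae_eq_condExp`). What remains is L¹ convergence of conditional expectations
given F_{μ_n}⁻¹ to those given F_μ⁻¹ (`tendsto_condGap_quantile`). Outside the atoms of μ one has u
= F_μ(F_μ⁻¹(u)), so a function of u is a function of F_μ⁻¹, which is asymptotically a function of
F_{μ_n}⁻¹. On an atom the limit averages over a whole interval of levels, and the condition on the
jumps says that the approximations eventually average over nearly all of it too.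

The adapted distance is bounded by comonotone couplings at both stages (`adaptedWasserstein_le`).
Along a subsequence the quantile functions of the disintegrations converge almost everywhere on the
unit square. Their moments of order ρ are those of ν_n, which converge to that of ν, so the
convergence holds in L^ρ (`tendsto_lintegral_enorm_sub_rpow`); the subsequence principle concludes.

In the counterexample μ_n has no atoms, so its disintegration sits on two points, whereas the
disintegration over δ_0 is all of ν. No two-point law is closer than 1/4 to the uniform law on
(-1,1) (`le_wasserstein_uniformIoo`). -/

/-- Lebesgue measure on the open unit interval. -/
noncomputable abbrev unitMeasure : Measure ℝ := volume.restrict (Set.Ioo (0 : ℝ) 1)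

instance : IsProbabilityMeasure unitMeasure := ⟨by simp [unitMeasure]⟩

lemma ae_unitMeasure_mem : ∀ᵐ u ∂unitMeasure, u ∈ Set.Ioo (0 : ℝ) 1 :=
  ae_restrict_mem measurableSet_Ioo

/-! ### Quantile functions and the inverse transform -/

section Quantile

variable {η : Measure ℝ}

lemma quantileSet_nonempty {u : ℝ} (hu : u < 1) : {x : ℝ | u ≤ cdf η x}.Nonempty :=
  (((tendsto_cdf_atTop η).eventually (lt_mem_nhds hu)).exists).imp fun _ h => le_of_lt h

lemma quantileSet_bddBelow {u : ℝ} (hu : 0 < u) : BddBelow {x : ℝ | u ≤ cdf η x} := by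
  obtain ⟨x, hx⟩ := ((tendsto_cdf_atBot η).eventually (gt_mem_nhds hu)).exists
  refine ⟨x, fun y hy => ?_⟩
  by_contra! h
  exact absurd (hy.trans (monotone_cdf η h.le)) (not_le.2 hx)

/-- Right-continuity of the distribution function makes the infimum attained. This Galois connection
is the only access to quantiles used for measurability, monotonicity and convergence. -/
lemma quantile_le_iff {u x : ℝ} (hu : u ∈ Set.Ioo (0 : ℝ) 1) :
    quantile η u ≤ x ↔ u ≤ cdf η x := by
  refine ⟨fun h => ?_, fun h => csInf_le (quantileSet_bddBelow hu.1) h⟩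
  by_contra! hx
  have hr := ((cdf η).right_continuous x).mono Set.Ioi_subset_Ici_self
  have h1 : ∀ᶠ y in 𝓝[>] x, cdf η y < u := hr.eventually (gt_mem_nhds hx)
  obtain ⟨y, hy, hxy⟩ := (h1.and self_mem_nhdsWithin).exists
  have h2 : y ≤ quantile η u := by
    refine le_csInf (quantileSet_nonempty hu.2) fun z hz => ?_
    by_contra! hzy
    exact absurd (le_trans hz (monotone_cdf η hzy.le)) (not_le.2 hy)
  exact absurd (h2.trans h) (not_le.2 hxy)

lemma lt_quantile_iff {u x : ℝ} (hu : u ∈ Set.Ioo (0 : ℝ) 1) :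
    x < quantile η u ↔ cdf η x < u := by
  rw [← not_le, quantile_le_iff hu, not_le]

lemma monotoneOn_quantile : MonotoneOn (quantile η) (Set.Ioo 0 1) := fun _ hu _ hv huv =>
  (quantile_le_iff hu).2 (huv.trans ((quantile_le_iff hv).1 le_rfl))

lemma quantile_of_nonpos {u : ℝ} (hu : u ≤ 0) : quantile η u = 0 := by
  have : {x : ℝ | u ≤ cdf η x} = Set.univ :=
    Set.eq_univ_of_forall fun x => hu.trans (cdf_nonneg η x)
  rw [quantile, this, Real.sInf_univ]

lemma quantile_of_one_lt {u : ℝ} (hu : 1 < u) : quantile η u = 0 := by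
  have : {x : ℝ | u ≤ cdf η x} = ∅ :=
    Set.eq_empty_of_forall_notMem fun x hx => absurd (le_trans hx (cdf_le_one η x)) (not_le.2 hu)
  rw [quantile, this, Real.sInf_empty]

lemma measurable_indicator_quantile :
    Measurable ((Set.Ioo (0 : ℝ) 1).indicator (quantile η)) := by
  refine measurable_of_Iic fun x => ?_
  by_cases hx : 0 ≤ x
  · have : (Set.Ioo (0 : ℝ) 1).indicator (quantile η) ⁻¹' Set.Iic x =
        (Set.Ioo (0 : ℝ) 1 ∩ Set.Iic (cdf η x)) ∪ (Set.Ioo (0 : ℝ) 1)ᶜ := by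
      ext u
      by_cases hu : u ∈ Set.Ioo (0 : ℝ) 1
      · simp [hu, -Set.mem_Ioo, quantile_le_iff hu]
      · simp [hu, -Set.mem_Ioo, hx]
    rw [this]
    exact (measurableSet_Ioo.inter measurableSet_Iic).union measurableSet_Ioo.compl
  · have : (Set.Ioo (0 : ℝ) 1).indicator (quantile η) ⁻¹' Set.Iic x =
        (Set.Ioo (0 : ℝ) 1 ∩ Set.Iic (cdf η x)) := by
      ext u
      by_cases hu : u ∈ Set.Ioo (0 : ℝ) 1
      · simp [hu, -Set.mem_Ioo, quantile_le_iff hu]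
      · simp [hu, -Set.mem_Ioo, hx]
    rw [this]
    exact measurableSet_Ioo.inter measurableSet_Iic

/-- Outside (0,1) the infimum runs over the whole line or over the empty set and defaults to 0; only
`u = 1` can give another value. -/
lemma countable_indicator_quantile_ne :
    {u | (Set.Ioo (0 : ℝ) 1).indicator (quantile η) u ≠ quantile η u}.Countable := by
  refine (Set.countable_singleton (1 : ℝ)).mono fun u hu => ?_
  by_contra h
  rcases le_or_gt u 0 with h0 | h0
  · exact hu (by rw [Set.indicator_of_notMem (by simp [h0]), quantile_of_nonpos h0])
  rcases lt_or_gt_of_ne (show u ≠ 1 from h) with h1 | h1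
  · exact hu (Set.indicator_of_mem (show u ∈ Set.Ioo (0 : ℝ) 1 from ⟨h0, h1⟩) _)
  · exact hu (by rw [Set.indicator_of_notMem (by simp [h1.le]), quantile_of_one_lt h1])

@[fun_prop]
lemma measurable_quantile : Measurable (quantile η) :=
  measurable_indicator_quantile.measurable_of_countable_ne countable_indicator_quantile_ne

lemma indicator_quantile_ae :
    (Set.Ioo (0 : ℝ) 1).indicator (quantile η) =ᵐ[volume] quantile η :=
  countable_indicator_quantile_ne.measure_zero _

lemma map_quantile [IsProbabilityMeasure η] : unitMeasure.map (quantile η) = η := by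
  have := Measure.isProbabilityMeasure_map (μ := unitMeasure)
    (measurable_quantile (η := η)).aemeasurable
  refine Measure.ext_of_Iic _ _ fun x => ?_
  rw [Measure.map_apply measurable_quantile measurableSet_Iic, ← ofReal_cdf η x, unitMeasure,
    Measure.restrict_apply (measurable_quantile measurableSet_Iic)]
  have h1 : quantile η ⁻¹' Set.Iic x ∩ Set.Ioo 0 1 = Set.Iic (cdf η x) ∩ Set.Ioo 0 1 := by
    ext u
    simp only [Set.mem_inter_iff, Set.mem_preimage, Set.mem_Iic]
    exact and_congr_left fun hu => quantile_le_iff hu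
  rw [h1]
  have h2 : (Set.Iic (cdf η x) ∩ Set.Ioo 0 1 : Set ℝ) =ᵐ[volume] Set.Ioc 0 (cdf η x) := by
    have : (Set.Iic (cdf η x) ∩ Set.Ioo 0 1 : Set ℝ) =ᵐ[volume]
        (Set.Iic (cdf η x) ∩ Set.Ioc 0 1 : Set ℝ) :=
      (ae_eq_refl _).inter Ioo_ae_eq_Ioc
    have hset : (Set.Iic (cdf η x) ∩ Set.Ioc 0 1 : Set ℝ) = Set.Ioc 0 (cdf η x) := by
      ext u
      have := cdf_le_one η x
      simp only [Set.mem_inter_iff, Set.mem_Iic, Set.mem_Ioc]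
      constructor
      · rintro ⟨h1, h2, h3⟩; exact ⟨h2, h1⟩
      · rintro ⟨h1, h2⟩; exact ⟨h2, h1, h2.trans this⟩
    rwa [hset] at this
  rw [measure_congr h2, Real.volume_Ioc, sub_zero]

lemma measurePreserving_quantile [IsProbabilityMeasure η] :
    MeasurePreserving (quantile η) unitMeasure η :=
  ⟨measurable_quantile, map_quantile⟩

lemma integrableOn_quantile [IsProbabilityMeasure η] (h : Integrable (fun x : ℝ => x) η) :
    Integrable (quantile η) unitMeasure :=
  measurePreserving_quantile.integrable_comp_of_integrable h

/-- Thanks to the default value 0 outside the unit interval, integrability holds on the whole line,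
and interval integrals of quantiles need no side conditions on their endpoints. -/
lemma integrable_quantile [IsProbabilityMeasure η] (h : Integrable (fun x : ℝ => x) η) :
    Integrable (quantile η) volume :=
  (((integrable_indicator_iff measurableSet_Ioo).2 (integrableOn_quantile h))).congr
    indicator_quantile_ae

end Quantile

/-! ### Convergence of quantile functions and convergence in L^ρ -/

section Convergence

/-- Pointwise convergence of distribution functions on a dense set implies convergence of the
quantile functions at every continuity point of the limit. -/
lemma tendsto_quantile {ηs : ℕ → Measure ℝ} {η : Measure ℝ} {D : Set ℝ} (hD : Dense D)
    (h : ∀ y ∈ D, Tendsto (fun n => cdf (ηs n) y) atTop (𝓝 (cdf η y)))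
    {u : ℝ} (hu : u ∈ Set.Ioo (0 : ℝ) 1) (hc : ContinuousAt (quantile η) u) :
    Tendsto (fun n => quantile (ηs n) u) atTop (𝓝 (quantile η u)) := by
  refine tendsto_order.2 ⟨fun a ha => ?_, fun b hb => ?_⟩
  · obtain ⟨y, hyD, hay, hyu⟩ := hD.exists_between ha
    have h1 : cdf η y < u := (lt_quantile_iff hu).1 hyu
    filter_upwards [(h y hyD).eventually (gt_mem_nhds h1)] with n hn
    exact hay.trans ((lt_quantile_iff hu).2 hn)
  · have h1 : ∀ᶠ v in 𝓝[>] u, quantile η v < b :=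
      (hc.eventually (gt_mem_nhds hb)).filter_mono nhdsWithin_le_nhds
    have h2 : ∀ᶠ v in 𝓝[>] u, v ∈ Set.Ioo u 1 := Ioo_mem_nhdsGT hu.2
    obtain ⟨v, hv, hv2⟩ := (h1.and h2).exists
    obtain ⟨y, hyD, hvy, hyb⟩ := hD.exists_between hv
    have h3 : v ≤ cdf η y := (quantile_le_iff ⟨hu.1.trans hv2.1, hv2.2⟩).1 hvy.le
    filter_upwards [(h y hyD).eventually (lt_mem_nhds (hv2.1.trans_le h3))] with n hn
    exact ((quantile_le_iff hu).2 hn.le).trans_lt hyb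

/-- Convergence of monotone functions on a dense set is locally uniform at continuity points. -/
lemma tendsto_monotoneOn_comp {f : ℕ → ℝ → ℝ} {g : ℝ → ℝ} {s D : Set ℝ} (hs : IsOpen s)
    (hf : ∀ n, MonotoneOn (f n) s) (hD : Dense D)
    (h : ∀ y ∈ D, y ∈ s → Tendsto (fun n => f n y) atTop (𝓝 (g y)))
    {v : ℝ} (hv : v ∈ s) (hc : ContinuousAt g v) {vs : ℕ → ℝ}
    (hvs : Tendsto vs atTop (𝓝 v)) : Tendsto (fun n => f n (vs n)) atTop (𝓝 (g v)) := by
  have hsv : s ∈ 𝓝 v := hs.mem_nhds hv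
  have hmem : ∀ᶠ n in atTop, vs n ∈ s := hvs.eventually hsv
  refine tendsto_order.2 ⟨fun a ha => ?_, fun b hb => ?_⟩
  · have h1 : ∀ᶠ y in 𝓝 v, a < g y ∧ y ∈ s := (hc.eventually (lt_mem_nhds ha)).and hsv
    obtain ⟨l, hl, hlv⟩ := exists_Ioc_subset_of_mem_nhds h1 ⟨v - 1, by linarith⟩
    obtain ⟨y, hyD, hly, hyv⟩ := hD.exists_between hl
    have hy := hlv ⟨hly, hyv.le⟩
    filter_upwards [hmem, (h y hyD hy.2).eventually (lt_mem_nhds hy.1),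
      hvs.eventually (lt_mem_nhds hyv)] with n h1 h2 h3
    exact h2.trans_le (hf n hy.2 h1 h3.le)
  · have h1 : ∀ᶠ y in 𝓝 v, g y < b ∧ y ∈ s := (hc.eventually (gt_mem_nhds hb)).and hsv
    obtain ⟨l, hl, hlv⟩ := exists_Ico_subset_of_mem_nhds h1 ⟨v + 1, by linarith⟩
    obtain ⟨y, hyD, hvy, hyl⟩ := hD.exists_between hl
    have hy := hlv ⟨hvy.le, hyl⟩
    filter_upwards [hmem, (h y hyD hy.2).eventually (gt_mem_nhds hy.1),
      hvs.eventually (gt_mem_nhds hvy)] with n h1 h2 h3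
    exact (hf n h1 hy.2 h3.le).trans_lt h2

lemma ae_continuousAt_of_monotoneOn {g : ℝ → ℝ} {s : Set ℝ} (hs : IsOpen s)
    (hg : MonotoneOn g s) : ∀ᵐ u ∂volume.restrict s, ContinuousAt g u := by
  have h0 := hg.countable_not_continuousWithinAt.measure_zero volume
  rw [ae_restrict_iff' hs.measurableSet]
  refine measure_mono_null (fun u hu => ?_) h0
  simp only [Set.mem_compl_iff, Set.mem_ofPred_eq, Classical.not_imp] at hu
  exact ⟨hu.1, fun h => hu.2 (h.continuousAt (hs.mem_nhds hu.1))⟩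

lemma tendsto_quantile_ae {ηs : ℕ → Measure ℝ} {η : Measure ℝ} {D : Set ℝ} (hD : Dense D)
    (h : ∀ y ∈ D, Tendsto (fun n => cdf (ηs n) y) atTop (𝓝 (cdf η y))) :
    ∀ᵐ u ∂unitMeasure, Tendsto (fun n => quantile (ηs n) u) atTop (𝓝 (quantile η u)) := by
  filter_upwards [ae_continuousAt_of_monotoneOn isOpen_Ioo (monotoneOn_quantile (η := η)),
    ae_unitMeasure_mem] with u hc hu
  exact tendsto_quantile hD h hu hc

/-- Almost everywhere convergence together with convergence of the moments of order `ρ` implies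
convergence in `L^ρ`. -/
lemma tendsto_lintegral_enorm_sub_rpow {α : Type*} [MeasurableSpace α] {P : Measure α}
    {ρ : ℝ} (hρ : 1 ≤ ρ) {f : ℕ → α → ℝ} {g : α → ℝ} (hf : ∀ n, AEMeasurable (f n) P)
    (hg : AEMeasurable g P) (hae : ∀ᵐ a ∂P, Tendsto (fun n => f n a) atTop (𝓝 (g a)))
    (hfin : ∫⁻ a, ‖g a‖ₑ ^ ρ ∂P ≠ ⊤)
    (hmom : Tendsto (fun n => ∫⁻ a, ‖f n a‖ₑ ^ ρ ∂P) atTop (𝓝 (∫⁻ a, ‖g a‖ₑ ^ ρ ∂P))) :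
    Tendsto (fun n => ∫⁻ a, ‖f n a - g a‖ₑ ^ ρ ∂P) atTop (𝓝 0) := by
  have hρ0 : 0 ≤ ρ := by linarith
  have hC : (2 : ENNReal) ^ (ρ - 1) ≠ ⊤ := ENNReal.rpow_ne_top_of_nonneg (by linarith) (by simp)
  set C : ENNReal := (2 : ENNReal) ^ (ρ - 1) with hCdef
  set I : ENNReal := ∫⁻ a, ‖g a‖ₑ ^ ρ ∂P with hI
  have hle : ∀ n a, ‖f n a - g a‖ₑ ^ ρ ≤ C * (‖f n a‖ₑ ^ ρ + ‖g a‖ₑ ^ ρ) := fun n a =>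
    (ENNReal.rpow_le_rpow enorm_sub_le hρ0).trans
      (ENNReal.rpow_add_le_mul_rpow_add_rpow _ _ hρ)
  have mf : ∀ n, AEMeasurable (fun a => ‖f n a‖ₑ ^ ρ) P := fun n => (hf n).enorm.pow_const ρ
  have mg : AEMeasurable (fun a => ‖g a‖ₑ ^ ρ) P := hg.enorm.pow_const ρ
  have md : ∀ n, AEMeasurable (fun a => ‖f n a - g a‖ₑ ^ ρ) P :=
    fun n => ((hf n).sub hg).enorm.pow_const ρ
  have ms : ∀ n, AEMeasurable (fun a => ‖f n a‖ₑ ^ ρ + ‖g a‖ₑ ^ ρ) P := fun n => (mf n).add mg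
  have mg2 : AEMeasurable (fun a => ‖g a‖ₑ ^ ρ + ‖g a‖ₑ ^ ρ) P := mg.add mg
  -- Fatou's lemma is applied to the nonnegative functions C(|f_n|^ρ + |g|^ρ) - |f_n - g|^ρ, whose
  -- pointwise limit is 2C|g|^ρ. Since the integrals of the first term converge to the integral of
  -- that limit, nothing is left for |f_n - g|^ρ.
  set h : ℕ → α → ENNReal := fun n a =>
    C * (‖f n a‖ₑ ^ ρ + ‖g a‖ₑ ^ ρ) - ‖f n a - g a‖ₑ ^ ρ with hh
  have mh : ∀ n, AEMeasurable (h n) P := fun n => (((mf n).add mg).const_mul C).sub (md n)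
  have hsum : ∀ n, ∫⁻ a, h n a ∂P + ∫⁻ a, ‖f n a - g a‖ₑ ^ ρ ∂P =
      C * (∫⁻ a, ‖f n a‖ₑ ^ ρ ∂P + I) := by
    intro n
    rw [← lintegral_add_right' _ (md n), hI, ← lintegral_add_right' _ mg,
      ← lintegral_const_mul'' _ (ms n)]
    exact lintegral_congr fun a => tsub_add_cancel_of_le (hle n a)
  have hfatou : C * (I + I) ≤ liminf (fun n => ∫⁻ a, h n a ∂P) atTop := by
    refine le_trans (le_of_eq ?_) (lintegral_liminf_le' mh)
    rw [hI, ← lintegral_add_right' _ mg, ← lintegral_const_mul'' _ mg2]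
    refine lintegral_congr_ae ?_
    filter_upwards [hae] with a ha
    refine (Tendsto.liminf_eq ?_).symm
    have h1 : Tendsto (fun n => ‖f n a‖ₑ ^ ρ) atTop (𝓝 (‖g a‖ₑ ^ ρ)) :=
      (ENNReal.continuous_rpow_const.tendsto _).comp ((continuous_enorm.tendsto _).comp ha)
    have h2 : Tendsto (fun n => ‖f n a - g a‖ₑ ^ ρ) atTop (𝓝 0) := by
      have h3 : Tendsto (fun n => f n a - g a) atTop (𝓝 0) := by
        simpa using ha.sub (tendsto_const_nhds (x := g a))
      have h4 := (ENNReal.continuous_rpow_const (y := ρ)).tendsto _ |>.comp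
        ((continuous_enorm.tendsto _).comp h3)
      simpa [Function.comp_def, ENNReal.zero_rpow_of_pos (show 0 < ρ by linarith)] using h4
    have h5 := ENNReal.Tendsto.sub (ENNReal.Tendsto.const_mul (h1.add
      (tendsto_const_nhds (x := ‖g a‖ₑ ^ ρ))) (Or.inr hC)) h2 (Or.inr (by simp))
    simpa using h5
  have hCI : C * (I + I) ≠ ⊤ := ENNReal.mul_ne_top hC (by simp [hfin])
  have htot : Tendsto (fun n => C * (∫⁻ a, ‖f n a‖ₑ ^ ρ ∂P + I)) atTop (𝓝 (C * (I + I))) :=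
    ENNReal.Tendsto.const_mul (hmom.add tendsto_const_nhds) (Or.inr hC)
  refine ENNReal.tendsto_nhds_zero.2 fun ε hε => ?_
  -- If the limit vanishes, subtracting ε/2 does not make it strictly smaller; the dominating
  -- integrals then tend to 0 themselves.
  by_cases hCI0 : C * (I + I) = 0
  · filter_upwards [ENNReal.tendsto_nhds_zero.1 (hCI0 ▸ htot) ε hε] with n hn
    exact (le_add_self.trans (hsum n).le).trans hn
  by_cases hεt : ε = ⊤
  · simp [hεt]
  have hε2 : ε / 2 ≠ 0 := by simp [hε.ne']
  have h1 : ∀ᶠ n in atTop, C * (I + I) - ε / 2 < ∫⁻ a, h n a ∂P :=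
    eventually_lt_of_lt_liminf ((ENNReal.sub_lt_self hCI hCI0 hε2).trans_le hfatou)
  have h2 : ∀ᶠ n in atTop, C * (∫⁻ a, ‖f n a‖ₑ ^ ρ ∂P + I) < C * (I + I) + ε / 2 :=
    htot.eventually (gt_mem_nhds (ENNReal.lt_add_right hCI hε2))
  filter_upwards [h1, h2] with n h1 h2
  have h3 : C * (I + I) ≤ ∫⁻ a, h n a ∂P + ε / 2 := tsub_le_iff_right.1 h1.le
  have hhn : ∫⁻ a, h n a ∂P ≠ ⊤ := by
    have : ∫⁻ a, h n a ∂P ≤ C * (∫⁻ a, ‖f n a‖ₑ ^ ρ ∂P + I) := le_self_add.trans (hsum n).le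
    exact ((this.trans_lt h2).trans_le le_top).ne
  have h4 : ∫⁻ a, h n a ∂P + ∫⁻ a, ‖f n a - g a‖ₑ ^ ρ ∂P ≤ ∫⁻ a, h n a ∂P + ε := by
    rw [hsum n]
    calc _ ≤ C * (I + I) + ε / 2 := h2.le
      _ ≤ ∫⁻ a, h n a ∂P + ε / 2 + ε / 2 := by gcongr
      _ = _ := by rw [add_assoc, ENNReal.add_halves]
  exact (ENNReal.add_le_add_iff_left hhn).1 h4

end Convergence

/-! ### Generalised inverses of primitives of nonnegative functions -/

section GenInv

variable {Ψ : ℝ → ℝ}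

lemma genInv_mem (hc : Continuous Ψ) {s : ℝ} (hs : s ≤ Ψ 1) :
    genInv Ψ s ∈ Set.Icc (0 : ℝ) 1 ∧ s ≤ Ψ (genInv Ψ s) := by
  have hcl : IsClosed {r : ℝ | r ∈ Set.Icc (0 : ℝ) 1 ∧ s ≤ Ψ r} :=
    isClosed_Icc.inter (isClosed_le continuous_const hc)
  exact hcl.csInf_mem ⟨1, by simp, hs⟩ ⟨0, fun r hr => hr.1.1⟩

lemma genInv_le {s r : ℝ} (hr : r ∈ Set.Icc (0 : ℝ) 1) (h : s ≤ Ψ r) : genInv Ψ s ≤ r :=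
  csInf_le ⟨0, fun _ hr => hr.1.1⟩ ⟨hr, h⟩

lemma genInv_le_iff (hm : Monotone Ψ) (hc : Continuous Ψ) {s r : ℝ} (hs : s ≤ Ψ 1)
    (hr : r ∈ Set.Icc (0 : ℝ) 1) : genInv Ψ s ≤ r ↔ s ≤ Ψ r :=
  ⟨fun h => (genInv_mem hc hs).2.trans (hm h), genInv_le hr⟩

lemma apply_genInv (hc : Continuous Ψ) {s : ℝ} (h0 : Ψ 0 ≤ s) (hs : s ≤ Ψ 1) :
    Ψ (genInv Ψ s) = s := by
  obtain ⟨hm, hle⟩ := genInv_mem hc hs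
  obtain ⟨r, hr, hrs⟩ := intermediate_value_Icc hm.1 hc.continuousOn ⟨h0, hle⟩
  have : genInv Ψ s ≤ r := genInv_le ⟨hr.1, hr.2.trans hm.2⟩ hrs.ge
  rw [← le_antisymm hr.2 this, hrs]

lemma monotoneOn_genInv (hm : Monotone Ψ) (hc : Continuous Ψ) :
    MonotoneOn (genInv Ψ) (Set.Iic (Ψ 1)) := fun _ hs _ ht hst =>
  (genInv_le_iff hm hc hs (genInv_mem hc ht).1).2 (hst.trans (genInv_mem hc ht).2)

lemma genInv_of_lt (hm : Monotone Ψ) {s : ℝ} (hs : Ψ 1 < s) : genInv Ψ s = 0 := by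
  have : {r : ℝ | r ∈ Set.Icc (0 : ℝ) 1 ∧ s ≤ Ψ r} = ∅ :=
    Set.eq_empty_of_forall_notMem fun r hr =>
      absurd (hr.2.trans (hm hr.1.2)) (not_le.2 hs)
  rw [genInv, this, Real.sInf_empty]

lemma measurable_genInv (hm : Monotone Ψ) (hc : Continuous Ψ) : Measurable (genInv Ψ) := by
  refine measurable_of_restrict_of_restrict_compl (s := Set.Iic (Ψ 1)) measurableSet_Iic ?_ ?_
  · refine Monotone.measurable fun x y hxy => ?_
    exact monotoneOn_genInv hm hc x.2 y.2 hxy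
  · have : (Set.Iic (Ψ 1))ᶜ.domRestrict (genInv Ψ) = fun _ => 0 :=
      funext fun x => genInv_of_lt hm (not_le.1 x.2)
    rw [this]
    exact measurable_const

variable {g : ℝ → ℝ}

lemma continuous_primitive_of_integrable (hg : Integrable g) :
    Continuous fun u => ∫ v in (0 : ℝ)..u, g v :=
  intervalIntegral.continuous_primitive (fun _ _ => hg.intervalIntegrable) 0

lemma monotone_primitive (hg : Integrable g) (h0 : ∀ v, 0 ≤ g v) :
    Monotone fun u => ∫ v in (0 : ℝ)..u, g v := by
  intro u w huw
  have := intervalIntegral.integral_add_adjacent_intervals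
    (hg.intervalIntegrable (a := 0) (b := u)) (hg.intervalIntegrable (a := u) (b := w))
  have h2 := intervalIntegral.integral_nonneg (μ := volume) huw fun v _ => h0 v
  simp only
  linarith

/-- Inverse transform sampling for the finite measure g(u) du: by the Galois connection, the levels
sent into (-∞, r] form (0, Ψ(r)], up to null sets. -/
lemma map_genInv_primitive (hg : Integrable g) (h0 : ∀ v, 0 ≤ g v)
    (hΨ : ∀ u, Ψ u = ∫ v in (0 : ℝ)..u, g v) :
    (volume.restrict (Set.Ioo 0 (Ψ 1))).map (genInv Ψ) =
      unitMeasure.withDensity fun u => ENNReal.ofReal (g u) := by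
  have hΨ' : Ψ = fun u => ∫ v in (0 : ℝ)..u, g v := funext hΨ
  have hc : Continuous Ψ := hΨ' ▸ continuous_primitive_of_integrable hg
  have hm : Monotone Ψ := hΨ' ▸ monotone_primitive hg h0
  have hΨ0 : Ψ 0 = 0 := by simp [hΨ]
  have hmeas := measurable_genInv hm hc
  refine Measure.ext_of_Iic _ _ fun r => ?_
  rw [Measure.map_apply hmeas measurableSet_Iic, Measure.restrict_apply (hmeas measurableSet_Iic),
    withDensity_apply _ measurableSet_Iic, unitMeasure, Measure.restrict_restrict measurableSet_Iic]
  have key : ∀ r ∈ Set.Icc (0 : ℝ) 1, volume (Set.Ioc 0 (Ψ r)) =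
      ∫⁻ u in Set.Ioc 0 r, ENNReal.ofReal (g u) := by
    intro r hr
    rw [Real.volume_Ioc, sub_zero, hΨ r, intervalIntegral.integral_of_le hr.1,
      ofReal_integral_eq_lintegral_ofReal hg.integrableOn (ae_of_all _ h0)]
  have hae : (genInv Ψ ⁻¹' Set.Iic r ∩ Set.Ioo 0 (Ψ 1) : Set ℝ) =ᵐ[volume]
      (genInv Ψ ⁻¹' Set.Iic r ∩ Set.Ioc 0 (Ψ 1) : Set ℝ) := (ae_eq_refl _).inter Ioo_ae_eq_Ioc
  have hae2 : (Set.Iic r ∩ Set.Ioo 0 1 : Set ℝ) =ᵐ[volume] (Set.Iic r ∩ Set.Ioc 0 1 : Set ℝ) :=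
    (ae_eq_refl _).inter Ioo_ae_eq_Ioc
  rw [measure_congr hae, Measure.restrict_congr_set hae2]
  rcases lt_or_ge r 0 with hr | hr
  · have h1 : genInv Ψ ⁻¹' Set.Iic r ∩ Set.Ioc 0 (Ψ 1) = ∅ := by
      refine Set.eq_empty_of_forall_notMem fun s hs => ?_
      have h2 : genInv Ψ s ≤ r := hs.1
      linarith [(genInv_mem hc hs.2.2).1.1]
    have h2 : Set.Iic r ∩ Set.Ioc (0 : ℝ) 1 = ∅ := by
      refine Set.eq_empty_of_forall_notMem fun s hs => ?_
      have h2 : s ≤ r := hs.1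
      linarith [hs.2.1]
    simp [h1, h2]
  rcases le_or_gt r 1 with hr1 | hr1
  · have h1 : genInv Ψ ⁻¹' Set.Iic r ∩ Set.Ioc 0 (Ψ 1) = Set.Ioc 0 (Ψ r) := by
      ext s
      simp only [Set.mem_inter_iff, Set.mem_preimage, Set.mem_Iic, Set.mem_Ioc]
      constructor
      · rintro ⟨h1, h2, h3⟩
        exact ⟨h2, (genInv_le_iff hm hc h3 ⟨hr, hr1⟩).1 h1⟩
      · rintro ⟨h1, h2⟩
        exact ⟨(genInv_le_iff hm hc (h2.trans (hm hr1)) ⟨hr, hr1⟩).2 h2, h1, h2.trans (hm hr1)⟩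
    have h2 : Set.Iic r ∩ Set.Ioc (0 : ℝ) 1 = Set.Ioc 0 r := by
      ext s
      simp only [Set.mem_inter_iff, Set.mem_Iic, Set.mem_Ioc]
      constructor
      · rintro ⟨h1, h2, h3⟩; exact ⟨h2, h1⟩
      · rintro ⟨h1, h2⟩; exact ⟨h2, h1, h2.trans hr1⟩
    rw [h1, h2, key r ⟨hr, hr1⟩]
  · have h1 : genInv Ψ ⁻¹' Set.Iic r ∩ Set.Ioc 0 (Ψ 1) = Set.Ioc 0 (Ψ 1) :=
      Set.inter_eq_right.2 fun s hs => (genInv_mem hc hs.2).1.2.trans hr1.le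
    have h2 : Set.Iic r ∩ Set.Ioc (0 : ℝ) 1 = Set.Ioc 0 1 :=
      Set.inter_eq_right.2 fun s hs => hs.2.trans hr1.le
    rw [h1, h2, key 1 (by simp)]

/-- Properties holding almost everywhere on {g > 0} pass to the points Ψ⁻¹(s), whose law under
Lebesgue measure has density `g`. -/
lemma ae_genInv_of_ae (hg : Integrable g) (hgm : Measurable g) (h0 : ∀ v, 0 ≤ g v)
    (hΨ : ∀ u, Ψ u = ∫ v in (0 : ℝ)..u, g v) {Q : ℝ → Prop}
    (hQ : ∀ᵐ u ∂unitMeasure, 0 < g u → Q u) :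
    ∀ᵐ s ∂volume.restrict (Set.Ioo 0 (Ψ 1)), Q (genInv Ψ s) := by
  have hΨ' : Ψ = fun u => ∫ v in (0 : ℝ)..u, g v := funext hΨ
  have hc : Continuous Ψ := hΨ' ▸ continuous_primitive_of_integrable hg
  have hm : Monotone Ψ := hΨ' ▸ monotone_primitive hg h0
  refine ae_of_ae_map (measurable_genInv hm hc).aemeasurable ?_
  rw [map_genInv_primitive hg h0 hΨ, ae_withDensity_iff (by fun_prop)]
  filter_upwards [hQ] with u hu h
  exact hu (by simpa using h)

/-- The converse transfer, from levels `s` to points `u` via s = Ψ(u). It is available because Ψ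
maps g(u) du back to Lebesgue measure. -/
lemma ae_primitive_of_ae (hg : Integrable g) (hgm : Measurable g) (h0 : ∀ v, 0 ≤ g v)
    (hΨ : ∀ u, Ψ u = ∫ v in (0 : ℝ)..u, g v) {R : ℝ → Prop}
    (hR : ∀ᵐ s ∂volume.restrict (Set.Ioo 0 (Ψ 1)), R s) :
    ∀ᵐ u ∂unitMeasure, 0 < g u → genInv Ψ (Ψ u) = u ∧ R (Ψ u) := by
  have hΨ' : Ψ = fun u => ∫ v in (0 : ℝ)..u, g v := funext hΨ
  have hc : Continuous Ψ := hΨ' ▸ continuous_primitive_of_integrable hg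
  have hm : Monotone Ψ := hΨ' ▸ monotone_primitive hg h0
  have hΨ0 : Ψ 0 = 0 := by simp [hΨ]
  have hgen := measurable_genInv hm hc
  have hinv : ∀ᵐ s ∂volume.restrict (Set.Ioo 0 (Ψ 1)), Ψ (genInv Ψ s) = s := by
    filter_upwards [ae_restrict_mem measurableSet_Ioo] with s hs
    exact apply_genInv hc (hΨ0.trans_le hs.1.le) hs.2.le
  have hmap : (unitMeasure.withDensity fun u => ENNReal.ofReal (g u)).map Ψ =
      volume.restrict (Set.Ioo 0 (Ψ 1)) := by
    rw [← map_genInv_primitive hg h0 hΨ, Measure.map_map hc.measurable hgen]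
    calc _ = Measure.map id (volume.restrict (Set.Ioo 0 (Ψ 1))) := Measure.map_congr hinv
      _ = _ := Measure.map_id
  have h1 : ∀ᵐ u ∂unitMeasure.withDensity fun u => ENNReal.ofReal (g u), R (Ψ u) :=
    ae_of_ae_map hc.measurable.aemeasurable (hmap ▸ hR)
  -- The measure g(u) du is carried by points u = Ψ⁻¹(s), and there Ψ(u) = s, hence Ψ⁻¹(Ψ(u)) =
  -- Ψ⁻¹(s) = u.
  have h2 : ∀ᵐ u ∂unitMeasure.withDensity fun u => ENNReal.ofReal (g u),
      genInv Ψ (Ψ u) = u := by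
    have hset : MeasurableSet {u | genInv Ψ (Ψ u) = u} :=
      measurableSet_eq_fun (hgen.comp hc.measurable) measurable_id
    rw [← map_genInv_primitive hg h0 hΨ, ae_map_iff hgen.aemeasurable hset]
    filter_upwards [hinv] with s hs
    rw [hs]
  have h3 := h1.and h2
  rw [ae_withDensity_iff (by fun_prop)] at h3
  filter_upwards [h3] with u hu h
  exact (hu (by simpa using h)).symm

/-- Stability of the generalised inverse at a continuity point. -/
lemma tendsto_genInv {Ψs : ℕ → ℝ → ℝ} (hc : ∀ n, Continuous (Ψs n)) (hm : ∀ n, Monotone (Ψs n))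
    (hΨc : Continuous Ψ)
    (h : ∀ r ∈ Set.Icc (0 : ℝ) 1, Tendsto (fun n => Ψs n r) atTop (𝓝 (Ψ r)))
    {ss : ℕ → ℝ} {s : ℝ} (hss : Tendsto ss atTop (𝓝 s)) (hle : ∀ n, ss n ≤ Ψs n 1)
    (hs : s < Ψ 1) (hcont : ContinuousAt (genInv Ψ) s) (hmem : genInv Ψ s ∈ Set.Ioo (0 : ℝ) 1) :
    Tendsto (fun n => genInv (Ψs n) (ss n)) atTop (𝓝 (genInv Ψ s)) := by
  refine tendsto_order.2 ⟨fun a ha => ?_, fun b hb => ?_⟩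
  · obtain ⟨r, har, hr⟩ := exists_between (max_lt ha hmem.1)
    have hr01 : r ∈ Set.Icc (0 : ℝ) 1 :=
      ⟨(le_max_right a 0).trans har.le, hr.le.trans hmem.2.le⟩
    have h1 : Ψ r < s := by
      by_contra! h2
      exact absurd (genInv_le hr01 h2) (not_le.2 hr)
    filter_upwards [(h r hr01).eventually_lt hss h1] with n hn
    refine lt_of_lt_of_le ((le_max_left a 0).trans_lt har) ?_
    by_contra! h2
    exact absurd ((genInv_le_iff (hm n) (hc n) (hle n) hr01).1 h2.le) (not_le.2 hn)
  -- A level `t` slightly above `s` has its inverse still below `b`, and Ψ at that inverse is at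
  -- least t > s. This leaves room for the errors in `Ψs n` and `ss n`.
  · have h1 : ∀ᶠ t in 𝓝[>] s, genInv Ψ t < min b 1 :=
      (hcont.eventually (gt_mem_nhds (lt_min hb hmem.2))).filter_mono nhdsWithin_le_nhds
    obtain ⟨t, ht, hst, ht1⟩ := (h1.and (Ioo_mem_nhdsGT hs)).exists
    obtain ⟨hr, htr⟩ := genInv_mem hΨc ht1.le
    filter_upwards [hss.eventually_lt (h _ hr) (hst.trans_le htr)] with n hn
    exact ((genInv_le hr hn.le).trans_lt ht).trans_le (min_le_left _ _)

end GenInv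

/-! ### The functions Ψ₊ and Ψ₋ and the convex order -/

section Psi

variable {μ ν : Measure ℝ}

lemma measurable_posPart_sub :
    Measurable fun v => max (quantile μ v - quantile ν v) 0 := by fun_prop

lemma measurable_negPart_sub :
    Measurable fun v => max (-(quantile μ v - quantile ν v)) 0 := by fun_prop

variable [IsProbabilityMeasure μ] [IsProbabilityMeasure ν]

lemma integrable_posPart_sub (hμ : Integrable (fun x : ℝ => x) μ)
    (hν : Integrable (fun x : ℝ => x) ν) :
    Integrable fun v => max (quantile μ v - quantile ν v) 0 :=
  ((integrable_quantile hμ).sub (integrable_quantile hν)).pos_part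

lemma integrable_negPart_sub (hμ : Integrable (fun x : ℝ => x) μ)
    (hν : Integrable (fun x : ℝ => x) ν) :
    Integrable fun v => max (-(quantile μ v - quantile ν v)) 0 :=
  ((integrable_quantile hμ).sub (integrable_quantile hν)).neg_part

lemma continuous_psiPlus (hμ : Integrable (fun x : ℝ => x) μ)
    (hν : Integrable (fun x : ℝ => x) ν) : Continuous (psiPlus μ ν) :=
  continuous_primitive_of_integrable (integrable_posPart_sub hμ hν)

lemma continuous_psiMinus (hμ : Integrable (fun x : ℝ => x) μ)
    (hν : Integrable (fun x : ℝ => x) ν) : Continuous (psiMinus μ ν) :=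
  continuous_primitive_of_integrable (integrable_negPart_sub hμ hν)

lemma monotone_psiPlus (hμ : Integrable (fun x : ℝ => x) μ)
    (hν : Integrable (fun x : ℝ => x) ν) : Monotone (psiPlus μ ν) :=
  monotone_primitive (integrable_posPart_sub hμ hν) fun _ => le_max_right _ _

lemma monotone_psiMinus (hμ : Integrable (fun x : ℝ => x) μ)
    (hν : Integrable (fun x : ℝ => x) ν) : Monotone (psiMinus μ ν) :=
  monotone_primitive (integrable_negPart_sub hμ hν) fun _ => le_max_right _ _

lemma psiPlus_sub_psiMinus (hμ : Integrable (fun x : ℝ => x) μ)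
    (hν : Integrable (fun x : ℝ => x) ν) (u : ℝ) :
    psiPlus μ ν u - psiMinus μ ν u =
      (∫ v in (0 : ℝ)..u, quantile μ v) - ∫ v in (0 : ℝ)..u, quantile ν v := by
  rw [psiPlus, psiMinus, ← intervalIntegral.integral_sub
    (integrable_posPart_sub hμ hν).intervalIntegrable
    (integrable_negPart_sub hμ hν).intervalIntegrable, ← intervalIntegral.integral_sub
    (integrable_quantile hμ).intervalIntegrable (integrable_quantile hν).intervalIntegrable]
  refine intervalIntegral.integral_congr fun v _ => ?_
  rcases le_total 0 (quantile μ v - quantile ν v) with h | h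
  · rw [max_eq_left h, max_eq_right (by linarith)]; ring
  · rw [max_eq_right h, max_eq_left (by linarith)]; ring

end Psi

/-- The convex order expressed through the functions `Ψ₊` and `Ψ₋`, for measures with finite
first moment. -/
structure PsiOrdered (μ ν : Measure ℝ) : Prop where
  left_prob : IsProbabilityMeasure μ
  right_prob : IsProbabilityMeasure ν
  left_int : Integrable (fun x : ℝ => x) μ
  right_int : Integrable (fun x : ℝ => x) ν
  psi_le : ∀ u ∈ Set.Icc (0 : ℝ) 1, psiMinus μ ν u ≤ psiPlus μ ν u
  psi_one : psiPlus μ ν 1 = psiMinus μ ν 1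

lemma MemP.integrable_id {ρ : ℝ} (hρ : 1 ≤ ρ) {η : Measure ℝ} (h : MemP ρ η) :
    Integrable (fun x : ℝ => x) η := by
  have := h.isProbabilityMeasure
  refine ((integrable_const (1 : ℝ)).add h.integrable_abs_rpow).mono'
    measurable_id.aestronglyMeasurable (ae_of_all _ fun x => ?_)
  simp only [Real.norm_eq_abs, Pi.add_apply]
  rcases le_total |x| 1 with hx | hx
  · have := Real.rpow_nonneg (abs_nonneg x) ρ
    linarith
  · have := Real.self_le_rpow_of_one_le hx hρ
    linarith

lemma integral_quantile_comp {η : Measure ℝ} [IsProbabilityMeasure η] {f : ℝ → ℝ}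
    (hf : Measurable f) : ∫ u, f (quantile η u) ∂unitMeasure = ∫ x, f x ∂η := by
  conv_rhs => rw [← map_quantile (η := η)]
  rw [integral_map measurable_quantile.aemeasurable hf.aestronglyMeasurable]

lemma intervalIntegral_zero_one_eq (f : ℝ → ℝ) :
    ∫ v in (0 : ℝ)..1, f v = ∫ v, f v ∂unitMeasure := by
  rw [intervalIntegral.integral_of_le zero_le_one, integral_Ioc_eq_integral_Ioo]

/-- Testing with x and -x equates the means, which is the equality at 1. For the inequality at `u`,
the test function (a - x)⁺ with a = F_ν⁻¹(u) is optimal: for ν its integral is exactly ∫₀ᵘ (a -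
F_ν⁻¹), for μ it is at least ∫₀ᵘ (a - F_μ⁻¹). -/
lemma ConvexOrder.psiOrdered {μ ν : Measure ℝ} (h : ConvexOrder μ ν)
    (hμp : IsProbabilityMeasure μ) (hνp : IsProbabilityMeasure ν)
    (hμ : Integrable (fun x : ℝ => x) μ) (hν : Integrable (fun x : ℝ => x) ν) :
    PsiOrdered μ ν := by
  have hmean : ∫ x, x ∂μ = ∫ x, x ∂ν := by
    refine le_antisymm (h (fun x => x) (convexOn_id convex_univ) hμ hν) ?_
    have := h (fun x => -x) (concaveOn_id convex_univ).neg hμ.neg hν.neg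
    rw [integral_neg, integral_neg] at this
    linarith
  have hone : psiPlus μ ν 1 - psiMinus μ ν 1 = 0 := by
    rw [psiPlus_sub_psiMinus hμ hν, intervalIntegral_zero_one_eq, intervalIntegral_zero_one_eq,
      integral_quantile_comp (f := fun x => x) measurable_id,
      integral_quantile_comp (f := fun x => x) measurable_id]
    exact sub_eq_zero.2 hmean
  refine ⟨hμp, hνp, hμ, hν, fun u hu => ?_, by linarith⟩
  rcases hu.2.eq_or_lt with rfl | hu1
  · linarith
  rcases hu.1.eq_or_lt with rfl | hu0
  · simp [psiPlus, psiMinus]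
  have hu' : u ∈ Set.Ioo (0 : ℝ) 1 := ⟨hu0, hu1⟩
  rw [← sub_nonneg, psiPlus_sub_psiMinus hμ hν, sub_nonneg]
  set a := quantile ν u with ha
  have hfm : Measurable fun x : ℝ => max (a - x) 0 := by fun_prop
  have hconv : ConvexOn ℝ Set.univ fun x : ℝ => max (a - x) 0 :=
    ((convexOn_const a convex_univ).sub (concaveOn_id convex_univ)).sup
      (convexOn_const 0 convex_univ)
  have hiμ : Integrable (fun x : ℝ => max (a - x) 0) μ := ((integrable_const a).sub hμ).pos_part
  have hiν : Integrable (fun x : ℝ => max (a - x) 0) ν := ((integrable_const a).sub hν).pos_part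
  have hle := h _ hconv hiμ hiν
  rw [← integral_quantile_comp hfm, ← integral_quantile_comp hfm] at hle
  have hsub : Set.Ioo (0 : ℝ) u ⊆ Set.Ioo 0 1 := Set.Ioo_subset_Ioo_right hu1.le
  have hcompμ : Integrable (fun v => max (a - quantile μ v) 0) unitMeasure :=
    measurePreserving_quantile.integrable_comp_of_integrable (g := fun x => max (a - x) 0) hiμ
  have hν2 : ∫ v, max (a - quantile ν v) 0 ∂unitMeasure = ∫ v in (0 : ℝ)..u, (a - quantile ν v) := by
    rw [intervalIntegral.integral_of_le hu0.le, integral_Ioc_eq_integral_Ioo, unitMeasure,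
      ← integral_indicator measurableSet_Ioo, ← integral_indicator measurableSet_Ioo]
    refine integral_congr_ae ?_
    filter_upwards [compl_mem_ae_iff.2 (measure_singleton u)] with v hv
    by_cases h1 : v ∈ Set.Ioo (0 : ℝ) 1
    · rw [Set.indicator_of_mem h1]
      rcases lt_or_gt_of_ne (show v ≠ u from hv) with h2 | h2
      · rw [Set.indicator_of_mem (show v ∈ Set.Ioo 0 u from ⟨h1.1, h2⟩)]
        exact max_eq_left (sub_nonneg.2 (monotoneOn_quantile h1 hu' h2.le))
      · rw [Set.indicator_of_notMem (fun h3 => absurd h3.2 (not_lt.2 h2.le))]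
        exact max_eq_right (sub_nonpos.2 (monotoneOn_quantile hu' h1 h2.le))
    · rw [Set.indicator_of_notMem h1, Set.indicator_of_notMem fun h2 => h1 (hsub h2)]
  have hμ2 : ∫ v in (0 : ℝ)..u, (a - quantile μ v) ≤
      ∫ v, max (a - quantile μ v) 0 ∂unitMeasure := by
    rw [intervalIntegral.integral_of_le hu0.le, integral_Ioc_eq_integral_Ioo]
    calc _ ≤ ∫ v in Set.Ioo 0 u, max (a - quantile μ v) 0 := by
          refine integral_mono ?_ ?_ fun v => le_max_left _ _
          · exact (integrable_const a).sub (integrable_quantile hμ).integrableOn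
          · exact IntegrableOn.mono_set hcompμ hsub
      _ ≤ _ := setIntegral_mono_set hcompμ (ae_of_all _ fun v => le_max_right _ _)
          hsub.eventuallyLE
  have hfin := (hμ2.trans hle).trans hν2.le
  rw [intervalIntegral.integral_sub _root_.intervalIntegrable_const
    (integrable_quantile hμ).intervalIntegrable, intervalIntegral.integral_sub
    _root_.intervalIntegrable_const (integrable_quantile hν).intervalIntegrable] at hfin
  linarith

/-! ### The matching of levels by φ and the weight p -/

section Matched

variable {μ ν : Measure ℝ}

/-- `x` lies where `F_μ⁻¹ > F_ν⁻¹`, `y` lies where `F_μ⁻¹ < F_ν⁻¹`, and `φ` exchanges them. -/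
structure Matched (μ ν : Measure ℝ) (x y : ℝ) : Prop where
  left_mem : x ∈ Set.Ioo (0 : ℝ) 1
  right_mem : y ∈ Set.Ioo (0 : ℝ) 1
  left_lt : quantile ν x < quantile μ x
  mid_le : quantile μ x ≤ quantile μ y
  right_lt : quantile μ y < quantile ν y
  phi_left : phi μ ν x = y
  phi_right : phi μ ν y = x

/-- The two matched levels are the inverses of Ψ₊ and Ψ₋ at a common height `s`. As Ψ₋ ≤ Ψ₊, the
inverse of Ψ₊ comes first, and monotonicity of F_μ⁻¹ puts both values of F_μ⁻¹ between the two
values of F_ν⁻¹. -/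
lemma PsiOrdered.ae_matched (h : PsiOrdered μ ν) :
    ∀ᵐ s ∂volume.restrict (Set.Ioo 0 (psiPlus μ ν 1)),
      Matched μ ν (genInv (psiPlus μ ν) s) (genInv (psiMinus μ ν) s) := by
  have := h.left_prob
  have := h.right_prob
  have hμ := h.left_int
  have hν := h.right_int
  have h1 : ∀ᵐ s ∂volume.restrict (Set.Ioo 0 (psiPlus μ ν 1)),
      genInv (psiPlus μ ν) s ∈ Set.Ioo (0 : ℝ) 1 ∧
        0 < max (quantile μ (genInv (psiPlus μ ν) s) - quantile ν (genInv (psiPlus μ ν) s)) 0 := by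
    refine ae_genInv_of_ae (integrable_posPart_sub hμ hν) measurable_posPart_sub
      (fun _ => le_max_right _ _) (fun _ => rfl)
      (Q := fun u => u ∈ Set.Ioo (0 : ℝ) 1 ∧ 0 < max (quantile μ u - quantile ν u) 0) ?_
    filter_upwards [ae_unitMeasure_mem] with u hu h using ⟨hu, h⟩
  have h2 : ∀ᵐ s ∂volume.restrict (Set.Ioo 0 (psiMinus μ ν 1)),
      genInv (psiMinus μ ν) s ∈ Set.Ioo (0 : ℝ) 1 ∧
        0 < max (-(quantile μ (genInv (psiMinus μ ν) s) -
          quantile ν (genInv (psiMinus μ ν) s))) 0 := by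
    refine ae_genInv_of_ae (integrable_negPart_sub hμ hν) measurable_negPart_sub
      (fun _ => le_max_right _ _) (fun _ => rfl)
      (Q := fun u => u ∈ Set.Ioo (0 : ℝ) 1 ∧ 0 < max (-(quantile μ u - quantile ν u)) 0) ?_
    filter_upwards [ae_unitMeasure_mem] with u hu h using ⟨hu, h⟩
  rw [← h.psi_one] at h2
  filter_upwards [h1, h2, ae_restrict_mem measurableSet_Ioo] with s ⟨ha, hGa⟩ ⟨hb, hGb⟩ hs
  have hs' : s ≤ psiMinus μ ν 1 := h.psi_one ▸ hs.2.le
  have hPa : psiPlus μ ν (genInv (psiPlus μ ν) s) = s :=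
    apply_genInv (continuous_psiPlus hμ hν) (by simpa [psiPlus] using hs.1.le) hs.2.le
  have hMb : psiMinus μ ν (genInv (psiMinus μ ν) s) = s :=
    apply_genInv (continuous_psiMinus hμ hν) (by simpa [psiMinus] using hs.1.le) hs'
  have ha' : quantile ν (genInv (psiPlus μ ν) s) < quantile μ (genInv (psiPlus μ ν) s) := by
    simpa using hGa
  have hb' : quantile μ (genInv (psiMinus μ ν) s) < quantile ν (genInv (psiMinus μ ν) s) := by
    simpa using hGb
  have hab : genInv (psiPlus μ ν) s ≤ genInv (psiMinus μ ν) s := by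
    refine genInv_le ⟨hb.1.le, hb.2.le⟩ ?_
    calc s = psiMinus μ ν (genInv (psiMinus μ ν) s) := hMb.symm
      _ ≤ _ := h.psi_le _ ⟨hb.1.le, hb.2.le⟩
  refine ⟨ha, hb, ha', monotoneOn_quantile ha hb hab, hb', ?_, ?_⟩
  · rw [phi, if_pos ha', hPa]
  · rw [phi, if_neg (not_lt.2 hb'.le), if_pos hb', hMb]

lemma PsiOrdered.ae_matched_left (h : PsiOrdered μ ν) :
    ∀ᵐ u ∂unitMeasure, quantile ν u < quantile μ u → Matched μ ν u (phi μ ν u) := by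
  have := h.left_prob
  have := h.right_prob
  have h1 := ae_primitive_of_ae (Ψ := psiPlus μ ν) (integrable_posPart_sub h.left_int h.right_int)
    measurable_posPart_sub (fun _ => le_max_right _ _) (fun _ => rfl) h.ae_matched
  filter_upwards [h1] with u hu hlt
  obtain ⟨h2, h3⟩ := hu (by simpa using hlt)
  rw [h2] at h3
  rwa [h3.phi_left]

lemma PsiOrdered.ae_matched_right (h : PsiOrdered μ ν) :
    ∀ᵐ u ∂unitMeasure, quantile μ u < quantile ν u → Matched μ ν (phi μ ν u) u := by
  have := h.left_prob
  have := h.right_prob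
  have h1 := ae_primitive_of_ae (Ψ := psiMinus μ ν) (integrable_negPart_sub h.left_int h.right_int)
    measurable_negPart_sub (fun _ => le_max_right _ _) (fun _ => rfl)
    (R := fun s => Matched μ ν (genInv (psiPlus μ ν) s) (genInv (psiMinus μ ν) s))
    (by have := h.ae_matched; rwa [h.psi_one] at this)
  filter_upwards [h1] with u hu hlt
  obtain ⟨h2, h3⟩ := hu (by simpa using hlt)
  rw [h2] at h3
  rwa [h3.phi_right]

/-- The basic properties of the weight `p(u)`. -/
structure GoodWeight (μ ν : Measure ℝ) (u : ℝ) : Prop where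
  nonneg : 0 ≤ weight μ ν u
  le_one : weight μ ν u ≤ 1
  mul_sub : weight μ ν u * (quantile ν (phi μ ν u) - quantile ν u) = quantile μ u - quantile ν u
  eq_mul : weight μ ν u = |quantile μ u - quantile ν u| *
    |quantile ν (phi μ ν u) - quantile ν u|⁻¹
  ne_of_ne : quantile μ u ≠ quantile ν u → quantile ν (phi μ ν u) ≠ quantile ν u

/-- For matched levels F_μ⁻¹(u) lies between F_ν⁻¹(u) and F_ν⁻¹(φ(u)), so `weight` is a genuine
barycentric coordinate. -/
lemma PsiOrdered.ae_goodWeight (h : PsiOrdered μ ν) : ∀ᵐ u ∂unitMeasure, GoodWeight μ ν u := by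
  filter_upwards [h.ae_matched_left, h.ae_matched_right] with u hl hr
  rcases lt_trichotomy (quantile μ u) (quantile ν u) with h1 | h1 | h1
  · have h2 := hr h1
    have h3 := h2.left_lt
    have h4 := h2.mid_le
    have hw : weight μ ν u = (quantile μ u - quantile ν u) /
      (quantile ν (phi μ ν u) - quantile ν u) := if_pos h1.ne
    have hneg : quantile ν (phi μ ν u) - quantile ν u < 0 := by linarith
    refine ⟨?_, ?_, ?_, ?_, fun _ => (sub_neg.1 hneg).ne⟩
    · rw [hw]; exact div_nonneg_of_nonpos (by linarith) hneg.le
    · rw [hw, div_le_one_of_neg hneg]; linarith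
    · rw [hw, div_mul_cancel₀ _ hneg.ne]
    · rw [hw, abs_of_neg (sub_neg.2 h1), abs_of_neg hneg, ← div_eq_mul_inv, neg_div_neg_eq]
  · have hw : weight μ ν u = 0 := if_neg (not_not.2 h1)
    exact ⟨hw.ge, hw.trans_le zero_le_one, by rw [hw, h1]; ring, by rw [hw, h1]; simp,
      fun h => absurd h1 h⟩
  · have h2 := hl h1
    have h3 := h2.right_lt
    have h4 := h2.mid_le
    have hw : weight μ ν u = (quantile μ u - quantile ν u) /
      (quantile ν (phi μ ν u) - quantile ν u) := if_pos h1.ne'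
    have hpos : 0 < quantile ν (phi μ ν u) - quantile ν u := by linarith
    refine ⟨?_, ?_, ?_, ?_, fun _ => (sub_pos.1 hpos).ne'⟩
    · rw [hw]; exact div_nonneg (by linarith) hpos.le
    · rw [hw, div_le_one hpos]; linarith
    · rw [hw, div_mul_cancel₀ _ hpos.ne']
    · rw [hw, abs_of_pos (sub_pos.2 h1), abs_of_pos hpos, ← div_eq_mul_inv]

section Measurability

variable [IsProbabilityMeasure μ] [IsProbabilityMeasure ν]

lemma measurable_phi (hμ : Integrable (fun x : ℝ => x) μ) (hν : Integrable (fun x : ℝ => x) ν) :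
    Measurable (phi μ ν) := by
  have h1 := measurable_genInv (monotone_psiPlus hμ hν) (continuous_psiPlus hμ hν)
  have h2 := measurable_genInv (monotone_psiMinus hμ hν) (continuous_psiMinus hμ hν)
  have h3 := (continuous_psiPlus hμ hν).measurable
  have h4 := (continuous_psiMinus hμ hν).measurable
  unfold phi
  refine Measurable.ite (measurableSet_lt measurable_quantile measurable_quantile) (h2.comp h3) ?_
  exact Measurable.ite (measurableSet_lt measurable_quantile measurable_quantile) (h1.comp h4)
    measurable_id

lemma measurable_weight (hμ : Integrable (fun x : ℝ => x) μ)
    (hν : Integrable (fun x : ℝ => x) ν) : Measurable (weight μ ν) := by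
  have h1 := measurable_phi hμ hν
  unfold weight
  refine Measurable.ite (measurableSet_eq_fun measurable_quantile measurable_quantile).compl ?_
    measurable_const
  fun_prop

end Measurability

/-- Change of variables: the weight transports to two copies of Lebesgue measure. -/
lemma PsiOrdered.lintegral_weight (h : PsiOrdered μ ν) {f : ℝ → ENNReal} (hf : Measurable f) :
    ∫⁻ u, ENNReal.ofReal (weight μ ν u) * f u ∂unitMeasure =
      ∫⁻ s in Set.Ioo 0 (psiPlus μ ν 1),
        ENNReal.ofReal |quantile ν (genInv (psiMinus μ ν) s) -
          quantile ν (genInv (psiPlus μ ν) s)|⁻¹ *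
          (f (genInv (psiPlus μ ν) s) + f (genInv (psiMinus μ ν) s)) := by
  have := h.left_prob
  have := h.right_prob
  have hμ := h.left_int
  have hν := h.right_int
  have hphi := measurable_phi hμ hν
  have hga := measurable_genInv (monotone_psiPlus hμ hν) (continuous_psiPlus hμ hν)
  have hgb := measurable_genInv (monotone_psiMinus hμ hν) (continuous_psiMinus hμ hν)
  set k : ℝ → ENNReal := fun u =>
    ENNReal.ofReal |quantile ν (phi μ ν u) - quantile ν u|⁻¹ * f u with hk
  have hkm : Measurable k := by fun_prop
  have hP : Measurable fun v => ENNReal.ofReal (max (quantile μ v - quantile ν v) 0) := by fun_prop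
  have hN : Measurable fun v => ENNReal.ofReal (max (-(quantile μ v - quantile ν v)) 0) := by
    fun_prop
  -- The numerator of the weight splits into positive and negative parts, whose densities are images
  -- of Lebesgue measure on the same interval of heights. The denominator has the same absolute
  -- value at both matched levels.
  calc _ = ∫⁻ u, (ENNReal.ofReal (max (quantile μ u - quantile ν u) 0) * k u +
        ENNReal.ofReal (max (-(quantile μ u - quantile ν u)) 0) * k u) ∂unitMeasure := by
        refine lintegral_congr_ae ?_
        filter_upwards [h.ae_goodWeight] with u hu
        rw [hu.eq_mul, ENNReal.ofReal_mul (abs_nonneg _), ← add_mul, mul_assoc,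
          ← ENNReal.ofReal_add (le_max_right _ _) (le_max_right _ _)]
        congr 2
        rcases le_total 0 (quantile μ u - quantile ν u) with h | h
        · rw [max_eq_left h, max_eq_right (by linarith), abs_of_nonneg h]; ring
        · rw [max_eq_right h, max_eq_left (by linarith), abs_of_nonpos h]; ring
    _ = (∫⁻ s in Set.Ioo 0 (psiPlus μ ν 1), k (genInv (psiPlus μ ν) s)) +
        ∫⁻ s in Set.Ioo 0 (psiPlus μ ν 1), k (genInv (psiMinus μ ν) s) := by
        rw [lintegral_add_left (by fun_prop)]
        congr 1
        · rw [← lintegral_map hkm hga, map_genInv_primitive (Ψ := psiPlus μ ν)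
            (integrable_posPart_sub hμ hν) (fun _ => le_max_right _ _) (fun _ => rfl),
            lintegral_withDensity_eq_lintegral_mul _ hP hkm]
          rfl
        · rw [h.psi_one, ← lintegral_map hkm hgb,
            map_genInv_primitive (Ψ := psiMinus μ ν) (integrable_negPart_sub hμ hν)
            (fun _ => le_max_right _ _) (fun _ => rfl),
            lintegral_withDensity_eq_lintegral_mul _ hN hkm]
          rfl
    _ = _ := by
        rw [← lintegral_add_left (by fun_prop)]
        refine lintegral_congr_ae ?_
        filter_upwards [h.ae_matched] with s hs
        simp only [hk, hs.phi_left, hs.phi_right]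
        rw [abs_sub_comm (quantile ν (genInv (psiPlus μ ν) s)), mul_add]

/-- After the change of variables φ merely exchanges the two summands. This symmetry is why the
second marginal of the coupling is ν. -/
lemma PsiOrdered.lintegral_weight_swap (h : PsiOrdered μ ν) {f : ℝ → ENNReal}
    (hf : Measurable f) :
    ∫⁻ u, ENNReal.ofReal (weight μ ν u) * f (quantile ν (phi μ ν u)) ∂unitMeasure =
      ∫⁻ u, ENNReal.ofReal (weight μ ν u) * f (quantile ν u) ∂unitMeasure := by
  have := h.left_prob
  have := h.right_prob
  have hphi := measurable_phi h.left_int h.right_int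
  rw [h.lintegral_weight (f := fun u => f (quantile ν (phi μ ν u))) (by fun_prop),
    h.lintegral_weight (f := fun u => f (quantile ν u)) (by fun_prop)]
  refine lintegral_congr_ae ?_
  filter_upwards [h.ae_matched] with s hs
  simp only [hs.phi_left, hs.phi_right]
  rw [add_comm (f _)]

end Matched

/-! ### The inverse transform coupling and its marginals -/

section Coupling

variable {μ ν : Measure ℝ}

lemma dirac_prod_kernelIT (u : ℝ) :
    (Measure.dirac (quantile μ u)).prod (kernelIT μ ν u) =
      ENNReal.ofReal (weight μ ν u) •
        Measure.dirac (quantile μ u, quantile ν (phi μ ν u)) +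
      ENNReal.ofReal (1 - weight μ ν u) • Measure.dirac (quantile μ u, quantile ν u) := by
  rw [kernelIT, Measure.prod_add, Measure.prod_smul_right, Measure.prod_smul_right,
    Measure.dirac_prod_dirac, Measure.dirac_prod_dirac]

lemma PsiOrdered.measurable_dirac_prod_kernelIT (h : PsiOrdered μ ν) :
    Measurable fun u => (Measure.dirac (quantile μ u)).prod (kernelIT μ ν u) := by
  have := h.left_prob
  have := h.right_prob
  have hphi := measurable_phi h.left_int h.right_int
  have hw := measurable_weight h.left_int h.right_int
  refine Measure.measurable_of_measurable_coe _ fun s hs => ?_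
  simp only [dirac_prod_kernelIT, Measure.add_apply, Measure.smul_apply, smul_eq_mul,
    Measure.dirac_apply' _ hs]
  have h1 : Measurable fun u => s.indicator (1 : ℝ × ℝ → ENNReal)
      (quantile μ u, quantile ν (phi μ ν u)) :=
    (measurable_one.indicator hs).comp (by fun_prop)
  have h2 : Measurable fun u => s.indicator (1 : ℝ × ℝ → ENNReal) (quantile μ u, quantile ν u) :=
    (measurable_one.indicator hs).comp (by fun_prop)
  fun_prop

lemma PsiOrdered.lintegral_couplingIT (h : PsiOrdered μ ν) {f : ℝ × ℝ → ENNReal}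
    (hf : Measurable f) :
    ∫⁻ z, f z ∂couplingIT μ ν = ∫⁻ u, (ENNReal.ofReal (weight μ ν u) *
      f (quantile μ u, quantile ν (phi μ ν u)) +
      ENNReal.ofReal (1 - weight μ ν u) * f (quantile μ u, quantile ν u)) ∂unitMeasure := by
  rw [couplingIT, Measure.lintegral_bind h.measurable_dirac_prod_kernelIT.aemeasurable
    hf.aemeasurable]
  refine lintegral_congr fun u => ?_
  rw [dirac_prod_kernelIT, lintegral_add_measure, lintegral_smul_measure, lintegral_smul_measure,
    lintegral_dirac' _ hf, lintegral_dirac' _ hf, smul_eq_mul, smul_eq_mul]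

lemma GoodWeight.ofReal_add {u : ℝ} (h : GoodWeight μ ν u) :
    ENNReal.ofReal (weight μ ν u) + ENNReal.ofReal (1 - weight μ ν u) = 1 := by
  rw [← ENNReal.ofReal_add h.nonneg (sub_nonneg.2 h.le_one)]
  simp

lemma PsiOrdered.fst_couplingIT (h : PsiOrdered μ ν) : (couplingIT μ ν).fst = μ := by
  have := h.left_prob
  refine Measure.ext_of_lintegral _ fun f hf => ?_
  rw [Measure.fst, lintegral_map hf measurable_fst, h.lintegral_couplingIT (f := fun z => f z.1) (by fun_prop)]
  conv_rhs => rw [← map_quantile (η := μ), lintegral_map hf measurable_quantile]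
  refine lintegral_congr_ae ?_
  filter_upwards [h.ae_goodWeight] with u hu
  rw [← add_mul, hu.ofReal_add, one_mul]

lemma PsiOrdered.snd_couplingIT (h : PsiOrdered μ ν) : (couplingIT μ ν).snd = ν := by
  have := h.left_prob
  have := h.right_prob
  have hphi := measurable_phi h.left_int h.right_int
  have hw := measurable_weight h.left_int h.right_int
  refine Measure.ext_of_lintegral _ fun f hf => ?_
  rw [Measure.snd, lintegral_map hf measurable_snd, h.lintegral_couplingIT (f := fun z => f z.2) (by fun_prop),
    lintegral_add_left (by fun_prop), h.lintegral_weight_swap hf, ← lintegral_add_left (by fun_prop)]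
  conv_rhs => rw [← map_quantile (η := ν), lintegral_map hf measurable_quantile]
  refine lintegral_congr_ae ?_
  filter_upwards [h.ae_goodWeight] with u hu
  rw [← add_mul, hu.ofReal_add, one_mul]

lemma PsiOrdered.isProbabilityMeasure_couplingIT (h : PsiOrdered μ ν) :
    IsProbabilityMeasure (couplingIT μ ν) := by
  have := h.left_prob
  refine ⟨?_⟩
  rw [← Measure.fst_univ, h.fst_couplingIT, measure_univ]

end Coupling

/-! ### Consequences of Wasserstein convergence -/

section Wasserstein

variable {ρ : ℝ} {μ ν : Measure ℝ} {π : Measure (ℝ × ℝ)}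

lemma exists_coupling_of_wasserstein_lt (hρ : 0 < ρ) {c : ENNReal} (h : wasserstein ρ μ ν < c) :
    ∃ π, IsCoupling π μ ν ∧ ∫⁻ z, ‖z.1 - z.2‖ₑ ^ ρ ∂π < c ^ ρ := by
  rw [wasserstein] at h
  simp only [iInf_lt_iff] at h
  obtain ⟨π, hπ, h⟩ := h
  refine ⟨π, hπ, ?_⟩
  have := ENNReal.rpow_lt_rpow h hρ
  rwa [← ENNReal.rpow_mul, one_div, inv_mul_cancel₀ hρ.ne', ENNReal.rpow_one] at this

lemma IsCoupling.fst_preimage (h : IsCoupling π μ ν) {s : Set ℝ} (hs : MeasurableSet s) :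
    π (Prod.fst ⁻¹' s) = μ s := by
  rw [← h.1, Measure.fst_apply hs]

lemma IsCoupling.snd_preimage (h : IsCoupling π μ ν) {s : Set ℝ} (hs : MeasurableSet s) :
    π (Prod.snd ⁻¹' s) = ν s := by
  rw [← h.2, Measure.snd_apply hs]

lemma IsCoupling.lintegral_fst (h : IsCoupling π μ ν) {f : ℝ → ENNReal} (hf : Measurable f) :
    ∫⁻ z, f z.1 ∂π = ∫⁻ x, f x ∂μ := by
  rw [← h.1, Measure.fst, lintegral_map hf measurable_fst]

lemma IsCoupling.lintegral_snd (h : IsCoupling π μ ν) {f : ℝ → ENNReal} (hf : Measurable f) :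
    ∫⁻ z, f z.2 ∂π = ∫⁻ x, f x ∂ν := by
  rw [← h.2, Measure.snd, lintegral_map hf measurable_snd]

lemma IsCoupling.isProbabilityMeasure [IsProbabilityMeasure μ] (h : IsCoupling π μ ν) :
    IsProbabilityMeasure π := by
  refine ⟨?_⟩
  rw [← Measure.fst_univ, h.1, measure_univ]

lemma isCoupling_map {f g : ℝ → ℝ} {P : Measure ℝ} (hf : Measurable f) (hg : Measurable g) :
    IsCoupling (P.map fun u => (f u, g u)) (P.map f) (P.map g) :=
  ⟨Measure.fst_map_prodMk hg, Measure.snd_map_prodMk hf⟩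

lemma wasserstein_rpow_le [IsProbabilityMeasure μ] [IsProbabilityMeasure ν] (hρ : 0 < ρ) :
    wasserstein ρ μ ν ^ ρ ≤ ∫⁻ u, ‖quantile μ u - quantile ν u‖ₑ ^ ρ ∂unitMeasure := by
  have h := isCoupling_map (P := unitMeasure) (measurable_quantile (η := μ))
    (measurable_quantile (η := ν))
  rw [map_quantile, map_quantile] at h
  have h1 : wasserstein ρ μ ν ≤
      (∫⁻ u, ‖quantile μ u - quantile ν u‖ₑ ^ ρ ∂unitMeasure) ^ (1 / ρ) := by
    refine (iInf₂_le (_ : Measure (ℝ × ℝ)) h).trans (ENNReal.rpow_le_rpow ?_ (by positivity))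
    exact lintegral_map_le _ _
  calc _ ≤ _ := ENNReal.rpow_le_rpow h1 hρ.le
    _ = _ := by rw [← ENNReal.rpow_mul, one_div, inv_mul_cancel₀ hρ.ne', ENNReal.rpow_one]

/-- Off an event of probability at most `δ` the two coordinates differ by less than `ε`, as in the
Lévy distance. -/
lemma IsCoupling.cdf_le_add [IsProbabilityMeasure μ] [IsProbabilityMeasure ν]
    (h : IsCoupling π μ ν) {ε δ : ℝ} (hδ : 0 ≤ δ)
    (hπ : π {z | ENNReal.ofReal ε ≤ ‖z.1 - z.2‖ₑ} ≤ ENNReal.ofReal δ) (x : ℝ) :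
    cdf μ x ≤ cdf ν (x + ε) + δ ∧ cdf ν (x - ε) ≤ cdf μ x + δ := by
  have key : ∀ z : ℝ × ℝ, ¬ ENNReal.ofReal ε ≤ ‖z.1 - z.2‖ₑ → |z.1 - z.2| < ε := by
    intro z hz
    rw [Real.enorm_eq_ofReal_abs, not_le] at hz
    exact (ENNReal.ofReal_lt_ofReal_iff_of_nonneg (abs_nonneg _)).1 hz
  constructor
  · rw [← ENNReal.ofReal_le_ofReal_iff (add_nonneg (cdf_nonneg _ _) hδ),
      ENNReal.ofReal_add (cdf_nonneg _ _) hδ, ofReal_cdf, ofReal_cdf,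
      ← h.fst_preimage measurableSet_Iic, ← h.snd_preimage measurableSet_Iic]
    refine le_trans ((measure_mono fun z hz => ?_).trans (measure_union_le _ _))
      (add_le_add_right hπ _)
    by_cases hz2 : ENNReal.ofReal ε ≤ ‖z.1 - z.2‖ₑ
    · exact Or.inr hz2
    · have h1 : z.1 ≤ x := hz
      have h2 := abs_lt.1 (key z hz2)
      exact Or.inl (show z.2 ≤ x + ε by linarith)
  · rw [← ENNReal.ofReal_le_ofReal_iff (add_nonneg (cdf_nonneg _ _) hδ),
      ENNReal.ofReal_add (cdf_nonneg _ _) hδ, ofReal_cdf, ofReal_cdf,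
      ← h.fst_preimage measurableSet_Iic, ← h.snd_preimage measurableSet_Iic]
    refine le_trans ((measure_mono fun z hz => ?_).trans (measure_union_le _ _))
      (add_le_add_right hπ _)
    by_cases hz2 : ENNReal.ofReal ε ≤ ‖z.1 - z.2‖ₑ
    · exact Or.inr hz2
    · have h1 : z.2 ≤ x - ε := hz
      have h2 := abs_lt.1 (key z hz2)
      exact Or.inl (show z.1 ≤ x by linarith)

variable {μs : ℕ → Measure ℝ}

lemma tendsto_cdf_of_wasserstein (hρ : 0 < ρ) [∀ n, IsProbabilityMeasure (μs n)]
    [IsProbabilityMeasure μ] (h : Tendsto (fun n => wasserstein ρ (μs n) μ) atTop (𝓝 0))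
    {x : ℝ} (hx : ContinuousAt (cdf μ) x) :
    Tendsto (fun n => cdf (μs n) x) atTop (𝓝 (cdf μ x)) := by
  refine Metric.tendsto_atTop'.2 fun η hη => ?_
  obtain ⟨ε, hε, hball⟩ := Metric.continuousAt_iff.1 hx (η / 2) (by positivity)
  -- By Markov's inequality, cost below (ε/2)^ρ · η/3 forces P(|x - y| ≥ ε/2) ≤ η/3. Together with
  -- the oscillation η/2 of F_μ near `x` the total error stays below η.
  set c : ENNReal := (ENNReal.ofReal (ε / 2) ^ ρ * ENNReal.ofReal (η / 3)) with hc
  have hc0 : 0 < c := by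
    refine ENNReal.mul_pos (ENNReal.rpow_pos (by simpa using hε) (by simp)).ne' (by simpa using hη)
  have hev : ∀ᶠ n in atTop, wasserstein ρ (μs n) μ < c ^ (1 / ρ) :=
    h.eventually (gt_mem_nhds (ENNReal.rpow_pos hc0
      (ENNReal.mul_ne_top (ENNReal.rpow_ne_top_of_nonneg hρ.le (by simp)) (by simp))))
  obtain ⟨N, hN⟩ := eventually_atTop.1 hev
  refine ⟨N, fun n hn => ?_⟩
  obtain ⟨π, hπ, hlt⟩ := exists_coupling_of_wasserstein_lt hρ (hN n hn.le)
  rw [← ENNReal.rpow_mul, one_div, inv_mul_cancel₀ hρ.ne', ENNReal.rpow_one] at hlt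
  have hmark := mul_meas_ge_le_lintegral₀ (μ := π) (f := fun z => ‖z.1 - z.2‖ₑ ^ ρ)
    (by fun_prop) (ENNReal.ofReal (ε / 2) ^ ρ)
  have hset : {z : ℝ × ℝ | ENNReal.ofReal (ε / 2) ^ ρ ≤ ‖z.1 - z.2‖ₑ ^ ρ} =
      {z | ENNReal.ofReal (ε / 2) ≤ ‖z.1 - z.2‖ₑ} := by
    ext z
    exact ENNReal.rpow_le_rpow_iff hρ
  rw [hset] at hmark
  have hle : π {z | ENNReal.ofReal (ε / 2) ≤ ‖z.1 - z.2‖ₑ} ≤ ENNReal.ofReal (η / 3) :=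
    (ENNReal.mul_le_mul_iff_right (ENNReal.rpow_pos (by simpa using hε) (by simp)).ne'
      (ENNReal.rpow_ne_top_of_nonneg hρ.le (by simp))).1 (hmark.trans hlt.le)
  obtain ⟨h1, h2⟩ := hπ.cdf_le_add (by positivity) hle x
  have h3 := hball (x := x + ε / 2) (by simp [abs_of_pos hε, hε])
  have h4 := hball (x := x - ε / 2) (by simp [abs_of_pos hε, hε])
  rw [Real.dist_eq, abs_lt] at h3 h4 ⊢
  constructor <;> linarith

lemma dense_continuousAt_cdf (μ : Measure ℝ) : Dense {x | ContinuousAt (cdf μ) x} := by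
  have := (monotone_cdf μ).countable_not_continuousAt.dense_compl ℝ
  convert this using 1
  ext x
  simp

lemma tendsto_quantile_ae_of_wasserstein (hρ : 0 < ρ) [∀ n, IsProbabilityMeasure (μs n)]
    [IsProbabilityMeasure μ] (h : Tendsto (fun n => wasserstein ρ (μs n) μ) atTop (𝓝 0)) :
    ∀ᵐ u ∂unitMeasure, Tendsto (fun n => quantile (μs n) u) atTop (𝓝 (quantile μ u)) :=
  tendsto_quantile_ae (dense_continuousAt_cdf μ) fun _ hy => tendsto_cdf_of_wasserstein hρ h hy

/-- Minkowski's inequality in L^ρ of the coupling: the norm of order ρ is 1-Lipschitz for the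
transport cost, so moments converge along Wasserstein limits. -/
lemma moment_le_add (hρ : 1 ≤ ρ) (h : IsCoupling π μ ν) :
    (∫⁻ x, ‖x‖ₑ ^ ρ ∂μ) ^ (1 / ρ) ≤ (∫⁻ x, ‖x‖ₑ ^ ρ ∂ν) ^ (1 / ρ) +
      (∫⁻ z, ‖z.1 - z.2‖ₑ ^ ρ ∂π) ^ (1 / ρ) ∧
    (∫⁻ x, ‖x‖ₑ ^ ρ ∂ν) ^ (1 / ρ) ≤ (∫⁻ x, ‖x‖ₑ ^ ρ ∂μ) ^ (1 / ρ) +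
      (∫⁻ z, ‖z.1 - z.2‖ₑ ^ ρ ∂π) ^ (1 / ρ) := by
  rw [← h.lintegral_fst (f := fun x => ‖x‖ₑ ^ ρ) (by fun_prop),
    ← h.lintegral_snd (f := fun x => ‖x‖ₑ ^ ρ) (by fun_prop)]
  constructor
  · have := ENNReal.lintegral_Lp_add_le (μ := π) (f := fun z => ‖z.2‖ₑ)
      (g := fun z => ‖z.1 - z.2‖ₑ) (by fun_prop) (by fun_prop) hρ
    refine le_trans ?_ this
    refine ENNReal.rpow_le_rpow (lintegral_mono fun z => ?_) (by positivity)
    refine ENNReal.rpow_le_rpow ?_ (by positivity)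
    calc ‖z.1‖ₑ = ‖z.2 + (z.1 - z.2)‖ₑ := by congr 1; ring
      _ ≤ _ := enorm_add_le _ _
  · have := ENNReal.lintegral_Lp_add_le (μ := π) (f := fun z => ‖z.1‖ₑ)
      (g := fun z => ‖z.1 - z.2‖ₑ) (by fun_prop) (by fun_prop) hρ
    refine le_trans ?_ this
    refine ENNReal.rpow_le_rpow (lintegral_mono fun z => ?_) (by positivity)
    refine ENNReal.rpow_le_rpow ?_ (by positivity)
    calc ‖z.2‖ₑ = ‖z.1 - (z.1 - z.2)‖ₑ := by congr 1; ring
      _ ≤ _ := enorm_sub_le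

lemma MemP.moment_ne_top (hρ : 0 ≤ ρ) (h : MemP ρ μ) : ∫⁻ x, ‖x‖ₑ ^ ρ ∂μ ≠ ⊤ := by
  have h1 := h.integrable_abs_rpow.2
  rw [hasFiniteIntegral_iff_enorm] at h1
  convert h1.ne using 2 with x
  ext x
  rw [Real.enorm_rpow_of_nonneg (abs_nonneg x) hρ, Real.enorm_eq_ofReal_abs, Real.enorm_eq_ofReal_abs, abs_abs]

lemma tendsto_moment_of_wasserstein (hρ : 1 ≤ ρ) (hμ : ∫⁻ x, ‖x‖ₑ ^ ρ ∂μ ≠ ⊤)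
    (h : Tendsto (fun n => wasserstein ρ (μs n) μ) atTop (𝓝 0)) :
    Tendsto (fun n => ∫⁻ x, ‖x‖ₑ ^ ρ ∂μs n) atTop (𝓝 (∫⁻ x, ‖x‖ₑ ^ ρ ∂μ)) := by
  have hρ0 : 0 < ρ := by linarith
  have h1 : ∀ n, (∫⁻ x, ‖x‖ₑ ^ ρ ∂μs n) ^ (1 / ρ) ≤
      (∫⁻ x, ‖x‖ₑ ^ ρ ∂μ) ^ (1 / ρ) + wasserstein ρ (μs n) μ := fun n => by
    rw [← tsub_le_iff_left]
    exact le_iInf₂ fun π hπ => tsub_le_iff_left.2 (moment_le_add hρ hπ).1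
  have h2 : ∀ n, (∫⁻ x, ‖x‖ₑ ^ ρ ∂μ) ^ (1 / ρ) - wasserstein ρ (μs n) μ ≤
      (∫⁻ x, ‖x‖ₑ ^ ρ ∂μs n) ^ (1 / ρ) := fun n => by
    rw [tsub_le_iff_right, ← tsub_le_iff_left]
    exact le_iInf₂ fun π hπ => tsub_le_iff_left.2 (moment_le_add hρ hπ).2
  have hfin : (∫⁻ x, ‖x‖ₑ ^ ρ ∂μ) ^ (1 / ρ) ≠ ⊤ :=
    ENNReal.rpow_ne_top_of_nonneg (by positivity) hμ
  have h3 : Tendsto (fun n => (∫⁻ x, ‖x‖ₑ ^ ρ ∂μs n) ^ (1 / ρ)) atTop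
      (𝓝 ((∫⁻ x, ‖x‖ₑ ^ ρ ∂μ) ^ (1 / ρ))) := by
    refine tendsto_of_tendsto_of_tendsto_of_le_of_le ?_ ?_ h2 h1
    · simpa using ENNReal.Tendsto.sub (tendsto_const_nhds
        (x := (∫⁻ x, ‖x‖ₑ ^ ρ ∂μ) ^ (1 / ρ))) h (Or.inl hfin)
    · simpa using tendsto_const_nhds.add h
  have h4 := (ENNReal.continuous_rpow_const (y := ρ)).tendsto _ |>.comp h3
  simpa only [Function.comp_def, ← ENNReal.rpow_mul, one_div, inv_mul_cancel₀ hρ0.ne',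
    ENNReal.rpow_one] using h4

lemma lintegral_quantile_comp [IsProbabilityMeasure μ] {f : ℝ → ENNReal} (hf : Measurable f) :
    ∫⁻ u, f (quantile μ u) ∂unitMeasure = ∫⁻ x, f x ∂μ := by
  conv_rhs => rw [← map_quantile (η := μ), lintegral_map hf measurable_quantile]

lemma tendsto_lintegral_quantile_sub (hρ : 1 ≤ ρ) [∀ n, IsProbabilityMeasure (μs n)]
    [IsProbabilityMeasure μ] (hμ : ∫⁻ x, ‖x‖ₑ ^ ρ ∂μ ≠ ⊤)
    (h : Tendsto (fun n => wasserstein ρ (μs n) μ) atTop (𝓝 0)) :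
    Tendsto (fun n => ∫⁻ u, ‖quantile (μs n) u - quantile μ u‖ₑ ^ ρ ∂unitMeasure)
      atTop (𝓝 0) := by
  refine tendsto_lintegral_enorm_sub_rpow hρ (fun n => measurable_quantile.aemeasurable)
    measurable_quantile.aemeasurable (tendsto_quantile_ae_of_wasserstein (by linarith) h) ?_ ?_
  · rwa [lintegral_quantile_comp (f := fun x => ‖x‖ₑ ^ ρ) (by fun_prop)]
  · simp_rw [lintegral_quantile_comp (f := fun x => ‖x‖ₑ ^ ρ) (by fun_prop)]
    exact tendsto_moment_of_wasserstein hρ hμ h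

lemma lintegral_enorm_le_rpow {α : Type*} [MeasurableSpace α] {P : Measure α}
    [IsProbabilityMeasure P] (hρ : 1 ≤ ρ) {f : α → ℝ} (hf : AEMeasurable f P) :
    ∫⁻ a, ‖f a‖ₑ ∂P ≤ (∫⁻ a, ‖f a‖ₑ ^ ρ ∂P) ^ (1 / ρ) := by
  have h := eLpNorm'_le_eLpNorm'_of_exponent_le (μ := P) (f := f) (p := 1) (q := ρ) one_pos hρ
    hf.aestronglyMeasurable
  simpa [eLpNorm'] using h

lemma tendsto_lintegral_quantile_sub_one (hρ : 1 ≤ ρ) [∀ n, IsProbabilityMeasure (μs n)]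
    [IsProbabilityMeasure μ] (hμ : ∫⁻ x, ‖x‖ₑ ^ ρ ∂μ ≠ ⊤)
    (h : Tendsto (fun n => wasserstein ρ (μs n) μ) atTop (𝓝 0)) :
    Tendsto (fun n => ∫⁻ u, ‖quantile (μs n) u - quantile μ u‖ₑ ∂unitMeasure) atTop (𝓝 0) := by
  have h1 := tendsto_lintegral_quantile_sub hρ hμ h
  have h2 := (ENNReal.continuous_rpow_const (y := 1 / ρ)).tendsto _ |>.comp h1
  rw [ENNReal.zero_rpow_of_pos (by positivity)] at h2
  exact tendsto_of_tendsto_of_tendsto_of_le_of_le tendsto_const_nhds h2 (fun _ => zero_le)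
    fun n => lintegral_enorm_le_rpow hρ
      (measurable_quantile.sub measurable_quantile).aemeasurable

end Wasserstein

/-! ### Almost everywhere convergence of the lifted kernels -/

section Lift

variable {μs νs : ℕ → Measure ℝ} {μ ν : Measure ℝ}

lemma abs_primitive_sub_le {f g : ℝ → ℝ} (hf : Integrable f) (hg : Integrable g) {u : ℝ}
    (hu : u ∈ Set.Icc (0 : ℝ) 1) :
    |(∫ v in (0 : ℝ)..u, f v) - ∫ v in (0 : ℝ)..u, g v| ≤ ∫ v, |f v - g v| ∂unitMeasure := by
  have h1 : Integrable fun v => |f v - g v| := (hf.sub hg).abs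
  rw [← intervalIntegral.integral_sub hf.intervalIntegrable hg.intervalIntegrable]
  refine (intervalIntegral.abs_integral_le_integral_abs hu.1).trans ?_
  rw [← intervalIntegral_zero_one_eq]
  exact intervalIntegral.integral_mono_interval le_rfl hu.1 hu.2 (ae_of_all _ fun _ => abs_nonneg _)
    h1.intervalIntegrable

lemma tendsto_integral_abs_of_lintegral {α : Type*} [MeasurableSpace α] {P : Measure α}
    {f : ℕ → α → ℝ} (hf : ∀ n, AEStronglyMeasurable (f n) P)
    (h : Tendsto (fun n => ∫⁻ a, ‖f n a‖ₑ ∂P) atTop (𝓝 0)) :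
    Tendsto (fun n => ∫ a, |f n a| ∂P) atTop (𝓝 0) := by
  have := (ENNReal.tendsto_toReal ENNReal.zero_ne_top).comp h
  simpa only [Function.comp_def, ← integral_norm_eq_lintegral_enorm (hf _), Real.norm_eq_abs,
    ENNReal.toReal_zero] using this

/-- Convergence of the marginals in the sense that is used for the lifted coupling. -/
structure QuantileConv (μs : ℕ → Measure ℝ) (μ : Measure ℝ) : Prop where
  cdf : ∀ y, ContinuousAt (cdf μ) y → Tendsto (fun n => cdf (μs n) y) atTop (𝓝 (cdf μ y))
  lone : Tendsto (fun n => ∫ u, |quantile (μs n) u - quantile μ u| ∂unitMeasure) atTop (𝓝 0)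

lemma QuantileConv.ae (h : QuantileConv μs μ) :
    ∀ᵐ u ∂unitMeasure, Tendsto (fun n => quantile (μs n) u) atTop (𝓝 (quantile μ u)) :=
  tendsto_quantile_ae (dense_continuousAt_cdf μ) h.cdf

lemma QuantileConv.tendsto_comp (h : QuantileConv μs μ) {v : ℝ} (hv : v ∈ Set.Ioo (0 : ℝ) 1)
    (hc : ContinuousAt (quantile μ) v) {vs : ℕ → ℝ} (hvs : Tendsto vs atTop (𝓝 v)) :
    Tendsto (fun n => quantile (μs n) (vs n)) atTop (𝓝 (quantile μ v)) := by
  have hcount := (monotoneOn_quantile (η := μ)).countable_not_continuousWithinAt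
  refine tendsto_monotoneOn_comp isOpen_Ioo (fun n => monotoneOn_quantile)
    (hcount.dense_compl ℝ) (fun y hy hy1 => ?_) hv hc hvs
  refine tendsto_quantile (dense_continuousAt_cdf μ) h.cdf hy1 ?_
  by_contra hcon
  exact hy ⟨hy1, fun hw => hcon (hw.continuousAt (isOpen_Ioo.mem_nhds hy1))⟩

lemma abs_max_sub_max_zero_le (a b : ℝ) : |max a 0 - max b 0| ≤ |a - b| :=
  abs_max_sub_max_le_abs a b 0

/-- Taking positive parts is 1-Lipschitz, so the error is at most the sum of the L¹ distances of the
quantile functions. -/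
lemma tendsto_psiPlus (h : ∀ n, PsiOrdered (μs n) (νs n))
    [IsProbabilityMeasure μ] [IsProbabilityMeasure ν] (hμ : Integrable (fun x : ℝ => x) μ)
    (hν : Integrable (fun x : ℝ => x) ν) (hcμ : QuantileConv μs μ) (hcν : QuantileConv νs ν)
    {u : ℝ} (hu : u ∈ Set.Icc (0 : ℝ) 1) :
    Tendsto (fun n => psiPlus (μs n) (νs n) u) atTop (𝓝 (psiPlus μ ν u)) := by
  rw [tendsto_iff_dist_tendsto_zero]
  refine squeeze_zero (fun _ => dist_nonneg) (fun n => ?_)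
    (by simpa using hcμ.lone.add hcν.lone)
  have := (h n).left_prob
  have := (h n).right_prob
  have hμi := (h n).left_int
  have hνi := (h n).right_int
  rw [Real.dist_eq]
  have i1 : Integrable (fun v => |quantile (μs n) v - quantile μ v|) unitMeasure :=
    ((integrable_quantile hμi).sub (integrable_quantile hμ)).abs.integrableOn
  have i2 : Integrable (fun v => |quantile (νs n) v - quantile ν v|) unitMeasure :=
    ((integrable_quantile hνi).sub (integrable_quantile hν)).abs.integrableOn
  refine (abs_primitive_sub_le (integrable_posPart_sub hμi hνi)
    (integrable_posPart_sub hμ hν) hu).trans ?_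
  rw [← integral_add i1 i2]
  refine integral_mono_of_nonneg (ae_of_all _ fun _ => abs_nonneg _) (i1.add i2)
    (ae_of_all _ fun v => ?_)
  refine (abs_max_sub_max_zero_le _ _).trans ?_
  refine le_trans (le_of_eq ?_) (abs_sub (quantile (μs n) v - quantile μ v)
    (quantile (νs n) v - quantile ν v))
  congr 1
  ring

lemma tendsto_psiMinus (h : ∀ n, PsiOrdered (μs n) (νs n))
    [IsProbabilityMeasure μ] [IsProbabilityMeasure ν] (hμ : Integrable (fun x : ℝ => x) μ)
    (hν : Integrable (fun x : ℝ => x) ν) (hcμ : QuantileConv μs μ) (hcν : QuantileConv νs ν)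
    {u : ℝ} (hu : u ∈ Set.Icc (0 : ℝ) 1) :
    Tendsto (fun n => psiMinus (μs n) (νs n) u) atTop (𝓝 (psiMinus μ ν u)) := by
  rw [tendsto_iff_dist_tendsto_zero]
  refine squeeze_zero (fun _ => dist_nonneg) (fun n => ?_)
    (by simpa using hcμ.lone.add hcν.lone)
  have := (h n).left_prob
  have := (h n).right_prob
  have hμi := (h n).left_int
  have hνi := (h n).right_int
  rw [Real.dist_eq]
  have i1 : Integrable (fun v => |quantile (μs n) v - quantile μ v|) unitMeasure :=
    ((integrable_quantile hμi).sub (integrable_quantile hμ)).abs.integrableOn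
  have i2 : Integrable (fun v => |quantile (νs n) v - quantile ν v|) unitMeasure :=
    ((integrable_quantile hνi).sub (integrable_quantile hν)).abs.integrableOn
  refine (abs_primitive_sub_le (integrable_negPart_sub hμi hνi)
    (integrable_negPart_sub hμ hν) hu).trans ?_
  rw [← integral_add i1 i2]
  refine integral_mono_of_nonneg (ae_of_all _ fun _ => abs_nonneg _) (i1.add i2)
    (ae_of_all _ fun v => ?_)
  refine (abs_max_sub_max_zero_le _ _).trans ?_
  refine le_trans (le_of_eq ?_) (abs_sub (quantile (μs n) v - quantile μ v)
    (quantile (νs n) v - quantile ν v))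
  rw [← abs_neg]
  congr 1
  ring

/-- The order of the limit pair is not a hypothesis of the stability theorem; it is inherited here
because the relations between Ψ₊ and Ψ₋ are closed under pointwise limits. -/
lemma PsiOrdered.of_tendsto (h : ∀ n, PsiOrdered (μs n) (νs n)) (hμp : IsProbabilityMeasure μ)
    (hνp : IsProbabilityMeasure ν) (hμ : Integrable (fun x : ℝ => x) μ)
    (hν : Integrable (fun x : ℝ => x) ν) (hcμ : QuantileConv μs μ) (hcν : QuantileConv νs ν) :
    PsiOrdered μ ν := by
  have hp := fun u hu => tendsto_psiPlus h hμ hν hcμ hcν (u := u) hu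
  have hm := fun u hu => tendsto_psiMinus h hμ hν hcμ hcν (u := u) hu
  refine ⟨hμp, hνp, hμ, hν, fun u hu => ?_, ?_⟩
  · exact le_of_tendsto_of_tendsto' (hm u hu) (hp u hu) fun n => (h n).psi_le u hu
  · refine tendsto_nhds_unique (hp 1 (by simp)) ?_
    simpa only [(h _).psi_one] using hm 1 (by simp)

lemma ae_continuousAt_genInv {Ψ : ℝ → ℝ} (hm : Monotone Ψ) (hc : Continuous Ψ) :
    ∀ᵐ s ∂volume.restrict (Set.Ioo 0 (Ψ 1)), ContinuousAt (genInv Ψ) s :=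
  ae_continuousAt_of_monotoneOn isOpen_Ioo
    ((monotoneOn_genInv hm hc).mono fun _ hs => hs.2.le)

/-- Convergence of the second support point of the lifted kernel. -/
lemma ae_tendsto_quantile_phi (h : ∀ n, PsiOrdered (μs n) (νs n)) (hl : PsiOrdered μ ν)
    (hcμ : QuantileConv μs μ) (hcν : QuantileConv νs ν) :
    ∀ᵐ u ∂unitMeasure, quantile μ u ≠ quantile ν u →
      Tendsto (fun n => quantile (νs n) (phi (μs n) (νs n) u)) atTop
        (𝓝 (quantile ν (phi μ ν u))) := by
  have := hl.left_prob
  have := hl.right_prob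
  have hμ := hl.left_int
  have hν := hl.right_int
  have hp := fun u hu => tendsto_psiPlus h hμ hν hcμ hcν (u := u) hu
  have hm := fun u hu => tendsto_psiMinus h hμ hν hcμ hcν (u := u) hu
  have hcont := ae_continuousAt_of_monotoneOn isOpen_Ioo (monotoneOn_quantile (η := ν))
  have hP : ∀ᵐ s ∂volume.restrict (Set.Ioo 0 (psiPlus μ ν 1)),
      ContinuousAt (quantile ν) (genInv (psiPlus μ ν) s) :=
    ae_genInv_of_ae (integrable_posPart_sub hμ hν) measurable_posPart_sub
      (fun _ => le_max_right _ _) (fun _ => rfl)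
      (Q := fun v => ContinuousAt (quantile ν) v) (by filter_upwards [hcont] with u hu _ using hu)
  have hM : ∀ᵐ s ∂volume.restrict (Set.Ioo 0 (psiMinus μ ν 1)),
      ContinuousAt (quantile ν) (genInv (psiMinus μ ν) s) :=
    ae_genInv_of_ae (integrable_negPart_sub hμ hν) measurable_negPart_sub
      (fun _ => le_max_right _ _) (fun _ => rfl)
      (Q := fun v => ContinuousAt (quantile ν) v) (by filter_upwards [hcont] with u hu _ using hu)
  have hP2 := ae_continuousAt_genInv (monotone_psiPlus hμ hν) (continuous_psiPlus hμ hν)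
  have hM2 := ae_continuousAt_genInv (monotone_psiMinus hμ hν) (continuous_psiMinus hμ hν)
  rw [← hl.psi_one] at hM hM2
  -- At almost every height both generalised inverses are continuous, F_ν⁻¹ is continuous at both of
  -- their values, and the levels are matched. `ae_primitive_of_ae` then allows the height to be
  -- Ψ₊(u) or Ψ₋(u).
  have hall := (hP.and hM).and ((hP2.and hM2).and (hl.ae_matched.and
    (ae_restrict_mem measurableSet_Ioo)))
  have hL := ae_primitive_of_ae (Ψ := psiPlus μ ν) (integrable_posPart_sub hμ hν)
    measurable_posPart_sub (fun _ => le_max_right _ _) (fun _ => rfl) hall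
  rw [hl.psi_one] at hall
  have hR := ae_primitive_of_ae (Ψ := psiMinus μ ν) (integrable_negPart_sub hμ hν)
    measurable_negPart_sub (fun _ => le_max_right _ _) (fun _ => rfl) hall
  filter_upwards [hL, hR, hcμ.ae, hcν.ae, ae_unitMeasure_mem] with u hL hR hμu hνu hu hne
  have hu' : u ∈ Set.Icc (0 : ℝ) 1 := ⟨hu.1.le, hu.2.le⟩
  rcases lt_or_gt_of_ne hne with hlt | hlt
  · obtain ⟨h1, ⟨h2, -⟩, ⟨h3, -⟩, h4, h5⟩ := hR (by simpa using hlt)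
    have hphi : phi μ ν u = genInv (psiPlus μ ν) (psiMinus μ ν u) := by
      rw [phi, if_neg (not_lt.2 hlt.le), if_pos hlt]
    -- The strict inequality between the limit quantiles at `u` is eventually shared by the
    -- approximations, so φ_n(u) is eventually given by the same branch as φ(u).
    have hev : ∀ᶠ n in atTop, genInv (psiPlus (μs n) (νs n)) (psiMinus (μs n) (νs n) u) =
        phi (μs n) (νs n) u := by
      filter_upwards [hμu.eventually_lt hνu hlt] with n hn
      rw [phi, if_neg (not_lt.2 hn.le), if_pos hn]
    have hT := tendsto_genInv (Ψs := fun n => psiPlus (μs n) (νs n)) (Ψ := psiPlus μ ν)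
      (fun n => have := (h n).left_prob; have := (h n).right_prob
        continuous_psiPlus (h n).left_int (h n).right_int)
      (fun n => have := (h n).left_prob; have := (h n).right_prob
        monotone_psiPlus (h n).left_int (h n).right_int)
      (continuous_psiPlus hμ hν) hp (hm u hu')
      (fun n => ((h n).psi_le u hu').trans <|
        have := (h n).left_prob; have := (h n).right_prob
        monotone_psiPlus (h n).left_int (h n).right_int hu'.2)
      (by rw [hl.psi_one]; exact h5.2) h3 h4.left_mem
    rw [hphi]
    exact hcν.tendsto_comp h4.left_mem h2 (hT.congr' hev)
  · obtain ⟨h1, ⟨-, h2⟩, ⟨-, h3⟩, h4, h5⟩ := hL (by simpa using hlt)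
    have hphi : phi μ ν u = genInv (psiMinus μ ν) (psiPlus μ ν u) := by
      rw [phi, if_pos hlt]
    have hev : ∀ᶠ n in atTop, genInv (psiMinus (μs n) (νs n)) (psiPlus (μs n) (νs n) u) =
        phi (μs n) (νs n) u := by
      filter_upwards [hνu.eventually_lt hμu hlt] with n hn
      rw [phi, if_pos hn]
    have hT := tendsto_genInv (Ψs := fun n => psiMinus (μs n) (νs n)) (Ψ := psiMinus μ ν)
      (fun n => have := (h n).left_prob; have := (h n).right_prob
        continuous_psiMinus (h n).left_int (h n).right_int)
      (fun n => have := (h n).left_prob; have := (h n).right_prob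
        monotone_psiMinus (h n).left_int (h n).right_int)
      (continuous_psiMinus hμ hν) hm (hp u hu')
      (fun n => by
        have := (h n).left_prob; have := (h n).right_prob
        rw [← (h n).psi_one]
        exact monotone_psiPlus (h n).left_int (h n).right_int hu'.2)
      (by rw [← hl.psi_one]; exact h5.2) h3 h4.right_mem
    rw [hphi]
    exact hcν.tendsto_comp h4.right_mem h2 (hT.congr' hev)

/-- The distribution function of the lifted kernel `m̃_u`. -/
noncomputable def liftCdf (μ ν : Measure ℝ) (u y : ℝ) : ℝ :=
  weight μ ν u * (Set.Ici (quantile ν (phi μ ν u))).indicator 1 y +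
    (1 - weight μ ν u) * (Set.Ici (quantile ν u)).indicator 1 y

lemma PsiOrdered.measurable_liftCdf (h : PsiOrdered μ ν) :
    Measurable fun z : ℝ × ℝ => liftCdf μ ν z.1 z.2 := by
  have := h.left_prob
  have := h.right_prob
  have hphi := measurable_phi h.left_int h.right_int
  have hw := measurable_weight h.left_int h.right_int
  have key : ∀ f : ℝ → ℝ, Measurable f →
      Measurable fun z : ℝ × ℝ => (Set.Ici (f z.1)).indicator (1 : ℝ → ℝ) z.2 := by
    intro f hf
    have : (fun z : ℝ × ℝ => (Set.Ici (f z.1)).indicator (1 : ℝ → ℝ) z.2) =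
        {z : ℝ × ℝ | f z.1 ≤ z.2}.indicator 1 := by
      ext z
      simp [Set.indicator_apply]
    rw [this]
    exact measurable_one.indicator (measurableSet_le (by fun_prop) (by fun_prop))
  have h1 := key (fun u => quantile ν (phi μ ν u)) (by fun_prop)
  have h2 := key (quantile ν) (by fun_prop)
  unfold liftCdf
  fun_prop

lemma GoodWeight.liftCdf_mem {u : ℝ} (h : GoodWeight μ ν u) (y : ℝ) :
    liftCdf μ ν u y ∈ Set.Icc (0 : ℝ) 1 := by
  have h1 := h.nonneg
  have h2 := h.le_one
  unfold liftCdf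
  simp only [Set.indicator_apply, Pi.one_apply, Set.mem_Icc]
  split_ifs <;> constructor <;> linarith

lemma tendsto_indicator_Ici {xs : ℕ → ℝ} {x y : ℝ} (h : Tendsto xs atTop (𝓝 x)) (hy : y ≠ x) :
    Tendsto (fun n => (Set.Ici (xs n)).indicator (1 : ℝ → ℝ) y) atTop
      (𝓝 ((Set.Ici x).indicator 1 y)) := by
  refine tendsto_const_nhds.congr' ?_
  rcases lt_or_gt_of_ne hy with h1 | h1
  · filter_upwards [h.eventually (lt_mem_nhds h1)] with n hn
    rw [Set.indicator_of_notMem (by simpa using h1), Set.indicator_of_notMem (by simpa using hn)]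
  · filter_upwards [h.eventually (gt_mem_nhds h1)] with n hn
    rw [Set.indicator_of_mem (by simpa using h1.le), Set.indicator_of_mem (by simpa using hn.le)]

/-- Almost everywhere convergence of the lifted kernels. -/
lemma ae_tendsto_liftCdf (h : ∀ n, PsiOrdered (μs n) (νs n)) (hl : PsiOrdered μ ν)
    (hcμ : QuantileConv μs μ) (hcν : QuantileConv νs ν) :
    ∀ᵐ u ∂unitMeasure, ∀ y, y ≠ quantile ν u → y ≠ quantile ν (phi μ ν u) →
      Tendsto (fun n => liftCdf (μs n) (νs n) u y) atTop (𝓝 (liftCdf μ ν u y)) := by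
  filter_upwards [ae_tendsto_quantile_phi h hl hcμ hcν, hcμ.ae, hcν.ae,
    ae_all_iff.2 fun n => (h n).ae_goodWeight, hl.ae_goodWeight] with u hz hμu hνu hgn hg y hy1 hy2
  have hx := tendsto_indicator_Ici hνu hy1
  have hG : Tendsto (fun n => quantile (μs n) u - quantile (νs n) u) atTop
    (𝓝 (quantile μ u - quantile ν u)) := hμu.sub hνu
  unfold liftCdf
  by_cases heq : quantile μ u = quantile ν u
  · have hw : weight μ ν u = 0 := if_neg (not_not.2 heq)
    rw [hw, zero_mul, zero_add, sub_zero, one_mul]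
    rw [heq, sub_self] at hG
    -- Here φ_n(u) need not converge. The difference of indicators is nonzero only if `y` separates
    -- the two support points, which are then at least |y - F_{ν_n}⁻¹(u)| apart. As weight times
    -- displacement is |F_{μ_n}⁻¹ - F_{ν_n}⁻¹|(u), the product is at most this divided by |y -
    -- F_{ν_n}⁻¹(u)|, whose limit is positive.
    have key : Tendsto (fun n => weight (μs n) (νs n) u *
        ((Set.Ici (quantile (νs n) (phi (μs n) (νs n) u))).indicator (1 : ℝ → ℝ) y -
          (Set.Ici (quantile (νs n) u)).indicator 1 y)) atTop (𝓝 0) := by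
      have hb : Tendsto (fun n => |quantile (μs n) u - quantile (νs n) u| *
          |y - quantile (νs n) u|⁻¹) atTop (𝓝 0) := by
        have h1 := ((tendsto_const_nhds (x := y)).sub hνu).abs.inv₀
          (abs_ne_zero.2 (sub_ne_zero.2 hy1))
        simpa using hG.abs.mul h1
      refine squeeze_zero_norm' ?_ hb
      filter_upwards [hνu.eventually_ne hy1.symm] with n hn
      rw [Real.norm_eq_abs, abs_mul, abs_of_nonneg (hgn n).nonneg, ← (hgn n).mul_sub, abs_mul,
        abs_of_nonneg (hgn n).nonneg, mul_assoc]
      refine mul_le_mul_of_nonneg_left ?_ (hgn n).nonneg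
      have hpos : 0 < |y - quantile (νs n) u| := abs_pos.2 (sub_ne_zero.2 hn.symm)
      rw [← div_eq_mul_inv, le_div_iff₀ hpos]
      simp only [Set.indicator_apply, Set.mem_Ici, Pi.one_apply]
      split_ifs with h1 h2 h2
      · simp
      · rw [sub_zero, abs_one, one_mul, abs_of_neg (by linarith), abs_of_neg (by linarith)]
        linarith
      · rw [zero_sub, abs_neg, abs_one, one_mul, abs_of_nonneg (by linarith),
          abs_of_nonneg (by linarith)]
        linarith
      · simp
    have := key.add hx
    rw [zero_add] at this
    refine this.congr fun n => ?_
    ring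
  · have hz' := hz heq
    have hd : quantile ν (phi μ ν u) - quantile ν u ≠ 0 := sub_ne_zero.2 (hg.ne_of_ne heq)
    have hw : Tendsto (fun n => weight (μs n) (νs n) u) atTop (𝓝 (weight μ ν u)) := by
      have h1 : weight μ ν u = (quantile μ u - quantile ν u) /
        (quantile ν (phi μ ν u) - quantile ν u) := if_pos heq
      rw [h1]
      refine (hG.div (hz'.sub hνu) hd).congr' ?_
      filter_upwards [hG.eventually_ne (sub_ne_zero.2 heq)] with n hn
      exact (if_pos (sub_ne_zero.1 hn)).symm
    exact (hw.mul (tendsto_indicator_Ici hz' hy2)).add ((tendsto_const_nhds.sub hw).mul hx)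

end Lift

/-! ### Stability of conditional expectations under convergence of the conditioning variable -/

section CondExp

/-- The σ-algebra generated by a real function on the real line. -/
abbrev sig (f : ℝ → ℝ) : MeasurableSpace ℝ := MeasurableSpace.comap f inferInstance

variable {P : Measure ℝ} {f : ℝ → ℝ} {fs : ℕ → ℝ → ℝ}

/-- The `L¹` distance of the conditional expectations of `g` given `f` and given `f'`. -/
noncomputable def condGap (P : Measure ℝ) (f f' g : ℝ → ℝ) : ℝ :=
  ∫ u, |(P[g | sig f]) u - (P[g | sig f']) u| ∂P

lemma condGap_nonneg (f f' g : ℝ → ℝ) : 0 ≤ condGap P f f' g :=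
  integral_nonneg fun _ => abs_nonneg _

lemma integrable_condGap (f f' g : ℝ → ℝ) :
    Integrable (fun u => |(P[g | sig f]) u - (P[g | sig f']) u|) P :=
  (integrable_condExp.sub integrable_condExp).abs

lemma condGap_add_le {f' g h : ℝ → ℝ} (hg : Integrable g P) (hh : Integrable h P) :
    condGap P f f' (g + h) ≤ condGap P f f' g + condGap P f f' h := by
  unfold condGap
  rw [← integral_add (integrable_condGap f f' g) (integrable_condGap f f' h)]
  refine integral_mono_ae (integrable_condGap f f' _)
    ((integrable_condGap f f' g).add (integrable_condGap f f' h)) ?_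
  filter_upwards [condExp_add hg hh (sig f), condExp_add hg hh (sig f')] with u h1 h2
  rw [h1, h2, Pi.add_apply, Pi.add_apply]
  refine le_trans (le_of_eq ?_) (abs_add_le _ _)
  congr 1
  ring

lemma condGap_le (f f' g : ℝ → ℝ) : condGap P f f' g ≤ 2 * ∫ u, |g u| ∂P := by
  unfold condGap
  have i1 : Integrable (fun u => |(P[g | sig f]) u|) P := integrable_condExp.abs
  have i2 : Integrable (fun u => |(P[g | sig f']) u|) P := integrable_condExp.abs
  have h1 := integral_abs_condExp_le (m := sig f) (μ := P) g
  have h2 := integral_abs_condExp_le (m := sig f') (μ := P) g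
  calc _ ≤ ∫ u, (|(P[g | sig f]) u| + |(P[g | sig f']) u|) ∂P :=
        integral_mono (integrable_condGap f f' g) (i1.add i2) fun u => abs_sub _ _
    _ ≤ _ := by rw [integral_add i1 i2]; linarith

lemma condGap_le_add {f' g h : ℝ → ℝ} (hg : Integrable g P) (hh : Integrable h P) :
    condGap P f f' g ≤ condGap P f f' h + 2 * ∫ u, |g u - h u| ∂P := by
  have := condGap_add_le (f := f) (f' := f') hh (hg.sub hh)
  rw [add_sub_cancel] at this
  exact this.trans (add_le_add_right (condGap_le f f' _) _)

/-- Conditional expectation contracts L¹, so the gap changes by at most twice the L¹ error of the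
approximation. -/
lemma tendsto_condGap_of_approx {g : ℝ → ℝ} (hg : Integrable g P)
    (h : ∀ ε > 0, ∃ k : ℝ → ℝ, Integrable k P ∧ ∫ u, |g u - k u| ∂P ≤ ε ∧
      Tendsto (fun n => condGap P (fs n) f k) atTop (𝓝 0)) :
    Tendsto (fun n => condGap P (fs n) f g) atTop (𝓝 0) := by
  refine tendsto_order.2 ⟨fun a ha => Eventually.of_forall fun n =>
    ha.trans_le (condGap_nonneg _ _ _), fun b hb => ?_⟩
  obtain ⟨k, hk, hle, ht⟩ := h (b / 4) (by positivity)
  filter_upwards [ht.eventually (gt_mem_nhds (half_pos hb))] with n hn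
  have := condGap_le_add (f := fs n) (f' := f) hg hk
  linarith

variable [IsProbabilityMeasure P]

lemma condExp_comp_self (hf : Measurable f) {k : ℝ → ℝ} (hk : Measurable k)
    (hi : Integrable (fun u => k (f u)) P) : P[fun u => k (f u) | sig f] = fun u => k (f u) :=
  condExp_of_stronglyMeasurable hf.comap_le
    (hk.comp (comap_measurable f)).stronglyMeasurable hi

/-- Functions of `f` are asymptotically measurable with respect to `fs n → f`. -/
lemma tendsto_condGap_comp (hf : Measurable f) (hfs : ∀ n, Measurable (fs n))
    (hae : ∀ᵐ u ∂P, Tendsto (fun n => fs n u) atTop (𝓝 (f u))) {k : ℝ → ℝ}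
    (hk : Measurable k) (hi : Integrable (fun u => k (f u)) P) :
    Tendsto (fun n => condGap P (fs n) f (fun u => k (f u))) atTop (𝓝 0) := by
  refine tendsto_condGap_of_approx hi fun ε hε => ?_
  have := Measure.isProbabilityMeasure_map (μ := P) hf.aemeasurable
  have hi' : Integrable k (P.map f) :=
    (integrable_map_measure hk.aestronglyMeasurable hf.aemeasurable).2 hi
  obtain ⟨k', hle, hk'⟩ := hi'.exists_boundedContinuous_integral_sub_le hε
  have hm : Measurable k' := k'.continuous.measurable
  have hbd : ∀ h : ℝ → ℝ, Measurable h → Integrable (fun u => k' (h u)) P := fun h hh =>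
    Integrable.of_bound (hm.comp hh).aestronglyMeasurable ‖k'‖
      (ae_of_all _ fun u => k'.norm_coe_le_norm _)
  refine ⟨fun u => k' (f u), hbd f hf, ?_, ?_⟩
  · rw [integral_map hf.aemeasurable (by fun_prop)] at hle
    exact hle
  · have h1 : Tendsto (fun n => ∫ u, |k' (f u) - k' (fs n u)| ∂P) atTop (𝓝 0) := by
      rw [← integral_zero ℝ ℝ (μ := P)]
      refine tendsto_integral_of_dominated_convergence (fun _ => 2 * ‖k'‖)
        (fun n => ((hm.comp hf).sub (hm.comp (hfs n))).abs.aestronglyMeasurable)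
        (integrable_const _) (fun n => ae_of_all _ fun u => ?_) ?_
      · rw [Real.norm_eq_abs, abs_abs]
        have := abs_sub (k' (f u)) (k' (fs n u))
        have h3 := k'.norm_coe_le_norm (f u)
        have h4 := k'.norm_coe_le_norm (fs n u)
        rw [Real.norm_eq_abs] at h3 h4
        linarith
      · filter_upwards [hae] with u hu
        have := ((tendsto_const_nhds (x := k' (f u))).sub
          ((k'.continuous.tendsto _).comp hu)).abs
        simpa using this
    refine squeeze_zero (fun n => condGap_nonneg _ _ _) (fun n => ?_)
      (by simpa using h1.const_mul 2)
    have hif := hbd f hf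
    have hin := hbd (fs n) (hfs n)
    have i0 : Integrable (fun u => |k' (f u) - k' (fs n u)|) P := (hif.sub hin).abs
    have i1 : Integrable (fun u => |(P[(fun u => k' (f u)) - fun u => k' (fs n u) |
      sig (fs n)]) u|) P := integrable_condExp.abs
    have h2 := integral_abs_condExp_le (m := sig (fs n)) (μ := P)
      ((fun u => k' (f u)) - fun u => k' (fs n u))
    have h3 : condGap P (fs n) f (fun u => k' (f u)) ≤
        ∫ u, (|(P[(fun u => k' (f u)) - fun u => k' (fs n u) | sig (fs n)]) u| +
          |k' (f u) - k' (fs n u)|) ∂P := by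
      refine integral_mono_ae (integrable_condGap _ _ _) (i1.add i0) ?_
      filter_upwards [condExp_sub hif hin (sig (fs n))] with u h1
      rw [condExp_comp_self hf hm hif, h1, Pi.sub_apply, condExp_comp_self (hfs n) hm hin]
      refine le_trans (abs_sub_le _ (k' (fs n u)) _) ?_
      rw [abs_sub_comm (k' (fs n u))]
    rw [integral_add i1 i0] at h3
    have h4 : ∫ u, |((fun u => k' (f u)) - fun u => k' (fs n u)) u| ∂P =
      ∫ u, |k' (f u) - k' (fs n u)| ∂P := rfl
    linarith

/-- A fiber is an atom of the generated σ-algebra, so conditioning replaces a function on it by its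
average. On a null fiber the division by zero is harmless. -/
lemma condExp_indicator_fiber (hf : Measurable f) (x : ℝ) {g : ℝ → ℝ} (hg : Integrable g P) :
    P[(f ⁻¹' {x}).indicator g | sig f] =ᵐ[P]
      (f ⁻¹' {x}).indicator fun _ => (∫ u in f ⁻¹' {x}, g u ∂P) / P.real (f ⁻¹' {x}) := by
  set J := f ⁻¹' {x} with hJ
  have hJm : MeasurableSet J := hf (measurableSet_singleton x)
  refine (ae_eq_condExp_of_forall_setIntegral_eq hf.comap_le (hg.indicator hJm)
    (fun s _ _ => ((integrable_const _).indicator hJm).integrableOn) (fun s hs _ => ?_) ?_).symm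
  · obtain ⟨B, hB, rfl⟩ := hs
    rw [setIntegral_indicator hJm, setIntegral_indicator hJm, setIntegral_const, smul_eq_mul]
    by_cases hx : x ∈ B
    · have : f ⁻¹' B ∩ J = J := Set.inter_eq_right.2 fun u hu => by
        have : f u = x := hu
        simpa [this] using hx
      rw [this]
      by_cases h0 : P.real J = 0
      · have h1 : P J = 0 := (measureReal_eq_zero_iff).1 h0
        rw [h0, zero_mul, Measure.restrict_eq_zero.2 h1, integral_zero_measure]
      · exact mul_div_cancel₀ _ h0
    · have : f ⁻¹' B ∩ J = ∅ := Set.eq_empty_of_forall_notMem fun u hu => by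
        have h1 : f u = x := hu.2
        exact hx (h1 ▸ hu.1)
      simp [this]
  · have : Measurable[sig f] (J.indicator fun _ : ℝ =>
        (∫ u in J, g u ∂P) / P.real J) :=
      (@measurable_const _ _ _ (sig f) _).indicator ⟨{x}, measurableSet_singleton x, rfl⟩
    exact this.stronglyMeasurable.aestronglyMeasurable

lemma integral_abs_condExp_indicator_fiber_le (hf : Measurable f) (x : ℝ) {g : ℝ → ℝ}
    (hg : Integrable g P) :
    ∫ u, |(P[(f ⁻¹' {x}).indicator g | sig f]) u| ∂P ≤ |∫ u in f ⁻¹' {x}, g u ∂P| := by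
  have hJm : MeasurableSet (f ⁻¹' {x}) := hf (measurableSet_singleton x)
  have hcongr : ∫ u, |(P[(f ⁻¹' {x}).indicator g | sig f]) u| ∂P =
      ∫ u, |(f ⁻¹' {x}).indicator (fun _ : ℝ =>
        (∫ u in f ⁻¹' {x}, g u ∂P) / P.real (f ⁻¹' {x})) u| ∂P :=
    integral_congr_ae ((condExp_indicator_fiber hf x hg).fun_comp abs)
  rw [hcongr]
  have : (fun u => |(f ⁻¹' {x}).indicator (fun _ : ℝ =>
      (∫ u in f ⁻¹' {x}, g u ∂P) / P.real (f ⁻¹' {x})) u|) =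
      (f ⁻¹' {x}).indicator fun _ : ℝ =>
        |(∫ u in f ⁻¹' {x}, g u ∂P) / P.real (f ⁻¹' {x})| := by
    ext u
    by_cases hu : u ∈ f ⁻¹' {x}
    · rw [Set.indicator_of_mem hu, Set.indicator_of_mem hu]
    · rw [Set.indicator_of_notMem hu, Set.indicator_of_notMem hu, abs_zero]
  rw [this, integral_indicator hJm, setIntegral_const, smul_eq_mul, abs_div,
    abs_of_nonneg (measureReal_nonneg (μ := P))]
  by_cases h0 : P.real (f ⁻¹' {x}) = 0
  · rw [h0, zero_mul]; exact abs_nonneg _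
  · rw [mul_div_cancel₀ _ h0]

/-- On an atom of the limit that is asymptotically contained in an atom of the approximation,
conditional expectations converge. -/
lemma tendsto_condGap_indicator_fiber (hf : Measurable f) (hfs : ∀ n, Measurable (fs n))
    (hae : ∀ᵐ u ∂P, Tendsto (fun n => fs n u) atTop (𝓝 (f u))) {x : ℝ} {xs : ℕ → ℝ}
    (hx : Tendsto (fun n => P.real (f ⁻¹' {x} \ fs n ⁻¹' {xs n})) atTop (𝓝 0))
    {g : ℝ → ℝ} (hg : Measurable g) {C : ℝ} (hC : ∀ᵐ u ∂P, |g u| ≤ C) :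
    Tendsto (fun n => condGap P (fs n) f ((f ⁻¹' {x}).indicator g)) atTop (𝓝 0) := by
  set I := f ⁻¹' {x} with hI
  have hIm : MeasurableSet I := hf (measurableSet_singleton x)
  have hgi : Integrable g P := Integrable.of_bound hg.aestronglyMeasurable C hC
  set c : ℝ := (∫ u in I, g u ∂P) / P.real I with hc
  -- On the fiber `g` is split into its mean `c`, which gives a function of `f`, and a remainder `h`
  -- with integral zero, which conditioning on `f` annihilates.
  set h : ℝ → ℝ := I.indicator fun u => g u - c with hh
  have hgc : Integrable (fun u => g u - c) P := hgi.sub (integrable_const c)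
  have hhi : Integrable h P := hgc.indicator hIm
  have hk : (fun u => ({x} : Set ℝ).indicator (fun _ => c) (f u)) = I.indicator fun _ => c := by
    ext u
    by_cases hu : f u = x
    · rw [Set.indicator_of_mem (show f u ∈ ({x} : Set ℝ) from hu),
        Set.indicator_of_mem (show u ∈ I from hu)]
    · rw [Set.indicator_of_notMem (show f u ∉ ({x} : Set ℝ) from hu),
        Set.indicator_of_notMem (show u ∉ I from hu)]
  have hki : Integrable (fun u => ({x} : Set ℝ).indicator (fun _ => c) (f u)) P := by
    rw [hk]
    exact (integrable_const c).indicator hIm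
  have h1 := tendsto_condGap_comp hf hfs hae
    (k := ({x} : Set ℝ).indicator fun _ => c) (measurable_const.indicator
      (measurableSet_singleton x)) hki
  have hsum : I.indicator g = (fun u => ({x} : Set ℝ).indicator (fun _ => c) (f u)) + h := by
    rw [hk, hh]
    ext u
    by_cases hu : u ∈ I
    · simp only [Pi.add_apply, Set.indicator_of_mem hu, add_sub_cancel]
    · simp only [Pi.add_apply, Set.indicator_of_notMem hu, add_zero]
  have hzero : ∫ u in I, (g u - c) ∂P = 0 := by
    rw [integral_sub hgi.integrableOn (integrable_const c).integrableOn, setIntegral_const,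
      smul_eq_mul, hc]
    by_cases h0 : P.real I = 0
    · have h1 : P I = 0 := (measureReal_eq_zero_iff).1 h0
      rw [h0, zero_mul, Measure.restrict_eq_zero.2 h1, integral_zero_measure, sub_zero]
    · rw [mul_div_cancel₀ _ h0, sub_self]
  have hcond0 : P[h | sig f] =ᵐ[P] 0 := by
    refine (condExp_indicator_fiber hf x hgc).trans (Eq.eventuallyEq ?_)
    rw [← hI, hzero, zero_div]
    exact Set.indicator_zero _ _
  have hhb : ∀ᵐ u ∂P, |h u| ≤ I.indicator (fun _ => C + |c|) u := by
    filter_upwards [hC] with u hu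
    by_cases hI' : u ∈ I
    · rw [hh, Set.indicator_of_mem hI', Set.indicator_of_mem hI']
      exact (abs_sub _ _).trans (by linarith)
    · rw [hh, Set.indicator_of_notMem hI', Set.indicator_of_notMem hI', abs_zero]
  have hintI : ∫ u, h u ∂P = 0 := by rw [hh, integral_indicator hIm, hzero]
  have h2 : Tendsto (fun n => condGap P (fs n) f h) atTop (𝓝 0) := by
    refine squeeze_zero (fun n => condGap_nonneg _ _ _) (fun n => ?_)
      (by simpa using hx.const_mul (2 * (C + |c|)))
    -- On `J`, an atom of the σ-algebra of f_n, conditioning leaves only |∫_J h|. Since `h` has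
    -- integral zero, this equals |∫_{Jᶜ} h|. Both pieces are thus controlled by `h` off `J`, which
    -- is bounded and lives on `I \ J`, of vanishing measure.
    set J := fs n ⁻¹' {xs n} with hJ
    have hJm : MeasurableSet J := hfs n (measurableSet_singleton _)
    have hsplit : h = J.indicator h + Jᶜ.indicator h := (Set.indicator_self_add_compl J h).symm
    have i1 : Integrable (J.indicator h) P := hhi.indicator hJm
    have i2 : Integrable (Jᶜ.indicator h) P := hhi.indicator hJm.compl
    have e1 : ∫ u, |(P[J.indicator h | sig (fs n)]) u| ∂P ≤ |∫ u in J, h u ∂P| :=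
      integral_abs_condExp_indicator_fiber_le (hfs n) (xs n) hhi
    have e2 := integral_abs_condExp_le (m := sig (fs n)) (μ := P) (Jᶜ.indicator h)
    have e3 : |∫ u in J, h u ∂P| ≤ ∫ u, |Jᶜ.indicator h u| ∂P := by
      have := integral_add_compl hJm hhi
      rw [hintI] at this
      rw [eq_neg_of_add_eq_zero_left this, abs_neg, ← integral_indicator hJm.compl]
      exact abs_integral_le_integral_abs
    have e4 : ∫ u, |Jᶜ.indicator h u| ∂P ≤ (C + |c|) * P.real (I \ J) := by
      have hIJ : MeasurableSet (I \ J) := hIm.diff hJm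
      calc _ ≤ ∫ u, (I \ J).indicator (fun _ => C + |c|) u ∂P := by
            refine integral_mono_ae i2.abs ((integrable_const _).indicator hIJ) ?_
            filter_upwards [hhb] with u hu
            by_cases h3 : u ∈ J
            · rw [Set.indicator_of_notMem (show u ∉ Jᶜ by simpa using h3),
                Set.indicator_of_notMem (fun h4 => h4.2 h3), abs_zero]
            · rw [Set.indicator_of_mem (show u ∈ Jᶜ from h3)]
              refine hu.trans (le_of_eq ?_)
              by_cases h4 : u ∈ I
              · rw [Set.indicator_of_mem h4, Set.indicator_of_mem (show u ∈ I \ J from ⟨h4, h3⟩)]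
              · rw [Set.indicator_of_notMem h4, Set.indicator_of_notMem (fun h5 => h4 h5.1)]
        _ = _ := by
            rw [integral_indicator hIJ, setIntegral_const, smul_eq_mul, mul_comm]
    have i3 : Integrable (fun u => |(P[J.indicator h | sig (fs n)]) u|) P :=
      integrable_condExp.abs
    have i4 : Integrable (fun u => |(P[Jᶜ.indicator h | sig (fs n)]) u|) P :=
      integrable_condExp.abs
    have e5 : condGap P (fs n) f h ≤ ∫ u, (|(P[J.indicator h | sig (fs n)]) u| +
        |(P[Jᶜ.indicator h | sig (fs n)]) u|) ∂P := by
      refine integral_mono_ae (integrable_condGap _ _ _) (i3.add i4) ?_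
      have := condExp_add i1 i2 (sig (fs n))
      rw [← hsplit] at this
      filter_upwards [this, hcond0] with u h1 h2
      rw [h1, h2, Pi.zero_apply, sub_zero]
      exact abs_add_le _ _
    rw [integral_add i3 i4] at e5
    linarith
  refine squeeze_zero (fun n => condGap_nonneg _ _ _) (fun n => ?_)
    (by have := h1.add h2; rwa [add_zero] at this)
  rw [hsum]
  exact condGap_add_le hki hhi

end CondExp

/-! ### Atoms of μ and the condition on the jumps -/

section Atoms

variable {μ : Measure ℝ} {μs : ℕ → Measure ℝ}

lemma leftLim_cdf_le {u : ℝ} (hu : u ∈ Set.Ioo (0 : ℝ) 1) :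
    Function.leftLim (cdf μ) (quantile μ u) ≤ u := by
  refine le_of_tendsto ((monotone_cdf μ).tendsto_leftLim _) ?_
  filter_upwards [self_mem_nhdsWithin] with x hx
  exact ((lt_quantile_iff hu).1 hx).le

lemma quantile_eq_of_mem {u x : ℝ} (hu : u ∈ Set.Ioo (0 : ℝ) 1)
    (h1 : Function.leftLim (cdf μ) x < u) (h2 : u ≤ cdf μ x) : quantile μ u = x := by
  refine le_antisymm ((quantile_le_iff hu).2 h2) (le_of_forall_lt fun y hy => ?_)
  exact (lt_quantile_iff hu).2 (((monotone_cdf μ).le_leftLim hy).trans_lt h1)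

lemma real_singleton_eq [IsProbabilityMeasure μ] (x : ℝ) :
    μ.real {x} = cdf μ x - Function.leftLim (cdf μ) x := by
  have h := (cdf μ).measure_singleton x
  rw [measure_cdf] at h
  rw [measureReal_def, h, ENNReal.toReal_ofReal]
  exact sub_nonneg.2 ((monotone_cdf μ).leftLim_le le_rfl)

lemma cdf_quantile_of_singleton [IsProbabilityMeasure μ] {u : ℝ} (hu : u ∈ Set.Ioo (0 : ℝ) 1)
    (h : μ {quantile μ u} = 0) : cdf μ (quantile μ u) = u := by
  have h1 := real_singleton_eq (μ := μ) (quantile μ u)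
  rw [measureReal_def, h, ENNReal.toReal_zero] at h1
  have h2 := leftLim_cdf_le (μ := μ) hu
  have h3 := (quantile_le_iff (η := μ) hu).1 le_rfl
  linarith

/-- Up to endpoints, the fiber of the quantile function over `x` is the jump interval (F_μ(x-),
F_μ(x)]. The expression in the condition on the jumps is the signed length of its overlap with a
jump interval of F_{μ_n}. -/
lemma tendsto_real_fiber_diff [IsProbabilityMeasure μ] {x : ℝ} {xs : ℕ → ℝ}
    (h : Tendsto (fun n => min (cdf (μs n) (xs n)) (cdf μ x) -
      max (Function.leftLim (cdf (μs n)) (xs n)) (Function.leftLim (cdf μ) x))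
      atTop (𝓝 (μ.real {x}))) :
    Tendsto (fun n => unitMeasure.real (quantile μ ⁻¹' {x} \ quantile (μs n) ⁻¹' {xs n}))
      atTop (𝓝 0) := by
  have h1 := (tendsto_const_nhds (x := μ.real {x})).sub h
  rw [sub_self] at h1
  refine squeeze_zero (fun _ => measureReal_nonneg) (fun n => ?_) h1
  set a := Function.leftLim (cdf μ) x
  set b := cdf μ x
  set c := Function.leftLim (cdf (μs n)) (xs n)
  set d := cdf (μs n) (xs n)
  have hab : a ≤ b := (monotone_cdf μ).leftLim_le le_rfl
  have hsub : (quantile μ ⁻¹' {x} \ quantile (μs n) ⁻¹' {xs n}) ∩ Set.Ioo 0 1 ⊆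
      Set.Icc a b \ Set.Ioc (max c a) (min d b) := by
    rintro u ⟨⟨h1, h2⟩, hu⟩
    have h1' : quantile μ u = x := h1
    refine ⟨⟨?_, ?_⟩, fun h3 => h2 ?_⟩
    · simpa [h1'] using leftLim_cdf_le (μ := μ) hu
    · exact (quantile_le_iff hu).1 h1'.le
    · exact quantile_eq_of_mem hu ((le_max_left _ _).trans_lt h3.1) (h3.2.trans (min_le_left _ _))
  have hm : MeasurableSet (quantile μ ⁻¹' {x} \ quantile (μs n) ⁻¹' {xs n}) :=
    (measurable_quantile (measurableSet_singleton _)).diff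
      (measurable_quantile (measurableSet_singleton _))
  rw [measureReal_restrict_apply hm]
  have hfin : volume (Set.Icc a b \ Set.Ioc (max c a) (min d b)) ≠ ⊤ :=
    measure_ne_top_of_subset Set.sdiff_subset (by simp)
  refine (measureReal_mono hsub hfin).trans ?_
  have hsub2 : Set.Ioc (max c a) (min d b) ⊆ Set.Icc a b := fun u hu =>
    ⟨(le_max_right _ _).trans hu.1.le, hu.2.trans (min_le_right _ _)⟩
  rw [measureReal_sdiff hsub2 measurableSet_Ioc (by simp), real_singleton_eq, Real.volume_real_Icc,
    Real.volume_real_Ioc, max_eq_left (by linarith)]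
  have := le_max_left (min d b - max c a) 0
  linarith

lemma countable_atoms (μ : Measure ℝ) [IsProbabilityMeasure μ] : {x | 0 < μ {x}}.Countable := by
  refine Measure.countable_meas_pos_of_disjoint_iUnion (μ := μ) (As := fun x : ℝ => {x})
    (fun x => measurableSet_singleton x) fun x y hxy => ?_
  simpa using hxy

/-- Only finitely many atoms have mass at least 1/(k+1), and these sets exhaust all atoms as k
grows. The jump condition, which is not uniform over atoms, is then needed only finitely often. -/
lemma exists_finset_atoms (μ : Measure ℝ) [IsProbabilityMeasure μ] {ε : ℝ} (hε : 0 < ε) :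
    ∃ S : Finset ℝ, (∀ x ∈ S, 0 < μ {x}) ∧ μ.real ({x | 0 < μ {x}} \ S) ≤ ε := by
  set T : ℕ → Set ℝ := fun k => {x | ((k : ENNReal) + 1)⁻¹ ≤ μ {x}} with hT
  have hfin : ∀ k, (T k).Finite := fun k =>
    Measure.finite_const_le_meas_of_disjoint_iUnion μ (As := fun x : ℝ => {x})
      (by simp) (fun x => measurableSet_singleton x)
      (fun x y hxy => by simpa using hxy) (measure_ne_top _ _)
  have hlim : Tendsto (fun k => μ ({x | 0 < μ {x}} \ T k)) atTop
      (𝓝 (μ (⋂ k, {x | 0 < μ {x}} \ T k))) := by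
    refine tendsto_measure_iInter_atTop (fun k => ?_) (fun i j hij x hx => ⟨hx.1, fun h => hx.2 ?_⟩)
      ⟨0, measure_ne_top _ _⟩
    · exact ((countable_atoms μ).measurableSet.diff (hfin k).measurableSet).nullMeasurableSet
    · refine le_trans ?_ (show ((i : ENNReal) + 1)⁻¹ ≤ μ {x} from h)
      gcongr
  have hemp : (⋂ k, {x | 0 < μ {x}} \ T k) = ∅ := by
    refine Set.eq_empty_of_forall_notMem fun x hx => ?_
    rw [Set.mem_iInter] at hx
    have hx0 : μ {x} ≠ 0 := (show 0 < μ {x} from (hx 0).1).ne'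
    obtain ⟨k, hk⟩ := ENNReal.exists_inv_nat_lt hx0
    refine (hx k).2 (le_trans ?_ hk.le)
    exact ENNReal.inv_le_inv.2 le_self_add
  rw [hemp, measure_empty] at hlim
  have hlim' := (ENNReal.tendsto_toReal ENNReal.zero_ne_top).comp hlim
  obtain ⟨k, hk⟩ := (hlim'.eventually (gt_mem_nhds (by simpa using hε))).exists
  refine ⟨(hfin k).toFinset, fun x hx => ?_, ?_⟩
  · have h1 : ((k : ENNReal) + 1)⁻¹ ≤ μ {x} := by simpa [hT] using hx
    refine lt_of_lt_of_le ?_ h1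
    simp
  · rw [Set.Finite.coe_toFinset]
    exact hk.le

/-- Stability of conditional expectations given the quantile functions. -/
lemma tendsto_condGap_quantile [IsProbabilityMeasure μ]
    (hae : ∀ᵐ u ∂unitMeasure, Tendsto (fun n => quantile (μs n) u) atTop (𝓝 (quantile μ u)))
    (hJ : JumpsAsymptoticallyContained μs μ) {g : ℝ → ℝ} (hg : Measurable g) {C : ℝ}
    (hC : ∀ᵐ u ∂unitMeasure, |g u| ≤ C) :
    Tendsto (fun n => condGap unitMeasure (quantile (μs n)) (quantile μ) g) atTop (𝓝 0) := by
  have hq : Measurable (quantile μ) := measurable_quantile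
  have hqs : ∀ n, Measurable (quantile (μs n)) := fun n => measurable_quantile
  have hgi : Integrable g unitMeasure := Integrable.of_bound hg.aestronglyMeasurable C hC
  set T : Set ℝ := {x | 0 < μ {x}} with hT
  have hTm : MeasurableSet T := (countable_atoms μ).measurableSet
  have hfinite : ∀ S : Finset ℝ, (∀ x ∈ S, 0 < μ {x}) → Tendsto (fun n => condGap unitMeasure
      (quantile (μs n)) (quantile μ) ((quantile μ ⁻¹' (S : Set ℝ)).indicator g)) atTop (𝓝 0) := by
    intro S
    induction S using Finset.induction_on with
    | empty =>
      intro _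
      simp [condGap]
    | insert x S hxS ih =>
      intro hS
      have h1 := ih fun y hy => hS y (Finset.mem_insert_of_mem hy)
      obtain ⟨xs, hxs⟩ := hJ x (hS x (Finset.mem_insert_self x S))
      have h2 := tendsto_condGap_indicator_fiber hq hqs hae (tendsto_real_fiber_diff hxs) hg hC
      have hdisj : Disjoint (quantile μ ⁻¹' {x}) (quantile μ ⁻¹' (S : Set ℝ)) :=
        Disjoint.preimage _ (by simpa using hxS)
      have hset : (quantile μ ⁻¹' ((insert x S : Finset ℝ) : Set ℝ)).indicator g =
          (quantile μ ⁻¹' {x}).indicator g + (quantile μ ⁻¹' (S : Set ℝ)).indicator g := by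
        rw [Finset.coe_insert, Set.insert_eq, Set.preimage_union]
        exact Set.indicator_union_of_disjoint hdisj g
      rw [hset]
      refine squeeze_zero (fun n => condGap_nonneg _ _ _) (fun n => condGap_add_le
        (hgi.indicator (hq (measurableSet_singleton x)))
        (hgi.indicator (hq S.measurableSet))) ?_
      have := h2.add h1
      rwa [add_zero] at this
  -- Away from the atoms F_μ inverts F_μ⁻¹, so there `g` is a function of the quantile and
  -- `tendsto_condGap_comp` applies.
  have hk : Measurable (Tᶜ.indicator fun x => g (cdf μ x)) :=
    (hg.comp (monotone_cdf μ).measurable).indicator hTm.compl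
  have hkae : (fun u => Tᶜ.indicator (fun x => g (cdf μ x)) (quantile μ u)) =ᵐ[unitMeasure]
      (quantile μ ⁻¹' Tᶜ).indicator g := by
    filter_upwards [ae_unitMeasure_mem] with u hu
    by_cases hm : quantile μ u ∈ Tᶜ
    · rw [Set.indicator_of_mem hm, Set.indicator_of_mem (show u ∈ quantile μ ⁻¹' Tᶜ from hm),
        cdf_quantile_of_singleton hu (by simpa [hT] using hm)]
    · rw [Set.indicator_of_notMem hm,
        Set.indicator_of_notMem (show u ∉ quantile μ ⁻¹' Tᶜ from hm)]
  have hki : Integrable (fun u => Tᶜ.indicator (fun x => g (cdf μ x)) (quantile μ u))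
      unitMeasure := (hgi.indicator (hq hTm.compl)).congr hkae.symm
  have h1 := tendsto_condGap_comp hq hqs hae hk hki
  refine tendsto_condGap_of_approx hgi fun ε hε => ?_
  -- The neglected atoms contribute at most |C| times their mass; the added 1 avoids dividing by
  -- zero when `C = 0`.
  obtain ⟨S, hS, hSε⟩ := exists_finset_atoms μ (ε := ε / (|C| + 1)) (by positivity)
  have hSi : Integrable ((quantile μ ⁻¹' (S : Set ℝ)).indicator g) unitMeasure :=
    hgi.indicator (hq S.measurableSet)
  refine ⟨_, hki.add hSi, ?_, ?_⟩
  · have hd : MeasurableSet (T \ (S : Set ℝ)) := hTm.diff S.measurableSet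
    calc _ ≤ ∫ u, (quantile μ ⁻¹' (T \ (S : Set ℝ))).indicator (fun _ => |C|) u ∂unitMeasure := by
          refine integral_mono_ae (hgi.sub (hki.add hSi)).abs
            ((integrable_const _).indicator (hq hd)) ?_
          filter_upwards [hkae, hC] with u hu hCu
          change |g u - (Tᶜ.indicator (fun x => g (cdf μ x)) (quantile μ u) +
            (quantile μ ⁻¹' (S : Set ℝ)).indicator g u)| ≤ _
          rw [hu]
          by_cases h3 : quantile μ u ∈ T
          · rw [Set.indicator_of_notMem (show u ∉ quantile μ ⁻¹' Tᶜ from fun h => h h3), zero_add]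
            by_cases h4 : quantile μ u ∈ (S : Set ℝ)
            · rw [Set.indicator_of_mem (show u ∈ quantile μ ⁻¹' (S : Set ℝ) from h4),
                Set.indicator_of_notMem fun h => h.2 h4, sub_self, abs_zero]
            · rw [Set.indicator_of_notMem (show u ∉ quantile μ ⁻¹' (S : Set ℝ) from h4), sub_zero,
                Set.indicator_of_mem (show u ∈ quantile μ ⁻¹' (T \ (S : Set ℝ)) from ⟨h3, h4⟩)]
              exact hCu.trans (le_abs_self C)
          · have h4 : quantile μ u ∉ (S : Set ℝ) := fun h5 => h3 (hS _ h5)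
            rw [Set.indicator_of_mem (show u ∈ quantile μ ⁻¹' Tᶜ from h3),
              Set.indicator_of_notMem (show u ∉ quantile μ ⁻¹' (S : Set ℝ) from h4),
              Set.indicator_of_notMem fun h => h3 h.1, add_zero, sub_self, abs_zero]
      _ = μ.real (T \ (S : Set ℝ)) * |C| := by
          rw [integral_indicator (hq hd), setIntegral_const, smul_eq_mul]
          congr 1
          rw [← map_measureReal_apply hq hd, map_quantile]
      _ ≤ ε / (|C| + 1) * |C| := by gcongr
      _ ≤ ε / (|C| + 1) * (|C| + 1) := by gcongr; linarith
      _ = ε := by field_simp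
  · refine squeeze_zero (fun n => condGap_nonneg _ _ _) (fun n => condGap_add_le hki hSi) ?_
    have := h1.add (hfinite S hS)
    rwa [add_zero] at this

end Atoms

/-! ### Disintegrations of the coupling and an upper bound for the adapted distance -/

section Disintegration

variable {μ ν : Measure ℝ} {κ : Kernel ℝ ℝ}

lemma measurable_kernel_Iic [IsMarkovKernel κ] {f : ℝ → ℝ} (hf : Measurable f) :
    Measurable fun z : ℝ × ℝ => κ (f z.1) (Set.Iic z.2) := by
  have hset : MeasurableSet {p : (ℝ × ℝ) × ℝ | p.2 ≤ p.1.2} :=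
    measurableSet_le measurable_snd (measurable_snd.comp measurable_fst)
  exact Kernel.measurable_kernel_prodMk_left_of_finite
    (κ := κ.comap (fun z : ℝ × ℝ => f z.1) (hf.comp measurable_fst)) hset fun _ => inferInstance

lemma measurable_kernel_Iic_real [IsMarkovKernel κ] {f : ℝ → ℝ} (hf : Measurable f) :
    Measurable fun z : ℝ × ℝ => (κ (f z.1)).real (Set.Iic z.2) :=
  (measurable_kernel_Iic hf).ennreal_toReal

lemma PsiOrdered.measurable_liftCdf_left (h : PsiOrdered μ ν) (y : ℝ) :
    Measurable fun u => liftCdf μ ν u y :=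
  h.measurable_liftCdf.comp (measurable_prodMk_right (y := y))

lemma PsiOrdered.ae_abs_liftCdf_le (h : PsiOrdered μ ν) (y : ℝ) :
    ∀ᵐ u ∂unitMeasure, |liftCdf μ ν u y| ≤ 1 := by
  filter_upwards [h.ae_goodWeight] with u hu
  rw [abs_of_nonneg (hu.liftCdf_mem y).1]
  exact (hu.liftCdf_mem y).2

lemma PsiOrdered.integrable_liftCdf (h : PsiOrdered μ ν) (y : ℝ) :
    Integrable (fun u => liftCdf μ ν u y) unitMeasure :=
  Integrable.of_bound (h.measurable_liftCdf_left y).aestronglyMeasurable 1 (h.ae_abs_liftCdf_le y)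

/-- The distribution functions of the disintegration are conditional expectations of the
distribution functions of the lifted kernels. -/
lemma PsiOrdered.kernel_ae_eq_condExp (h : PsiOrdered μ ν) [IsMarkovKernel κ]
    [(couplingIT μ ν).IsCondKernel κ] (y : ℝ) :
    (fun u => (κ (quantile μ u)).real (Set.Iic y)) =ᵐ[unitMeasure]
      unitMeasure[fun u => liftCdf μ ν u y | sig (quantile μ)] := by
  have := h.left_prob
  have := h.right_prob
  have hphi := measurable_phi h.left_int h.right_int
  have hw := measurable_weight h.left_int h.right_int
  have hq : Measurable (quantile μ) := measurable_quantile
  have hKm : Measurable fun x => κ x (Set.Iic y) := κ.measurable_coe measurableSet_Iic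
  have hKr : Measurable fun x => (κ x).real (Set.Iic y) := hKm.ennreal_toReal
  have hLm := h.measurable_liftCdf_left y
  have hLi := h.integrable_liftCdf y
  have hKi : Integrable (fun u => (κ (quantile μ u)).real (Set.Iic y)) unitMeasure := by
    refine Integrable.of_bound (hKr.comp hq).aestronglyMeasurable 1 (ae_of_all _ fun u => ?_)
    rw [Real.norm_eq_abs, abs_of_nonneg measureReal_nonneg]
    exact measureReal_le_one
  refine ae_eq_condExp_of_forall_setIntegral_eq hq.comap_le hLi (fun s _ _ => hKi.integrableOn)
    (fun s hs _ => ?_) ?_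
  · obtain ⟨B, hB, rfl⟩ := hs
    -- Both integrals over {F_μ⁻¹ ∈ B} compute the mass of B × (-∞, y]: once through the
    -- disintegration, once through the lifted kernels.
    have e1 : ∫⁻ u in quantile μ ⁻¹' B, κ (quantile μ u) (Set.Iic y) ∂unitMeasure =
        couplingIT μ ν (B ×ˢ Set.Iic y) := by
      conv_rhs => rw [← (couplingIT μ ν).disintegrate κ]
      rw [h.fst_couplingIT, Measure.compProd_apply_prod hB measurableSet_Iic,
        ← setLIntegral_map hB hKm hq, map_quantile]
    have e2 : ∫⁻ u in quantile μ ⁻¹' B, ENNReal.ofReal (liftCdf μ ν u y) ∂unitMeasure =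
        couplingIT μ ν (B ×ˢ Set.Iic y) := by
      have hBm : MeasurableSet (B ×ˢ Set.Iic y) := hB.prod measurableSet_Iic
      rw [← lintegral_indicator_one hBm,
        h.lintegral_couplingIT (measurable_one.indicator hBm),
        ← lintegral_indicator (hq hB)]
      refine lintegral_congr_ae ?_
      filter_upwards [h.ae_goodWeight] with u hu
      have h1 := hu.nonneg
      have h2 := sub_nonneg.2 hu.le_one
      by_cases hm : quantile μ u ∈ B
      · have key : ∀ z : ℝ, (B ×ˢ Set.Iic y).indicator (1 : ℝ × ℝ → ENNReal) (quantile μ u, z) =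
            if z ≤ y then 1 else 0 := by
          intro z
          by_cases hz : z ≤ y
          · rw [if_pos hz, Set.indicator_of_mem (Set.mk_mem_prod hm (show z ∈ Set.Iic y from hz)), Pi.one_apply]
          · rw [if_neg hz, Set.indicator_of_notMem fun h => hz h.2]
        rw [Set.indicator_of_mem (show u ∈ quantile μ ⁻¹' B from hm), liftCdf, key, key]
        simp only [Set.indicator_apply, Set.mem_Ici, Pi.one_apply]
        split_ifs <;> simp [← ENNReal.ofReal_add h1 h2]
      · rw [Set.indicator_of_notMem (show u ∉ quantile μ ⁻¹' B from hm),
          Set.indicator_of_notMem fun h => hm h.1, Set.indicator_of_notMem fun h => hm h.1]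
        simp
    have e3 : ∫ u in quantile μ ⁻¹' B, (κ (quantile μ u)).real (Set.Iic y) ∂unitMeasure =
        (couplingIT μ ν (B ×ˢ Set.Iic y)).toReal := by
      rw [← e1, integral_eq_lintegral_of_nonneg_ae (ae_of_all _ fun u => measureReal_nonneg)
        (hKr.comp hq).aestronglyMeasurable]
      simp
    rw [e3, ← e2, integral_eq_lintegral_of_nonneg_ae ?_ hLm.aestronglyMeasurable]
    filter_upwards [ae_restrict_of_ae h.ae_goodWeight] with u hu using (hu.liftCdf_mem y).1
  · exact (hKr.comp (comap_measurable _)).stronglyMeasurable.aestronglyMeasurable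

/-- The moments of the second marginal in terms of the quantile functions of the disintegration. -/
lemma PsiOrdered.lintegral_quantile_kernel (h : PsiOrdered μ ν) [IsMarkovKernel κ]
    [(couplingIT μ ν).IsCondKernel κ] {f : ℝ → ENNReal} (hf : Measurable f) :
    ∫⁻ u, ∫⁻ w, f (quantile (κ (quantile μ u)) w) ∂unitMeasure ∂unitMeasure = ∫⁻ y, f y ∂ν := by
  have := h.left_prob
  have := h.isProbabilityMeasure_couplingIT
  simp_rw [lintegral_quantile_comp hf]
  rw [lintegral_quantile_comp (f := fun x => ∫⁻ y, f y ∂κ x) hf.lintegral_kernel,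
    ← h.snd_couplingIT, Measure.snd, lintegral_map hf measurable_snd]
  conv_rhs => rw [← (couplingIT μ ν).disintegrate κ]
  rw [Measure.lintegral_compProd (f := fun z => f z.2) (by fun_prop), h.fst_couplingIT]

/-- The quantile functions of a kernel, set to zero outside of the unit interval. -/
noncomputable def kernelQuantile (κ : Kernel ℝ ℝ) (f : ℝ → ℝ) (z : ℝ × ℝ) : ℝ :=
  (Set.Ioo (0 : ℝ) 1).indicator (quantile (κ (f z.1))) z.2

lemma measurable_kernelQuantile [IsMarkovKernel κ] {f : ℝ → ℝ} (hf : Measurable f) :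
    Measurable (kernelQuantile κ f) := by
  have hs : MeasurableSet {z : ℝ × ℝ | z.2 ∈ Set.Ioo (0 : ℝ) 1} :=
    measurable_snd measurableSet_Ioo
  refine measurable_of_Iic fun x => ?_
  have hm : MeasurableSet {z : ℝ × ℝ | z.2 ≤ (κ (f z.1)).real (Set.Iic x)} := by
    refine measurableSet_le measurable_snd ?_
    exact ((κ.measurable_coe measurableSet_Iic).ennreal_toReal.comp hf).comp measurable_fst
  have key : ∀ z : ℝ × ℝ, z.2 ∈ Set.Ioo (0 : ℝ) 1 →
      (kernelQuantile κ f z ≤ x ↔ z.2 ≤ (κ (f z.1)).real (Set.Iic x)) := by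
    intro z hz
    rw [kernelQuantile, Set.indicator_of_mem hz, quantile_le_iff hz, cdf_eq_real]
  by_cases hx : 0 ≤ x
  · have : kernelQuantile κ f ⁻¹' Set.Iic x =
        ({z : ℝ × ℝ | z.2 ∈ Set.Ioo (0 : ℝ) 1} ∩ {z | z.2 ≤ (κ (f z.1)).real (Set.Iic x)}) ∪
          {z : ℝ × ℝ | z.2 ∈ Set.Ioo (0 : ℝ) 1}ᶜ := by
      ext z
      by_cases hz : z.2 ∈ Set.Ioo (0 : ℝ) 1
      · have := key z hz
        simp only [Set.mem_preimage, Set.mem_Iic, this, Set.mem_union, Set.mem_inter_iff,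
          Set.mem_compl_iff, Set.mem_ofPred_eq, hz, true_and, not_true_eq_false, or_false]
      · simp only [Set.mem_preimage, Set.mem_Iic, Set.mem_union, Set.mem_inter_iff,
          Set.mem_compl_iff, Set.mem_ofPred_eq, hz, false_and, not_false_eq_true, or_true,
          kernelQuantile, Set.indicator_of_notMem hz, hx]
    rw [this]
    exact (hs.inter hm).union hs.compl
  · have : kernelQuantile κ f ⁻¹' Set.Iic x =
        {z : ℝ × ℝ | z.2 ∈ Set.Ioo (0 : ℝ) 1} ∩ {z | z.2 ≤ (κ (f z.1)).real (Set.Iic x)} := by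
      ext z
      by_cases hz : z.2 ∈ Set.Ioo (0 : ℝ) 1
      · have := key z hz
        simp only [Set.mem_preimage, Set.mem_Iic, this, Set.mem_inter_iff,
          Set.mem_ofPred_eq, hz, true_and]
      · simp only [Set.mem_preimage, Set.mem_Iic, Set.mem_inter_iff,
          Set.mem_ofPred_eq, hz, false_and, kernelQuantile, Set.indicator_of_notMem hz, hx]
    rw [this]
    exact hs.inter hm

lemma kernelQuantile_ae (f : ℝ → ℝ) (u : ℝ) :
    ∀ᵐ w ∂unitMeasure, kernelQuantile κ f (u, w) = quantile (κ (f u)) w := by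
  filter_upwards [ae_unitMeasure_mem] with w hw
  exact Set.indicator_of_mem hw _

/-- The comonotone coupling is used twice: for the first marginals, and between the two conditional
laws at each level `u`. -/
lemma adaptedWasserstein_le {ρ : ℝ} (hρ : 1 ≤ ρ) {μ' ν' : Measure ℝ} (h : PsiOrdered μ ν)
    (h' : PsiOrdered μ' ν') (κ κ' : Kernel ℝ ℝ) [IsMarkovKernel κ] [IsMarkovKernel κ']
    [(couplingIT μ ν).IsCondKernel κ] [(couplingIT μ' ν').IsCondKernel κ'] :
    adaptedWasserstein ρ (couplingIT μ ν) (couplingIT μ' ν') ≤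
      (∫⁻ u, ‖quantile μ u - quantile μ' u‖ₑ ^ ρ ∂unitMeasure +
        ∫⁻ z, ‖kernelQuantile κ (quantile μ) z - kernelQuantile κ' (quantile μ') z‖ₑ ^ ρ
          ∂unitMeasure.prod unitMeasure) ^ (1 / ρ) := by
  have := h.left_prob
  have := h'.left_prob
  have hρ0 : 0 < ρ := by linarith
  have hχ := isCoupling_map (P := unitMeasure) (measurable_quantile (η := μ))
    (measurable_quantile (η := μ'))
  rw [map_quantile, map_quantile] at hχ
  have hχ' : IsCoupling (unitMeasure.map fun u => (quantile μ u, quantile μ' u))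
      (couplingIT μ ν).fst (couplingIT μ' ν').fst := by
    rwa [h.fst_couplingIT, h'.fst_couplingIT]
  refine (iInf_le_of_le κ <| iInf_le_of_le (show IsMarkovKernel κ from inferInstance) <|
    iInf_le_of_le (show (couplingIT μ ν).IsCondKernel κ from inferInstance) <|
    iInf_le_of_le κ' <| iInf_le_of_le (show IsMarkovKernel κ' from inferInstance) <|
    iInf_le_of_le (show (couplingIT μ' ν').IsCondKernel κ' from inferInstance) <|
    iInf_le_of_le (unitMeasure.map fun u => (quantile μ u, quantile μ' u)) <|
    iInf_le_of_le hχ' le_rfl).trans ?_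
  refine ENNReal.rpow_le_rpow ((lintegral_map_le _ _).trans ?_) (by positivity)
  have hm1 := measurable_kernelQuantile (κ := κ) (measurable_quantile (η := μ))
  have hm2 := measurable_kernelQuantile (κ := κ') (measurable_quantile (η := μ'))
  rw [lintegral_prod _ (by fun_prop), ← lintegral_add_left (by fun_prop)]
  refine lintegral_mono fun u => add_le_add_right ?_ _
  refine (wasserstein_rpow_le hρ0).trans (le_of_eq (lintegral_congr_ae ?_))
  filter_upwards [kernelQuantile_ae (κ := κ) (quantile μ) u,
    kernelQuantile_ae (κ := κ') (quantile μ') u] with w h1 h2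
  rw [h1, h2]

end Disintegration

/-! ### Proof of the stability theorem -/

section Stability

variable {μs νs : ℕ → Measure ℝ} {μ ν : Measure ℝ} {κs : ℕ → Kernel ℝ ℝ} {κ : Kernel ℝ ℝ}

/-- Convergence of the distribution functions of the disintegrations, level by level. -/
lemma ae_tendsto_integral_kernel (h : ∀ n, PsiOrdered (μs n) (νs n)) (hl : PsiOrdered μ ν)
    (hcμ : QuantileConv μs μ) (hcν : QuantileConv νs ν)
    (hJ : JumpsAsymptoticallyContained μs μ) [∀ n, IsMarkovKernel (κs n)] [IsMarkovKernel κ]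
    [∀ n, (couplingIT (μs n) (νs n)).IsCondKernel (κs n)] [(couplingIT μ ν).IsCondKernel κ]
    {γ : Measure ℝ} [SFinite γ] [NullSingletonClass γ] :
    ∀ᵐ y ∂γ, Tendsto (fun n => ∫⁻ u, ‖(κs n (quantile (μs n) u)).real (Set.Iic y) -
      (κ (quantile μ u)).real (Set.Iic y)‖ₑ ∂unitMeasure) atTop (𝓝 0) := by
  have := hl.left_prob
  -- For fixed `u` only two values of `y` are excluded, and γ does not charge points. Fubini turns
  -- this into convergence for almost every `u` at almost every fixed `y`.
  have hlift : ∀ᵐ u ∂unitMeasure, ∀ᵐ y ∂γ,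
      Tendsto (fun n => liftCdf (μs n) (νs n) u y) atTop (𝓝 (liftCdf μ ν u y)) := by
    filter_upwards [ae_tendsto_liftCdf h hl hcμ hcν] with u hu
    have h1 : ∀ a : ℝ, ∀ᵐ y ∂γ, y ≠ a := fun a => compl_mem_ae_iff.2 (measure_singleton a)
    filter_upwards [h1 (quantile ν u), h1 (quantile ν (phi μ ν u))] with y hy1 hy2
    exact hu y hy1 hy2
  rw [Measure.ae_ae_comm (measurableSet_tendsto_fun (fun n => (h n).measurable_liftCdf)
    hl.measurable_liftCdf)] at hlift
  filter_upwards [hlift] with y hy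
  have hLm := fun {μ ν : Measure ℝ} (h : PsiOrdered μ ν) => h.measurable_liftCdf_left y
  have hLb := fun {μ ν : Measure ℝ} (h : PsiOrdered μ ν) => h.ae_abs_liftCdf_le y
  have hLi := fun {μ ν : Measure ℝ} (h : PsiOrdered μ ν) => h.integrable_liftCdf y
  have h1 : Tendsto (fun n => ∫ u, |liftCdf (μs n) (νs n) u y - liftCdf μ ν u y| ∂unitMeasure)
      atTop (𝓝 0) := by
    rw [← integral_zero ℝ ℝ (μ := unitMeasure)]
    refine tendsto_integral_of_dominated_convergence (fun _ => 2)
      (fun n => ((hLm (h n)).sub (hLm hl)).abs.aestronglyMeasurable) (integrable_const _)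
      (fun n => ?_) ?_
    · filter_upwards [hLb (h n), hLb hl] with u h1 h2
      rw [Real.norm_eq_abs, abs_abs]
      exact (abs_sub _ _).trans (by linarith)
    · filter_upwards [hy] with u hu
      simpa using (hu.sub (tendsto_const_nhds (x := liftCdf μ ν u y))).abs
  have h2 := tendsto_condGap_quantile hcμ.ae hJ (hLm hl) (hLb hl)
  have h3 := h1.add h2
  rw [add_zero] at h3
  have hle : ∀ n, ∫⁻ u, ‖(κs n (quantile (μs n) u)).real (Set.Iic y) -
      (κ (quantile μ u)).real (Set.Iic y)‖ₑ ∂unitMeasure ≤ ENNReal.ofReal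
        (∫ u, |liftCdf (μs n) (νs n) u y - liftCdf μ ν u y| ∂unitMeasure +
          condGap unitMeasure (quantile (μs n)) (quantile μ) fun u => liftCdf μ ν u y) := by
    intro n
    -- With L_n, L the lifted distribution functions and E_n, E the two conditional expectations,
    -- E_n L_n - E L = E_n(L_n - L) + (E_n L - E L): a contraction term plus a gap with fixed
    -- integrand.
    set D : ℝ → ℝ := (fun u => liftCdf (μs n) (νs n) u y) - fun u => liftCdf μ ν u y with hD
    have i1 : Integrable (fun u => |(unitMeasure[D | sig (quantile (μs n))]) u|) unitMeasure :=
      integrable_condExp.abs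
    have i2 := integrable_condGap (P := unitMeasure) (quantile (μs n)) (quantile μ)
      fun u => liftCdf μ ν u y
    have hc := integral_abs_condExp_le (m := sig (quantile (μs n))) (μ := unitMeasure) D
    have hsum : ∫⁻ u, ‖(κs n (quantile (μs n) u)).real (Set.Iic y) -
        (κ (quantile μ u)).real (Set.Iic y)‖ₑ ∂unitMeasure ≤
        ∫⁻ u, ENNReal.ofReal (|(unitMeasure[D | sig (quantile (μs n))]) u| +
          |(unitMeasure[fun u => liftCdf μ ν u y | sig (quantile (μs n))]) u -
            (unitMeasure[fun u => liftCdf μ ν u y | sig (quantile μ)]) u|) ∂unitMeasure := by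
      refine lintegral_mono_ae ?_
      filter_upwards [(h n).kernel_ae_eq_condExp (κ := κs n) y, hl.kernel_ae_eq_condExp (κ := κ) y,
        condExp_sub (hLi (h n)) (hLi hl) (sig (quantile (μs n)))] with u h1 h2 h3
      rw [h1, h2, Real.enorm_eq_ofReal_abs]
      refine ENNReal.ofReal_le_ofReal ?_
      rw [hD, h3, Pi.sub_apply]
      exact abs_sub_le _ _ _
    refine hsum.trans ?_
    have i3 : Integrable (fun u => |(unitMeasure[D | sig (quantile (μs n))]) u| +
        |(unitMeasure[fun u => liftCdf μ ν u y | sig (quantile (μs n))]) u -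
          (unitMeasure[fun u => liftCdf μ ν u y | sig (quantile μ)]) u|) unitMeasure := i1.add i2
    rw [← ofReal_integral_eq_lintegral_ofReal i3
      (ae_of_all _ fun u => add_nonneg (abs_nonneg _) (abs_nonneg _)), integral_add i1 i2]
    exact ENNReal.ofReal_le_ofReal (add_le_add_left hc _)
  refine tendsto_of_tendsto_of_tendsto_of_le_of_le tendsto_const_nhds ?_ (fun _ => zero_le) hle
  have h4 := (ENNReal.continuous_ofReal.tendsto _).comp h3
  rwa [ENNReal.ofReal_zero] at h4

/-- Along a subsequence the quantile functions of the disintegrations converge almost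
everywhere. -/
lemma exists_subseq_tendsto_kernelQuantile (h : ∀ n, PsiOrdered (μs n) (νs n))
    (hl : PsiOrdered μ ν) (hcμ : QuantileConv μs μ) (hcν : QuantileConv νs ν)
    (hJ : JumpsAsymptoticallyContained μs μ) [∀ n, IsMarkovKernel (κs n)] [IsMarkovKernel κ]
    [∀ n, (couplingIT (μs n) (νs n)).IsCondKernel (κs n)] [(couplingIT μ ν).IsCondKernel κ] :
    ∃ ns : ℕ → ℕ, StrictMono ns ∧ ∀ᵐ z ∂unitMeasure.prod unitMeasure,
      Tendsto (fun n => kernelQuantile (κs (ns n)) (quantile (μs (ns n))) z) atTop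
        (𝓝 (kernelQuantile κ (quantile μ) z)) := by
  -- A Gaussian law is finite, so dominated convergence with bound 1 works in `y`, and it has the
  -- null sets of Lebesgue measure, so sets of full measure are dense.
  set γ : Measure ℝ := gaussianReal 0 1 with hγ
  have : NullSingletonClass γ := nullSingletonClass_gaussianReal one_ne_zero
  set F : ℕ → ℝ × ℝ → ℝ := fun n z => (κs n (quantile (μs n) z.1)).real (Set.Iic z.2) with hF
  set G : ℝ × ℝ → ℝ := fun z => (κ (quantile μ z.1)).real (Set.Iic z.2) with hG
  have hFm : ∀ n, Measurable (F n) := fun n => measurable_kernel_Iic_real measurable_quantile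
  have hGm : Measurable G := measurable_kernel_Iic_real measurable_quantile
  have hL1 : Tendsto (fun n => ∫⁻ z, ‖F n z - G z‖ₑ ∂unitMeasure.prod γ) atTop (𝓝 0) := by
    have hm : ∀ n, Measurable fun z => ‖F n z - G z‖ₑ := fun n => ((hFm n).sub hGm).enorm
    simp_rw [fun n => lintegral_prod_symm' (μ := unitMeasure) (ν := γ) _ (hm n)]
    rw [← lintegral_zero (μ := γ)]
    refine tendsto_lintegral_of_dominated_convergence (fun _ => 1)
      (fun n => (hm n).lintegral_prod_left') (fun n => ae_of_all _ fun y => ?_) (by simp) ?_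
    · calc _ ≤ ∫⁻ _, 1 ∂unitMeasure := by
            refine lintegral_mono fun u => ?_
            rw [Real.enorm_eq_ofReal_abs, ← ENNReal.ofReal_one]
            refine ENNReal.ofReal_le_ofReal (abs_le.2 ⟨?_, ?_⟩)
            · have h1 : 0 ≤ F n (u, y) := measureReal_nonneg
              have h2 : G (u, y) ≤ 1 := measureReal_le_one
              linarith
            · have h1 : 0 ≤ G (u, y) := measureReal_nonneg
              have h2 : F n (u, y) ≤ 1 := measureReal_le_one
              linarith
        _ = 1 := by simp
    · exact ae_tendsto_integral_kernel h hl hcμ hcν hJ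
  have hmeas : TendstoInMeasure (unitMeasure.prod γ) F atTop G := by
    refine tendstoInMeasure_of_tendsto_eLpNorm one_ne_zero
      (fun n => (hFm n).aestronglyMeasurable) hGm.aestronglyMeasurable ?_
    simpa only [eLpNorm_one_eq_lintegral_enorm, Pi.sub_apply] using hL1
  obtain ⟨ns, hns, hae⟩ := hmeas.exists_seq_tendsto_ae
  refine ⟨ns, hns, ?_⟩
  rw [Measure.ae_prod_iff_ae_ae (measurableSet_tendsto_fun
    (fun n => measurable_kernelQuantile measurable_quantile)
    (measurable_kernelQuantile measurable_quantile))]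
  filter_upwards [Measure.ae_ae_of_ae_prod hae] with u hu
  have hu' := (gaussianReal_absolutelyContinuous' 0 one_ne_zero).ae_le hu
  have hD := Measure.dense_of_ae hu'
  have hq : ∀ᵐ w ∂unitMeasure, Tendsto (fun n => quantile (κs (ns n) (quantile (μs (ns n)) u)) w)
      atTop (𝓝 (quantile (κ (quantile μ u)) w)) := by
    refine tendsto_quantile_ae hD fun y hy => ?_
    simp_rw [cdf_eq_real]
    exact hy
  filter_upwards [hq, ae_unitMeasure_mem] with w hw hw01
  simpa only [kernelQuantile, Set.indicator_of_mem hw01] using hw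

/-- Averaged over the first marginal, the conditional laws recombine to the second one, so the ρ-th
moments on the unit square are those of ν_n and ν. Their convergence excludes escaping mass and
upgrades almost everywhere convergence to L^ρ. -/
lemma exists_subseq_tendsto_adaptedWasserstein {ρ : ℝ} (hρ : 1 ≤ ρ)
    (h : ∀ n, PsiOrdered (μs n) (νs n)) (hl : PsiOrdered μ ν)
    (hcμ : QuantileConv μs μ) (hcν : QuantileConv νs ν)
    (hμρ : Tendsto (fun n => ∫⁻ u, ‖quantile (μs n) u - quantile μ u‖ₑ ^ ρ ∂unitMeasure)
      atTop (𝓝 0))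
    (hfin : ∫⁻ y, ‖y‖ₑ ^ ρ ∂ν ≠ ⊤)
    (hνρ : Tendsto (fun n => ∫⁻ y, ‖y‖ₑ ^ ρ ∂νs n) atTop (𝓝 (∫⁻ y, ‖y‖ₑ ^ ρ ∂ν)))
    (hJ : JumpsAsymptoticallyContained μs μ) :
    ∃ ns : ℕ → ℕ, Tendsto (fun n => adaptedWasserstein ρ
      (couplingIT (μs (ns n)) (νs (ns n))) (couplingIT μ ν)) atTop (𝓝 0) := by
  have hρ0 : 0 < ρ := by linarith
  have := fun n => (h n).isProbabilityMeasure_couplingIT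
  have := hl.isProbabilityMeasure_couplingIT
  set κs : ℕ → Kernel ℝ ℝ := fun n => (couplingIT (μs n) (νs n)).condKernel
  set κ : Kernel ℝ ℝ := (couplingIT μ ν).condKernel
  obtain ⟨ns, hns, hae⟩ := exists_subseq_tendsto_kernelQuantile (κs := κs) (κ := κ) h hl hcμ hcν hJ
  refine ⟨ns, ?_⟩
  have hmom : ∀ {μ ν : Measure ℝ} (κ : Kernel ℝ ℝ), PsiOrdered μ ν → IsMarkovKernel κ →
      (couplingIT μ ν).IsCondKernel κ →
      ∫⁻ z, ‖kernelQuantile κ (quantile μ) z‖ₑ ^ ρ ∂unitMeasure.prod unitMeasure =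
        ∫⁻ y, ‖y‖ₑ ^ ρ ∂ν := by
    intro μ ν κ h _ _
    have hm := measurable_kernelQuantile (κ := κ) (measurable_quantile (η := μ))
    rw [lintegral_prod _ (by fun_prop), ← h.lintegral_quantile_kernel (κ := κ)
      (f := fun y => ‖y‖ₑ ^ ρ) (by fun_prop)]
    refine lintegral_congr fun u => lintegral_congr_ae ?_
    filter_upwards [kernelQuantile_ae (κ := κ) (quantile μ) u] with w hw
    rw [hw]
  have hQ := tendsto_lintegral_enorm_sub_rpow hρ
    (fun n => (measurable_kernelQuantile (κ := κs (ns n))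
      (measurable_quantile (η := μs (ns n)))).aemeasurable)
    (measurable_kernelQuantile (κ := κ) (measurable_quantile (η := μ))).aemeasurable hae
    (by rwa [hmom κ hl inferInstance inferInstance]) (by
      rw [hmom κ hl inferInstance inferInstance]
      simp_rw [fun n => hmom (κs (ns n)) (h (ns n)) inferInstance inferInstance]
      exact hνρ.comp hns.tendsto_atTop)
  have hsum := (hμρ.comp hns.tendsto_atTop).add hQ
  have hpow := (ENNReal.continuous_rpow_const (y := 1 / ρ)).tendsto _ |>.comp hsum
  rw [add_zero, ENNReal.zero_rpow_of_pos (by positivity)] at hpow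
  exact tendsto_of_tendsto_of_tendsto_of_le_of_le tendsto_const_nhds hpow (fun _ => zero_le)
    fun n => adaptedWasserstein_le hρ (h (ns n)) hl (κs (ns n)) κ

lemma quantileConv_of_wasserstein {ρ : ℝ} (hρ : 1 ≤ ρ) (hμs : ∀ n, MemP ρ (μs n))
    (hμ : MemP ρ μ) (h : Tendsto (fun n => wasserstein ρ (μs n) μ) atTop (𝓝 0)) :
    QuantileConv μs μ := by
  have := fun n => (hμs n).isProbabilityMeasure
  have := hμ.isProbabilityMeasure
  refine ⟨fun y hy => tendsto_cdf_of_wasserstein (by linarith) h hy, ?_⟩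
  exact tendsto_integral_abs_of_lintegral
    (fun n => (measurable_quantile.sub measurable_quantile).aestronglyMeasurable)
    (tendsto_lintegral_quantile_sub_one hρ (hμ.moment_ne_top (by linarith)) h)

/-- Stability of the inverse transform martingale coupling in adapted Wasserstein distance. -/
theorem tendsto_adaptedWasserstein_couplingIT {ρ : ℝ} (hρ : 1 ≤ ρ) (hμs : ∀ n, MemP ρ (μs n))
    (hνs : ∀ n, MemP ρ (νs n)) (hμ : MemP ρ μ) (hν : MemP ρ ν)
    (hcx : ∀ n, ConvexOrder (μs n) (νs n))
    (hWμ : Tendsto (fun n => wasserstein ρ (μs n) μ) atTop (𝓝 0))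
    (hWν : Tendsto (fun n => wasserstein ρ (νs n) ν) atTop (𝓝 0))
    (hJ : JumpsAsymptoticallyContained μs μ) :
    Tendsto (fun n => adaptedWasserstein ρ (couplingIT (μs n) (νs n)) (couplingIT μ ν))
      atTop (𝓝 0) := by
  have := fun n => (hμs n).isProbabilityMeasure
  have := hμ.isProbabilityMeasure
  have h : ∀ n, PsiOrdered (μs n) (νs n) := fun n =>
    (hcx n).psiOrdered (hμs n).isProbabilityMeasure (hνs n).isProbabilityMeasure
      ((hμs n).integrable_id hρ) ((hνs n).integrable_id hρ)
  have hcμ := quantileConv_of_wasserstein hρ hμs hμ hWμ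
  have hcν := quantileConv_of_wasserstein hρ hνs hν hWν
  have hl : PsiOrdered μ ν := PsiOrdered.of_tendsto h hμ.isProbabilityMeasure
    hν.isProbabilityMeasure (hμ.integrable_id hρ) (hν.integrable_id hρ) hcμ hcν
  have hρ0 : 0 ≤ ρ := by linarith
  -- Every hypothesis, including the condition on the jumps, passes to subsequences, so it suffices
  -- to extract a convergent one from each.
  refine tendsto_of_subseq_tendsto fun ns hns => ?_
  refine exists_subseq_tendsto_adaptedWasserstein (μs := fun n => μs (ns n))
    (νs := fun n => νs (ns n)) hρ (fun n => h (ns n)) hl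
    (quantileConv_of_wasserstein hρ (fun n => hμs (ns n)) hμ (hWμ.comp hns))
    (quantileConv_of_wasserstein hρ (fun n => hνs (ns n)) hν (hWν.comp hns))
    ((tendsto_lintegral_quantile_sub hρ (hμ.moment_ne_top hρ0) hWμ).comp hns)
    (hν.moment_ne_top hρ0)
    ((tendsto_moment_of_wasserstein hρ (hν.moment_ne_top hρ0) hWν).comp hns) fun x hx => ?_
  obtain ⟨xs, hxs⟩ := hJ x hx
  exact ⟨fun n => xs (ns n), hxs.comp hns⟩

end Stability

/-! ### Uniform distributions: convex order and distance to two-point laws -/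

section Uniform

lemma isProbabilityMeasure_uniformIoo {a b : ℝ} (h : a < b) :
    IsProbabilityMeasure (uniformIoo a b) :=
  cond_isProbabilityMeasure_of_finite (by simp [h]) (by simp)

lemma uniformIoo_eq (a b : ℝ) : uniformIoo a b =
    (ENNReal.ofReal (b - a))⁻¹ • volume.restrict (Set.Ioo a b) := by
  rw [uniformIoo, ProbabilityTheory.cond, Real.volume_Ioo]

lemma uniformIoo_singleton (a b x : ℝ) : uniformIoo a b {x} = 0 := by
  rw [uniformIoo_eq, Measure.smul_apply, measure_singleton, smul_zero]

lemma ae_uniformIoo_mem (a b : ℝ) : ∀ᵐ x ∂uniformIoo a b, x ∈ Set.Ioo a b := by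
  rw [uniformIoo_eq]
  exact Measure.ae_smul_measure (ae_restrict_mem measurableSet_Ioo) _

lemma map_mul_uniformIoo {r : ℝ} (hr : 0 < r) :
    (uniformIoo (-1) 1).map (fun x => r * x) = uniformIoo (-r) r := by
  ext s hs
  have hm : Measurable fun x : ℝ => r * x := by fun_prop
  rw [Measure.map_apply hm hs, uniformIoo_eq, uniformIoo_eq, Measure.smul_apply,
    Measure.smul_apply, Measure.restrict_apply (hm hs), Measure.restrict_apply hs]
  have hset : (fun x : ℝ => r * x) ⁻¹' s ∩ Set.Ioo (-1) 1 =
      (fun x : ℝ => r * x) ⁻¹' (s ∩ Set.Ioo (-r) r) := by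
    ext x
    simp only [Set.mem_inter_iff, Set.mem_preimage, Set.mem_Ioo]
    refine and_congr_right fun _ => and_congr ?_ ?_
    · constructor <;> intro h <;> nlinarith
    · constructor <;> intro h <;> nlinarith
  rw [hset, Real.volume_preimage_mul_left hr.ne', smul_eq_mul, smul_eq_mul, ← mul_assoc]
  congr 1
  rw [abs_of_pos (inv_pos.2 hr), ← ENNReal.ofReal_inv_of_pos (by norm_num),
    ← ENNReal.ofReal_inv_of_pos (by linarith), ← ENNReal.ofReal_mul (by norm_num)]
  congr 1
  field_simp

lemma map_neg_uniformIoo : (uniformIoo (-1) 1).map (fun x => -x) = uniformIoo (-1) 1 := by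
  ext s hs
  rw [Measure.map_apply measurable_neg hs, uniformIoo_eq, Measure.smul_apply,
    Measure.smul_apply, Measure.restrict_apply (measurable_neg hs), Measure.restrict_apply hs]
  have hset : (fun x : ℝ => -x) ⁻¹' s ∩ Set.Ioo (-1) 1 = -(s ∩ Set.Ioo (-1) 1) := by
    ext x
    simp only [Set.mem_inter_iff, Set.mem_preimage, Set.mem_Ioo, Set.mem_neg]
    refine and_congr_right fun _ => ?_
    constructor <;> rintro ⟨h1, h2⟩ <;> constructor <;> linarith
  rw [hset, Measure.measure_neg]

/-- Contractions of the uniform distribution on `(-1, 1)` are dominated in the convex order. -/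
lemma convexOrder_map_mul {r : ℝ} (h0 : 0 ≤ r) (h1 : r ≤ 1) :
    ConvexOrder ((uniformIoo (-1) 1).map fun x => r * x) (uniformIoo (-1) 1) := by
  intro f hf hfμ hfν
  have hm : Measurable fun x : ℝ => r * x := by fun_prop
  have hneg : MeasurePreserving (fun x : ℝ => -x) (uniformIoo (-1) 1) (uniformIoo (-1) 1) :=
    ⟨measurable_neg, map_neg_uniformIoo⟩
  have hfn : Integrable (fun x => f (-x)) (uniformIoo (-1) 1) :=
    hneg.integrable_comp_of_integrable hfν
  have hfr : Integrable (fun x => f (r * x)) (uniformIoo (-1) 1) :=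
    (integrable_map_measure hfμ.aestronglyMeasurable hm.aemeasurable).1 hfμ
  rw [integral_map hm.aemeasurable hfμ.aestronglyMeasurable]
  have hsymm : ∫ x, f (-x) ∂uniformIoo (-1) 1 = ∫ x, f x ∂uniformIoo (-1) 1 := by
    conv_rhs => rw [← map_neg_uniformIoo]
    rw [integral_map measurable_neg.aemeasurable]
    rw [map_neg_uniformIoo]
    exact hfν.aestronglyMeasurable
  -- The identity rx = ((1+r)/2) x + ((1-r)/2)(-x) is combined with convexity; by symmetry of the
  -- uniform law both terms have the same integral.
  calc ∫ x, f (r * x) ∂uniformIoo (-1) 1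
      ≤ ∫ x, ((1 + r) / 2 * f x + (1 - r) / 2 * f (-x)) ∂uniformIoo (-1) 1 := by
        refine integral_mono hfr ((hfν.const_mul _).add (hfn.const_mul _)) fun x => ?_
        have := hf.2 (Set.mem_univ x) (Set.mem_univ (-x))
          (show (0 : ℝ) ≤ (1 + r) / 2 by linarith) (show (0 : ℝ) ≤ (1 - r) / 2 by linarith)
          (by ring)
        simp only [smul_eq_mul] at this
        refine le_trans (le_of_eq ?_) this
        congr 1
        ring
    _ = ∫ x, f x ∂uniformIoo (-1) 1 := by
        rw [integral_add (hfν.const_mul _) (hfn.const_mul _), integral_const_mul,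
          integral_const_mul, hsymm]
        ring

lemma memP_uniformIoo {ρ : ℝ} (hρ : 0 ≤ ρ) {r : ℝ} (hr : 0 < r) :
    MemP ρ (uniformIoo (-r) r) := by
  have := isProbabilityMeasure_uniformIoo (show -r < r by linarith)
  refine ⟨this, Integrable.of_bound (by fun_prop) (r ^ ρ) ?_⟩
  filter_upwards [ae_uniformIoo_mem (-r) r] with x hx
  rw [Real.norm_eq_abs, abs_of_nonneg (by positivity)]
  exact Real.rpow_le_rpow (abs_nonneg x) (abs_le.2 ⟨hx.1.le, hx.2.le⟩) hρ

lemma memP_dirac_zero {ρ : ℝ} : MemP ρ (Measure.dirac 0) :=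
  ⟨inferInstance, integrable_dirac (by simp)⟩

lemma dirac_zero_eq_map : (Measure.dirac (0 : ℝ)) = (uniformIoo (-1) 1).map fun x => 0 * x := by
  have := isProbabilityMeasure_uniformIoo (show (-1 : ℝ) < 1 by norm_num)
  simp only [zero_mul]
  rw [Measure.map_const, measure_univ, one_smul]

lemma wasserstein_uniformIoo_dirac_le {ρ : ℝ} (hρ : 0 < ρ) {r : ℝ} (hr : 0 < r) :
    wasserstein ρ (uniformIoo (-r) r) (Measure.dirac 0) ≤ ENNReal.ofReal r := by
  have := isProbabilityMeasure_uniformIoo (show -r < r by linarith)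
  have h := isCoupling_map (P := uniformIoo (-r) r) (f := fun x => x) (g := fun _ => 0)
    measurable_id measurable_const
  rw [Measure.map_id', Measure.map_const, measure_univ, one_smul] at h
  refine (iInf₂_le (_ : Measure (ℝ × ℝ)) h).trans ?_
  have h1 : ∫⁻ z, ‖z.1 - z.2‖ₑ ^ ρ ∂(uniformIoo (-r) r).map (fun x => (x, (0 : ℝ))) ≤
      ENNReal.ofReal r ^ ρ := by
    refine (lintegral_map_le _ _).trans ?_
    calc _ ≤ ∫⁻ _, ENNReal.ofReal r ^ ρ ∂uniformIoo (-r) r := by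
          refine lintegral_mono_ae ?_
          filter_upwards [ae_uniformIoo_mem (-r) r] with x hx
          rw [sub_zero, Real.enorm_eq_ofReal_abs]
          exact ENNReal.rpow_le_rpow
            (ENNReal.ofReal_le_ofReal (abs_le.2 ⟨hx.1.le, hx.2.le⟩)) hρ.le
      _ = _ := by rw [lintegral_const, measure_univ, mul_one]
  calc _ ≤ (ENNReal.ofReal r ^ ρ) ^ (1 / ρ) := ENNReal.rpow_le_rpow h1 (by positivity)
    _ = _ := by rw [← ENNReal.rpow_mul, mul_one_div_cancel hρ.ne', ENNReal.rpow_one]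

/-- Without atoms F_{μ_n} equals its left limits, so the overlap expression is never positive, while
the atom at 0 has mass 1. -/
lemma not_jumpsAsymptoticallyContained_dirac {μs : ℕ → Measure ℝ}
    [∀ n, IsProbabilityMeasure (μs n)] (h : ∀ n x, μs n {x} = 0) :
    ¬ JumpsAsymptoticallyContained μs (Measure.dirac 0) := by
  intro hJ
  obtain ⟨xs, hxs⟩ := hJ 0 (by simp)
  have h1 : (Measure.dirac (0 : ℝ)).real {0} ≤ 0 := by
    refine le_of_tendsto' hxs fun n => ?_
    have h2 := real_singleton_eq (μ := μs n) (xs n)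
    rw [measureReal_def, h, ENNReal.toReal_zero] at h2
    have h3 := min_le_left (cdf (μs n) (xs n)) (cdf (Measure.dirac (0 : ℝ)) 0)
    have h4 := le_max_left (Function.leftLim (cdf (μs n)) (xs n))
      (Function.leftLim (cdf (Measure.dirac (0 : ℝ))) 0)
    linarith
  simp [measureReal_def] at h1
  linarith

/-- The integrand is a triangle of base 1 and height 1/2. With density 1/2 on (-1,1) its mean is at
most 1/8. -/
lemma lintegral_tent_le (c : ℝ) : ∫⁻ y, ENNReal.ofReal (1 / 2 - |y - c|) ≤ ENNReal.ofReal (1 / 4) := by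
  rw [lintegral_sub_right_eq_self (fun y => ENNReal.ofReal (1 / 2 - |y|)) c]
  have h1 : ∫⁻ y in Set.Ioc (-(1 / 2) : ℝ) 0, ENNReal.ofReal (1 / 2 + y) =
      ENNReal.ofReal (1 / 8) := by
    rw [← ofReal_integral_eq_lintegral_ofReal, ← intervalIntegral.integral_of_le (by norm_num)]
    · congr 1
      rw [intervalIntegral.integral_add (by simp) (by simp)]
      simp
      norm_num
    · exact (by fun_prop : Continuous fun y : ℝ => 1 / 2 + y).integrableOn_Ioc
    · filter_upwards [ae_restrict_mem measurableSet_Ioc] with y hy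
      have := hy.1
      change (0 : ℝ) ≤ 1 / 2 + y
      linarith
  have h2 : ∫⁻ y in Set.Ioc (0 : ℝ) (1 / 2), ENNReal.ofReal (1 / 2 - y) =
      ENNReal.ofReal (1 / 8) := by
    rw [← ofReal_integral_eq_lintegral_ofReal, ← intervalIntegral.integral_of_le (by norm_num)]
    · congr 1
      rw [intervalIntegral.integral_sub (by simp) (by simp)]
      simp
      norm_num
    · exact (by fun_prop : Continuous fun y : ℝ => 1 / 2 - y).integrableOn_Ioc
    · filter_upwards [ae_restrict_mem measurableSet_Ioc] with y hy
      have := hy.2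
      change (0 : ℝ) ≤ 1 / 2 - y
      linarith
  calc _ ≤ ∫⁻ y, ((Set.Ioc (-(1 / 2) : ℝ) 0).indicator (fun y => ENNReal.ofReal (1 / 2 + y)) y +
        (Set.Ioc (0 : ℝ) (1 / 2)).indicator (fun y => ENNReal.ofReal (1 / 2 - y)) y) := by
        refine lintegral_mono fun y => ?_
        rcases le_or_gt y (-(1 / 2)) with h3 | h3
        · rw [ENNReal.ofReal_of_nonpos (by rw [abs_of_nonpos (by linarith)]; linarith)]
          exact zero_le
        rcases le_or_gt y 0 with h4 | h4
        · rw [Set.indicator_of_mem (show y ∈ Set.Ioc (-(1 / 2) : ℝ) 0 from ⟨h3, h4⟩),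
            abs_of_nonpos h4, sub_neg_eq_add]
          exact le_self_add
        rcases le_or_gt y (1 / 2) with h5 | h5
        · rw [Set.indicator_of_mem (show y ∈ Set.Ioc (0 : ℝ) (1 / 2) from ⟨h4, h5⟩),
            abs_of_pos h4]
          exact le_add_self
        · rw [ENNReal.ofReal_of_nonpos (by rw [abs_of_pos h4]; linarith)]
          exact zero_le
    _ = ENNReal.ofReal (1 / 8) + ENNReal.ofReal (1 / 8) := by
        rw [lintegral_add_left ((by fun_prop : Measurable fun y : ℝ =>
          ENNReal.ofReal (1 / 2 + y)).indicator measurableSet_Ioc),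
          lintegral_indicator measurableSet_Ioc, lintegral_indicator measurableSet_Ioc, h1, h2]
    _ = _ := by
        rw [← ENNReal.ofReal_add (by norm_num) (by norm_num)]
        norm_num

lemma lintegral_uniformIoo_tent_le (c : ℝ) :
    ∫⁻ y, ENNReal.ofReal (1 / 2 - |y - c|) ∂uniformIoo (-1) 1 ≤ ENNReal.ofReal (1 / 8) := by
  rw [uniformIoo_eq, lintegral_smul_measure, smul_eq_mul,
    ← ENNReal.ofReal_inv_of_pos (by norm_num)]
  calc _ ≤ ENNReal.ofReal (1 - -1)⁻¹ * ENNReal.ofReal (1 / 4) := by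
        gcongr
        exact (setLIntegral_le_lintegral _ _).trans (lintegral_tent_le c)
    _ = _ := by
        rw [← ENNReal.ofReal_mul (by norm_num)]
        norm_num

/-- Two points cannot approximate the uniform distribution on `(-1, 1)` better than `1/4`. -/
lemma le_lintegral_min_uniformIoo (a b : ℝ) :
    ENNReal.ofReal (1 / 4) ≤
      ∫⁻ y, ENNReal.ofReal (min |y - a| |y - b|) ∂uniformIoo (-1) 1 := by
  have := isProbabilityMeasure_uniformIoo (show (-1 : ℝ) < 1 by norm_num)
  have h : ENNReal.ofReal (1 / 4) + ENNReal.ofReal (1 / 4) ≤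
      ∫⁻ y, ENNReal.ofReal (min |y - a| |y - b|) ∂uniformIoo (-1) 1 +
        ENNReal.ofReal (1 / 4) := by
    calc _ = ∫⁻ _, ENNReal.ofReal (1 / 2) ∂uniformIoo (-1) 1 := by
          rw [lintegral_const, measure_univ, mul_one, ← ENNReal.ofReal_add (by norm_num)
            (by norm_num)]
          norm_num
      -- Pointwise 1/2 is at most the distance to the nearer point plus the tent at that point. Two
      -- tents cost at most 1/8 each, leaving 1/2 - 1/4 = 1/4.
      _ ≤ ∫⁻ y, (ENNReal.ofReal (min |y - a| |y - b|) + (ENNReal.ofReal (1 / 2 - |y - a|) +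
          ENNReal.ofReal (1 / 2 - |y - b|))) ∂uniformIoo (-1) 1 := by
          refine lintegral_mono fun y => ?_
          rcases le_total |y - a| |y - b| with h | h
          · rw [min_eq_left h]
            calc _ ≤ ENNReal.ofReal |y - a| + ENNReal.ofReal (1 / 2 - |y - a|) := by
                  refine le_trans (ENNReal.ofReal_le_ofReal (by linarith)) ENNReal.ofReal_add_le
              _ ≤ _ := by gcongr; exact le_self_add
          · rw [min_eq_right h]
            calc _ ≤ ENNReal.ofReal |y - b| + ENNReal.ofReal (1 / 2 - |y - b|) := by
                  refine le_trans (ENNReal.ofReal_le_ofReal (by linarith)) ENNReal.ofReal_add_le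
              _ ≤ _ := by gcongr; exact le_add_self
      _ = ∫⁻ y, ENNReal.ofReal (min |y - a| |y - b|) ∂uniformIoo (-1) 1 +
          (∫⁻ y, ENNReal.ofReal (1 / 2 - |y - a|) ∂uniformIoo (-1) 1 +
            ∫⁻ y, ENNReal.ofReal (1 / 2 - |y - b|) ∂uniformIoo (-1) 1) := by
          rw [lintegral_add_left (by fun_prop), lintegral_add_left (by fun_prop)]
      _ ≤ _ := by
          gcongr
          refine (add_le_add (lintegral_uniformIoo_tent_le a)
            (lintegral_uniformIoo_tent_le b)).trans (le_of_eq ?_)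
          rw [← ENNReal.ofReal_add (by norm_num) (by norm_num)]
          norm_num
  exact (ENNReal.add_le_add_iff_right (by simp)).1 h

/-- Under any coupling |x - y| is at least the distance from `y` to the nearer of the two points;
Jensen's inequality reduces order ρ to order 1. -/
lemma le_wasserstein_uniformIoo {ρ : ℝ} (hρ : 1 ≤ ρ) {η : Measure ℝ} [IsProbabilityMeasure η]
    {a b : ℝ} (h : ∀ᵐ x ∂η, x = a ∨ x = b) :
    ENNReal.ofReal (1 / 4) ≤ wasserstein ρ η (uniformIoo (-1) 1) := by
  refine le_iInf₂ fun π hπ => ?_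
  have := hπ.isProbabilityMeasure
  refine le_trans ?_ (lintegral_enorm_le_rpow hρ (f := fun z : ℝ × ℝ => z.1 - z.2) (by fun_prop))
  refine (le_lintegral_min_uniformIoo a b).trans ?_
  rw [← hπ.lintegral_snd (f := fun y => ENNReal.ofReal (min |y - a| |y - b|)) (by fun_prop)]
  rw [← hπ.1, Measure.fst] at h
  refine lintegral_mono_ae ?_
  filter_upwards [ae_of_ae_map measurable_fst.aemeasurable h] with z hz
  rw [Real.enorm_eq_ofReal_abs, abs_sub_comm z.1]
  refine ENNReal.ofReal_le_ofReal ?_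
  rcases hz with hz | hz
  · rw [hz]; exact min_le_left _ _
  · rw [hz]; exact min_le_right _ _

end Uniform

/-! ### Necessity of the condition on the jumps -/

section Counterexample

variable {μ ν : Measure ℝ}

/-- If the first marginal has no atoms, the disintegration is carried by two points. -/
lemma PsiOrdered.ae_kernel_two_points (h : PsiOrdered μ ν) (hμ : ∀ x, μ {x} = 0)
    {κ : Kernel ℝ ℝ} [IsMarkovKernel κ] [(couplingIT μ ν).IsCondKernel κ] :
    ∀ᵐ x ∂μ, ∀ᵐ y ∂κ x, y = quantile ν (cdf μ x) ∨ y = quantile ν (phi μ ν (cdf μ x)) := by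
  have := h.left_prob
  have := h.right_prob
  have hphi := measurable_phi h.left_int h.right_int
  have hF : Measurable (cdf μ) := (monotone_cdf μ).measurable
  set S : Set (ℝ × ℝ) := {z | z.2 = quantile ν (cdf μ z.1) ∨
    z.2 = quantile ν (phi μ ν (cdf μ z.1))} with hS
  have hSm : MeasurableSet S :=
    (measurableSet_eq_fun (by fun_prop) (by fun_prop)).union
      (measurableSet_eq_fun (by fun_prop) (by fun_prop))
  have h0 : couplingIT μ ν Sᶜ = 0 := by
    rw [← lintegral_indicator_one hSm.compl,
      h.lintegral_couplingIT (measurable_one.indicator hSm.compl), ← lintegral_zero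
      (μ := unitMeasure)]
    refine lintegral_congr_ae ?_
    filter_upwards [ae_unitMeasure_mem] with u hu
    -- Without atoms the level `u` is recovered from x = F_μ⁻¹(u), so conditioning on `x` does not
    -- average the two-point kernels.
    have hFu : cdf μ (quantile μ u) = u := cdf_quantile_of_singleton hu (hμ _)
    have h1 : (quantile μ u, quantile ν (phi μ ν u)) ∈ S := Or.inr (by simp only [hFu])
    have h2 : (quantile μ u, quantile ν u) ∈ S := Or.inl (by simp only [hFu])
    rw [Set.indicator_of_notMem (Set.notMem_compl_iff.2 h1),
      Set.indicator_of_notMem (Set.notMem_compl_iff.2 h2)]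
    simp
  have h1 : ∀ᵐ z ∂couplingIT μ ν, z ∈ S := h0
  rw [← (couplingIT μ ν).disintegrate κ, h.fst_couplingIT] at h1
  exact Measure.ae_ae_of_ae_compProd h1

/-- The point 0 carries full mass, so the disintegration is determined there exactly and must be the
second marginal. -/
lemma kernel_eq_of_dirac (h : PsiOrdered (Measure.dirac 0) ν) {κ : Kernel ℝ ℝ} [IsMarkovKernel κ]
    [(couplingIT (Measure.dirac 0) ν).IsCondKernel κ] : κ 0 = ν := by
  have h1 := h.snd_couplingIT
  rw [← (couplingIT (Measure.dirac 0) ν).disintegrate κ, h.fst_couplingIT,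
    Measure.snd_compProd, Measure.dirac_bind κ.measurable] at h1
  exact h1

lemma le_adaptedWasserstein_uniformIoo {ρ : ℝ} (hρ : 1 ≤ ρ) (hμ : ∀ x, μ {x} = 0)
    (h : PsiOrdered μ (uniformIoo (-1) 1))
    (h0 : PsiOrdered (Measure.dirac 0) (uniformIoo (-1) 1)) :
    ENNReal.ofReal (1 / 4) ≤ adaptedWasserstein ρ (couplingIT μ (uniformIoo (-1) 1))
      (couplingIT (Measure.dirac 0) (uniformIoo (-1) 1)) := by
  have := h.left_prob
  have hρ0 : 0 < ρ := by linarith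
  refine le_iInf fun κ => le_iInf fun _ => le_iInf fun _ => le_iInf fun κ' => le_iInf fun _ =>
    le_iInf fun _ => le_iInf fun χ => le_iInf fun hχ => ?_
  rw [h.fst_couplingIT, h0.fst_couplingIT] at hχ
  have := hχ.isProbabilityMeasure
  have h1 : ∀ᵐ z ∂χ, ∀ᵐ y ∂κ z.1, y = quantile (uniformIoo (-1) 1) (cdf μ z.1) ∨
      y = quantile (uniformIoo (-1) 1) (phi μ (uniformIoo (-1) 1) (cdf μ z.1)) := by
    have h2 := h.ae_kernel_two_points hμ (κ := κ)
    have h3 : χ.map Prod.fst = μ := hχ.1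
    exact ae_of_ae_map measurable_fst.aemeasurable (h3.symm ▸ h2 : ∀ᵐ x ∂χ.map Prod.fst,
      ∀ᵐ y ∂κ x, y = quantile (uniformIoo (-1) 1) (cdf μ x) ∨
        y = quantile (uniformIoo (-1) 1) (phi μ (uniformIoo (-1) 1) (cdf μ x)))
  have h2 : ∀ᵐ z ∂χ, z.2 = 0 := by
    have h3 : ∀ᵐ x ∂Measure.dirac (0 : ℝ), x = 0 := by simp [ae_dirac_eq]
    rw [← hχ.2, Measure.snd] at h3
    exact ae_of_ae_map measurable_snd.aemeasurable h3
  have h3 : ENNReal.ofReal (1 / 4) ^ ρ ≤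
      ∫⁻ z, (‖z.1 - z.2‖ₑ ^ ρ + wasserstein ρ (κ z.1) (κ' z.2) ^ ρ) ∂χ := by
    calc _ = ∫⁻ _, ENNReal.ofReal (1 / 4) ^ ρ ∂χ := by
          rw [lintegral_const, measure_univ, mul_one]
      _ ≤ _ := by
          refine lintegral_mono_ae ?_
          filter_upwards [h1, h2] with z hz1 hz2
          rw [hz2, kernel_eq_of_dirac h0]
          exact (ENNReal.rpow_le_rpow (le_wasserstein_uniformIoo hρ hz1) hρ0.le).trans le_add_self
  calc ENNReal.ofReal (1 / 4) = (ENNReal.ofReal (1 / 4) ^ ρ) ^ (1 / ρ) := by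
        rw [← ENNReal.rpow_mul, mul_one_div_cancel hρ0.ne', ENNReal.rpow_one]
    _ ≤ _ := ENNReal.rpow_le_rpow h3 (by positivity)

end Counterexample

end ITMC

theorem mainTheorem4 (ρ : ℝ) (hρ : 1 ≤ ρ) :
    -- stability under the condition on the jumps, which holds when the limit is non-atomic
    (∀ (μs νs : ℕ → Measure ℝ) (μ ν : Measure ℝ),
      (∀ n, ITMC.MemP ρ (μs n)) → (∀ n, ITMC.MemP ρ (νs n)) →
      ITMC.MemP ρ μ → ITMC.MemP ρ ν →
      (∀ n, ITMC.ConvexOrder (μs n) (νs n)) →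
      Tendsto (fun n => ITMC.wasserstein ρ (μs n) μ) atTop (𝓝 0) →
      Tendsto (fun n => ITMC.wasserstein ρ (νs n) ν) atTop (𝓝 0) →
      (ITMC.JumpsAsymptoticallyContained μs μ →
        Tendsto (fun n => ITMC.adaptedWasserstein ρ
          (ITMC.couplingIT (μs n) (νs n)) (ITMC.couplingIT μ ν)) atTop (𝓝 0)) ∧
      ((∀ x, μ {x} = 0) → ITMC.JumpsAsymptoticallyContained μs μ)) ∧
    -- the condition on the jumps cannot be dropped
    (∃ (μs : ℕ → Measure ℝ) (μ ν : Measure ℝ),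
      (∀ n, μs n = ITMC.uniformIoo (-(1 / ((n : ℝ) + 1))) (1 / ((n : ℝ) + 1))) ∧
      μ = Measure.dirac 0 ∧ ν = ITMC.uniformIoo (-1) 1 ∧
      (∀ n, ITMC.MemP ρ (μs n)) ∧ ITMC.MemP ρ μ ∧ ITMC.MemP ρ ν ∧
      (∀ n, ITMC.ConvexOrder (μs n) ν) ∧
      Tendsto (fun n => ITMC.wasserstein ρ (μs n) μ) atTop (𝓝 0) ∧
      ¬ ITMC.JumpsAsymptoticallyContained μs μ ∧
      ∀ n, 1 / 4 ≤ ITMC.adaptedWasserstein ρ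
        (ITMC.couplingIT (μs n) ν) (ITMC.couplingIT μ ν)) := by
  have hρ0 : 0 < ρ := by linarith
  refine ⟨fun μs νs μ ν hμs hνs hμ hν hcx hWμ hWν => ⟨fun hJ =>
    ITMC.tendsto_adaptedWasserstein_couplingIT hρ hμs hνs hμ hν hcx hWμ hWν hJ,
    -- Without atoms the condition on the jumps is vacuous.
    fun h x hx => absurd (h x) hx.ne'⟩, ?_⟩
  have hr : ∀ n : ℕ, 0 < 1 / ((n : ℝ) + 1) := fun n => Nat.one_div_pos_of_nat
  have hr1 : ∀ n : ℕ, 1 / ((n : ℝ) + 1) ≤ 1 := fun n => by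
    rw [div_le_one (by positivity)]
    linarith [n.cast_nonneg (α := ℝ)]
  have hmem : ∀ n : ℕ, ITMC.MemP ρ
      (ITMC.uniformIoo (-(1 / ((n : ℝ) + 1))) (1 / ((n : ℝ) + 1))) :=
    fun n => ITMC.memP_uniformIoo hρ0.le (hr n)
  have hν : ITMC.MemP ρ (ITMC.uniformIoo (-1) 1) := ITMC.memP_uniformIoo hρ0.le one_pos
  have hμ : ITMC.MemP ρ (Measure.dirac 0) := ITMC.memP_dirac_zero
  have hcx : ∀ n : ℕ, ITMC.ConvexOrder
      (ITMC.uniformIoo (-(1 / ((n : ℝ) + 1))) (1 / ((n : ℝ) + 1))) (ITMC.uniformIoo (-1) 1) := by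
    intro n
    rw [← ITMC.map_mul_uniformIoo (hr n)]
    exact ITMC.convexOrder_map_mul (hr n).le (hr1 n)
  -- δ_0 is the contraction of the uniform law by the factor 0. The order is needed for the
  -- marginals of the limit coupling.
  have hcx0 : ITMC.ConvexOrder (Measure.dirac 0) (ITMC.uniformIoo (-1) 1) := by
    rw [ITMC.dirac_zero_eq_map]
    exact ITMC.convexOrder_map_mul le_rfl zero_le_one
  refine ⟨fun n => ITMC.uniformIoo (-(1 / ((n : ℝ) + 1))) (1 / ((n : ℝ) + 1)), Measure.dirac 0,
    ITMC.uniformIoo (-1) 1, fun _ => rfl, rfl, rfl, hmem, hμ, hν, hcx, ?_, ?_, fun n => ?_⟩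
  · have h1 : Tendsto (fun n : ℕ => ENNReal.ofReal (1 / ((n : ℝ) + 1))) atTop (𝓝 0) := by
      have h2 := (ENNReal.continuous_ofReal.tendsto 0).comp
        (tendsto_one_div_add_atTop_nhds_zero_nat (𝕜 := ℝ))
      rwa [ENNReal.ofReal_zero] at h2
    exact tendsto_of_tendsto_of_tendsto_of_le_of_le tendsto_const_nhds h1 (fun _ => zero_le)
      fun n => ITMC.wasserstein_uniformIoo_dirac_le hρ0 (hr n)
  · have := fun n => (hmem n).isProbabilityMeasure
    exact ITMC.not_jumpsAsymptoticallyContained_dirac fun n x => ITMC.uniformIoo_singleton _ _ x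
  · have h1 : ENNReal.ofReal (1 / 4) = 1 / 4 := by
      rw [ENNReal.ofReal_div_of_pos (by norm_num)]
      simp
    rw [← h1]
    exact ITMC.le_adaptedWasserstein_uniformIoo hρ (ITMC.uniformIoo_singleton _ _)
      ((hcx n).psiOrdered (hmem n).isProbabilityMeasure hν.isProbabilityMeasure
        ((hmem n).integrable_id hρ) (hν.integrable_id hρ))
      (hcx0.psiOrdered hμ.isProbabilityMeasure hν.isProbabilityMeasure
        (hμ.integrable_id hρ) (hν.integrable_id hρ))
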